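/- Let $M=\mathbb{H}^2/\Gamma$ be a hyperbolic surface, where $\Gamma=\pi_1(M)$ is a group of isometries of the hyperbolic plane $\mathbb{H}^2$ acting freely and properly discontinuously, and suppose that $\chi(M)<0$ (this includes the case $\chi(M)=-\infty$ of infinite first Betti number; $M$ is not assumed to be orientable or of finite area). A closed geodesic $\gamma$ is traversed once, so its length $l(\gamma)$ is its least positive period at unit speed; the lines above $\gamma$ are the geodesic lines of $\mathbb{H}^2$ which, parametrized at unit speed, lift $\gamma$. There is a sequence of closed geodesics $\gamma_n$ on $M$ and lines $l_n, m_n$ in $\mathbb{H}^2$ above $\gamma_n$ such that $$\frac{\text{length of the orthogonal projection of } m_n \text{ to } l_n}{l(\gamma_n)}\longrightarrow 1 \qquad (n\to\infty).$$ The examples can be chosen with $l_n$ and $m_n$ distinct and crossing for all $n$, and they can also be chosen with $l_n$ and $m_n$ disjoint for all $n$. More precisely, there are three pairwise disjoint geodesic lines $e_0,e_1,e_2$ in $\mathbb{H}^2$, none of which separates the other two (the edges of a triangle with ideal or ultra-ideal vertices), with reflections $\sigma_0,\sigma_1,\sigma_2$, such that $x=\sigma_2\sigma_0$ and $y=\sigma_2\sigma_1$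 lie in $\Gamma$. The cover $F=\mathbb{H}^2/\langle x,y\rangle$ of $M$ is then a hyperbolic three-holed sphere, the double of the triangle. There are an integer $N\ge 0$ and, for $n\ge 0$, closed geodesics $\delta_n$ on $F$ represented by $(xy)^{N+n}x$, projecting to closed geodesics $\gamma_n$ on $M$ of the same length, and distinct crossing lines $l_n,m_n$ above $\delta_n$ (hence above $\gamma_n$) for which the above ratio converges to $1$. Likewise (for the same $x,y$), there are an integer $N\ge 0$ and closed geodesics $\delta_n$ represented by $x(xy)^{N+n}y$, projecting to closed geodesics $\gamma_n$ on $M$ of the same length, and disjoint lines $l_n,m_n$ above $\delta_n$ for which the above ratio converges to $1$. -/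

import Mathlib

open scoped UpperHalfPlane MeasureTheory Topology ENNReal
open Filter

/-! ### Hyperbolic surfaces

A hyperbolic surface is presented as the quotient `ℍ / Γ` of the hyperbolic plane by a group of
isometries (of either orientation character) acting freely and properly discontinuously, so that
`ℍ` is its universal cover and `Γ` its group of covering transformations. -/

/-- `Γ` acts on the hyperbolic plane freely and properly discontinuously. -/
structure IsSurfaceGroup (Γ : Subgroup (ℍ ≃ᵢ ℍ)) : Prop where
  free : ∀ g ∈ Γ, ∀ z : ℍ, g z = z → g = 1
  properlyDiscontinuous : ∀ K : Set ℍ, IsCompact K →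
    {g : ℍ ≃ᵢ ℍ | g ∈ Γ ∧ (g '' K ∩ K).Nonempty}.Finite

/-- Two points of `ℍ` are equivalent when an element of `Γ` carries one to the other. -/
def orbitSetoid (Γ : Subgroup (ℍ ≃ᵢ ℍ)) : Setoid ℍ where
  r z w := ∃ g ∈ Γ, g z = w
  iseqv :=
    { refl := fun _ => ⟨1, Γ.one_mem, rfl⟩
      symm := by
        rintro z _ ⟨g, hg, rfl⟩
        exact ⟨g⁻¹, Γ.inv_mem hg, g.symm_apply_apply z⟩
      trans := by
        rintro z _ _ ⟨g, hg, rfl⟩ ⟨h, hh, rfl⟩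
        exact ⟨h * g, Γ.mul_mem hh hg, rfl⟩ }

/-- The surface `ℍ / Γ`. -/
def HypSurface (Γ : Subgroup (ℍ ≃ᵢ ℍ)) : Type := Quotient (orbitSetoid Γ)

/-- The quotient topology on `ℍ / Γ`. -/
instance (Γ : Subgroup (ℍ ≃ᵢ ℍ)) : TopologicalSpace (HypSurface Γ) :=
  inferInstanceAs (TopologicalSpace (Quotient (orbitSetoid Γ)))

/-- The universal covering `ℍ → ℍ / Γ`. -/
def HypSurface.mk (Γ : Subgroup (ℍ ≃ᵢ ℍ)) (z : ℍ) : HypSurface Γ := Quotient.mk (orbitSetoid Γ) z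

/-- The covering `ℍ / P → ℍ / Γ` belonging to a subgroup `P ≤ Γ`. -/
def HypSurface.cover {P Γ : Subgroup (ℍ ≃ᵢ ℍ)} (h : P ≤ Γ) : HypSurface P → HypSurface Γ :=
  Quotient.map id fun _ _ ⟨g, hg, e⟩ => ⟨g, h hg, e⟩

/-! ### The Euler characteristic -/

/-- The `i`-th Betti number of a space: the dimension of its `i`-th rational singular homology
(`⊤` when this is infinite). -/
noncomputable def bettiNumber (X : Type) [TopologicalSpace X] (i : ℕ) : ℕ∞ :=
  Cardinal.toENat (Module.rank ℚ
    (((AlgebraicTopology.singularHomologyFunctor (ModuleCat.{0} ℚ) i).obj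
      (ModuleCat.of ℚ ℚ)).obj (TopCat.of X)))

/-- The Euler characteristic `b₀ - b₁ + b₂` of a surface. For a connected surface `b₀` and `b₂` are
finite, so that the value is `-∞` exactly when `b₁` is infinite. -/
noncomputable def surfaceEulerChar (X : Type) [TopologicalSpace X] : EReal :=
  ((bettiNumber X 0 : ℝ≥0∞) : EReal) - ((bettiNumber X 1 : ℝ≥0∞) : EReal)
    + ((bettiNumber X 2 : ℝ≥0∞) : EReal)

/-! ### Lines, orthogonal projections, reflections -/

/-- A (complete) geodesic line in the hyperbolic plane. -/
def IsGeodesicLine (l : Set ℍ) : Prop := ∃ c : ℝ → ℍ, Isometry c ∧ Set.range c = l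

/-- The orthogonal projection of the set `m` to the line `l`: the points of `l` that are nearest to
some point of `m`. -/
def orthProj (m l : Set ℍ) : Set ℍ := {w | w ∈ l ∧ ∃ z ∈ m, dist z w = Metric.infDist z l}

/-- The length (one-dimensional Hausdorff measure) of the orthogonal projection of `m` to `l`. -/
noncomputable def orthProjLength (m l : Set ℍ) : ℝ≥0∞ := μH[1] (orthProj m l)

/-- `s` is the reflection in the line `l`: the isometry whose fixed points are the points of `l`. -/
def IsReflectionIn (s : ℍ ≃ᵢ ℍ) (l : Set ℍ) : Prop := {z : ℍ | s z = z} = l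

/-! ### Closed geodesics -/

/-- A closed geodesic on `ℍ / Γ`, traversed once at unit speed: the image of a unit speed geodesic
line of `ℍ` that is periodic in `ℍ / Γ`, its length being the least positive period. -/
structure ClosedGeodesic (Γ : Subgroup (ℍ ≃ᵢ ℍ)) where
  toFun : ℝ → HypSurface Γ
  length : ℝ
  exists_lift : ∃ c : ℝ → ℍ, Isometry c ∧ ∀ t, toFun t = HypSurface.mk Γ (c t)
  length_pos : 0 < length
  periodic : Function.Periodic toFun length
  length_le : ∀ T : ℝ, 0 < T → Function.Periodic toFun T → length ≤ T

namespace ClosedGeodesic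

/-- `c` is a geodesic line of `ℍ`, with unit speed parametrization, that lifts the closed
geodesic `γ`. -/
def IsLift {Γ : Subgroup (ℍ ≃ᵢ ℍ)} (γ : ClosedGeodesic Γ) (c : ℝ → ℍ) : Prop :=
  Isometry c ∧ ∀ t, γ.toFun t = HypSurface.mk Γ (c t)

/-- `l` is a geodesic line in `ℍ` above the closed geodesic `γ`. -/
def IsLineAbove {Γ : Subgroup (ℍ ≃ᵢ ℍ)} (γ : ClosedGeodesic Γ) (l : Set ℍ) : Prop :=
  ∃ c : ℝ → ℍ, γ.IsLift c ∧ Set.range c = l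

/-- The closed geodesic `γ` is represented by the element `g` of the fundamental group `Γ`: going
once around `γ` lifts to a path from a point to its image under the covering transformation `g`. -/
def IsRepresentedBy {Γ : Subgroup (ℍ ≃ᵢ ℍ)} (γ : ClosedGeodesic Γ) (g : ℍ ≃ᵢ ℍ) : Prop :=
  g ∈ Γ ∧ ∃ c : ℝ → ℍ, γ.IsLift c ∧ ∀ t, g (c t) = c (t + γ.length)

/-- The closed geodesic `δ` of the covering surface `ℍ / P` projects to the closed geodesic `γ` of
`ℍ / Γ`, with the same length. -/
def ProjectsTo {P Γ : Subgroup (ℍ ≃ᵢ ℍ)} (h : P ≤ Γ) (δ : ClosedGeodesic P)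
    (γ : ClosedGeodesic Γ) : Prop :=
  δ.length = γ.length ∧ ∀ t, γ.toFun t = HypSurface.cover h (δ.toFun t)

end ClosedGeodesic

/-! ### Hyperbolic three-holed spheres -/

/-- The lines `e 0, e 1, e 2` are the edges of a triangle all of whose vertices are ideal or
ultra-ideal: they are pairwise disjoint, and any two of them lie on the same side of the third. -/
structure IsIdealTriangle (e : Fin 3 → Set ℍ) : Prop where
  line : ∀ i, IsGeodesicLine (e i)
  disjoint : ∀ i j, i ≠ j → Disjoint (e i) (e j)
  sameSide : ∀ i j k, j ≠ i → k ≠ i → ∀ p ∈ e j, ∀ q ∈ e k, JoinedIn (e i)ᶜ p q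

/-- `x` and `y` are standard generators of the fundamental group of a hyperbolic three-holed sphere.
The three-holed sphere is the double of the triangle `T` with edges `e 0, e 1, e 2`; its universal
cover `ℍ` is tiled by copies of `T`, any two adjacent ones being interchanged by the reflection in
their common edge, and its group of covering transformations consists of the products of an even
number of the reflections `s i` in the edges of `T`, so it is generated by `s 2 * s 0` and
`s 2 * s 1`. Cutting along the images of `e 0` and `e 1` gives the quadrilateral `T ∪ s 2 T`; `x`
carries its side `e 0` to its side `s 2 (e 0)`, and `y` carries its side `e 1` to its
side `s 2 (e 1)`. -/
def IsThreeHoledSpherePair (x y : ℍ ≃ᵢ ℍ) : Prop :=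
  ∃ (e : Fin 3 → Set ℍ) (s : Fin 3 → ℍ ≃ᵢ ℍ), IsIdealTriangle e ∧
    (∀ i, IsReflectionIn (s i) (e i)) ∧ x = s 2 * s 0 ∧ y = s 2 * s 1

/-!
Isometries of `ℍ` are written as real `2 × 2` matrices of determinant `±1` (`exists_mobius_eq`), and
everything is read off from traces. The central quantity is the trace `ctr M V` of the commutator of
`M` and `V`. When `A` is hyperbolic with axis `l` and `tr A` is large compared with `ctr A V`, the
lines `l` and `V l` cross if `ctr A V > 2` and are disjoint if `ctr A V < 2`; in coordinates in
which `l` is the imaginary axis and `V = !![a, b; c, d]` with determinant one, one has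
`b c = -(ctr A V - 2) / (tr A ^ 2 - 4)`, and the projection of `V l` to `l` runs from height
`|b / d|` to height `|a / c|`, so that it has length `log |1 + 1 / (b c)|`
(`orthProjLength_smul_axis`). Hence, along a sequence of elements `A` whose traces tend to infinity
while `ctr A V` stays fixed, this length is `log (tr A ^ 2)` up to a bounded error, and so is the
translation length of `A`: their ratio tends to `1` (`tendsto_log_ratio`).

It has to be seen that the axis of `A` covers a closed geodesic whose length is the translation
length of `A`, and not a proper fraction of it, in `ℍ / Γ` too. If it were a proper fraction, then
`Γ` would contain an element `M` that translates along the axis by at most half of the translation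
length of `A`, and `|ctr M V - 2|` would be positive but, for `tr A` large, arbitrarily small
(`IsSurfaceGroup.length_le_of_periodic`). This is impossible because `Γ` is discrete: up to
multiplication by powers of `V` there are only finitely many elements `M` with `|ctr M V - 2|`
bounded (`IsSurfaceGroup.exists_ctr_gap`).

The elements `x`, `y` are obtained as follows. A surface with cyclic fundamental group has first
Betti number at most one, since its singular one-cycles are homologous to combinations of loops;
hence the negative Euler characteristic makes `Γ` noncyclic (`not_cyclic_of_eulerChar_neg`). A
discrete group acting freely all of whose elements are parabolic, or fix both ends of one line, is
cyclic, so that `Γ` contains a hyperbolic element and another element moving both ends of its axis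
(`IsSurfaceGroup.exists_hyperbolic_pair`). Powers and conjugates of these give matrices `X`, `Y` of
determinant one with `tr X > 2`, `tr Y > 2`, `tr (X⁻¹ Y) < -2`
(`IsSurfaceGroup.exists_separated_pair`). Under these inequalities the normalized bracket
`R = (X Y - Y X) / √(ctr X Y - 2)` and the products `R X`, `R Y` are reflections in the edges of a
triangle with ultra-ideal vertices (`isThreeHoledSpherePair_mobius`).

For the words `(xy)^k x` take `V = X Y`; then `ctr A V = ctr X Y > 2`. For the words `x (xy)^k y`
take `V = X (X Y) X⁻¹`; then `ctr A V = ctr (Y X) (X Y) < 2` by the trace identities of Fricke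
(`ctr_eq`, `ctr_mul_mul_lt_two`).
-/

/-! ### Isometries of the hyperbolic plane as real matrices -/

open UpperHalfPlane in
theorem re_smul_formula (g : GL (Fin 2) ℝ) (z : ℍ) :
    (g • z).re = (g 0 0 * g 1 0 * (z.re ^ 2 + z.im ^ 2) + (g 0 0 * g 1 1 + g 0 1 * g 1 0) * z.re
      + g 0 1 * g 1 1) / ((g 1 0 * z.re + g 1 1) ^ 2 + (g 1 0 * z.im) ^ 2) := by
  rw [re_smul, Complex.div_re, ← add_div]
  congr 1
  · simp [num, denom]; ring
  · simp [denom, Complex.normSq_apply]; ring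

open UpperHalfPlane in
theorem im_smul_formula (g : GL (Fin 2) ℝ) (z : ℍ) :
    (g • z).im = |g.val.det| * z.im /
      ((g 1 0 * z.re + g 1 1) ^ 2 + (g 1 0 * z.im) ^ 2) := by
  rw [im_smul_eq_div_normSq]
  congr 1
  simp [denom, Complex.normSq_apply]; ring

theorem smul_denom_pos (g : GL (Fin 2) ℝ) (z : ℍ) :
    0 < (g 1 0 * z.re + g 1 1) ^ 2 + (g 1 0 * z.im) ^ 2 := by
  have h := UpperHalfPlane.normSq_denom_pos g (z := (z : ℂ)) z.im_ne_zero
  simp [UpperHalfPlane.denom, Complex.normSq_apply] at h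
  nlinarith

/-- The hyperbolic distance in real coordinates. -/
theorem cosh_dist_formula (z w : ℍ) :
    Real.cosh (dist z w) =
      ((z.re - w.re) ^ 2 + z.im ^ 2 + w.im ^ 2) / (2 * z.im * w.im) := by
  rw [UpperHalfPlane.cosh_dist']

theorem dist_eq_of_cosh_eq {z w z' w' : ℍ}
    (h : Real.cosh (dist z w) = Real.cosh (dist z' w')) : dist z w = dist z' w' :=
  (Real.cosh_strictMonoOn.injOn) (Set.mem_Ici.2 dist_nonneg) (Set.mem_Ici.2 dist_nonneg) h

/-- The action of `GL (Fin 2) ℝ`, in which matrices of negative determinant act by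
`z ↦ (a * conj z + b) / (c * conj z + d)`, is isometric. -/
instance : IsIsometricSMul (GL (Fin 2) ℝ) ℍ := ⟨fun g => by
  refine Isometry.of_dist_eq fun z w => dist_eq_of_cosh_eq ?_
  rw [UpperHalfPlane.cosh_dist, UpperHalfPlane.cosh_dist]
  congr 1
  have hz := smul_denom_pos g z
  have hw := smul_denom_pos g w
  have hd : g.val.det ≠ 0 := g.det_ne_zero
  have hd' : 0 < |g.val.det| := abs_pos.2 hd
  have key : dist ((g • z : ℍ) : ℂ) (g • w : ℍ) ^ 2 =
      g.val.det ^ 2 * dist (z : ℂ) w ^ 2 /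
        (((g 1 0 * z.re + g 1 1) ^ 2 + (g 1 0 * z.im) ^ 2) *
          ((g 1 0 * w.re + g 1 1) ^ 2 + (g 1 0 * w.im) ^ 2)) := by
    rw [Complex.dist_eq_re_im, Complex.dist_eq_re_im, Real.sq_sqrt (by positivity),
      Real.sq_sqrt (by positivity)]
    simp only [UpperHalfPlane.coe_re, UpperHalfPlane.coe_im]
    rw [re_smul_formula, re_smul_formula, im_smul_formula, im_smul_formula,
      eq_div_iff (by positivity), div_sub_div _ _ hz.ne' hw.ne', div_sub_div _ _ hz.ne' hw.ne',
      div_pow, div_pow, ← add_div,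
      div_mul_eq_mul_div, div_eq_iff (by positivity)]
    have : |g.val.det| ^ 2 = g.val.det ^ 2 := sq_abs _
    have h2 : (|g.val.det| * z.im * ((g 1 0 * w.re + g 1 1) ^ 2 + (g 1 0 * w.im) ^ 2) -
      ((g 1 0 * z.re + g 1 1) ^ 2 + (g 1 0 * z.im) ^ 2) * (|g.val.det| * w.im)) ^ 2 =
      g.val.det ^ 2 * (z.im * ((g 1 0 * w.re + g 1 1) ^ 2 + (g 1 0 * w.im) ^ 2) -
      ((g 1 0 * z.re + g 1 1) ^ 2 + (g 1 0 * z.im) ^ 2) * w.im) ^ 2 := by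
      rw [← this]; ring
    rw [h2, Matrix.det_fin_two]
    ring
  rw [key, im_smul_formula, im_smul_formula, div_eq_div_iff]
  · have : |g.val.det| ^ 2 = g.val.det ^ 2 := sq_abs _
    rw [← this]
    field_simp
  · have := z.im_pos; have := w.im_pos; positivity
  · have := z.im_pos; have := w.im_pos; positivity⟩

/-- The isometry of `ℍ` given by an invertible real matrix; matrices of negative determinant act by
orientation reversing isometries. -/
noncomputable def mobius : GL (Fin 2) ℝ →* (ℍ ≃ᵢ ℍ) where
  toFun g := IsometryEquiv.constSMul g
  map_one' := by ext1 z; exact one_smul (GL (Fin 2) ℝ) z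
  map_mul' g h := by ext1 z; exact mul_smul g h z

@[simp] theorem mobius_apply (g : GL (Fin 2) ℝ) (z : ℍ) : mobius g z = g • z := rfl

theorem isometryEquiv_mul_apply (g h : ℍ ≃ᵢ ℍ) (z : ℍ) : (g * h) z = g (h z) := rfl

theorem isometryEquiv_inv_apply_self (g : ℍ ≃ᵢ ℍ) (z : ℍ) : g⁻¹ (g z) = z := g.symm_apply_apply z

/-- The invertible matrix with the given entries. -/
noncomputable def glMk (a b c d : ℝ) (h : a * d - b * c ≠ 0) : GL (Fin 2) ℝ :=
  .mkOfDetNeZero !![a, b; c, d] (by rw [Matrix.det_fin_two_of]; exact h)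

@[simp] theorem glMk_val (a b c d : ℝ) (h : a * d - b * c ≠ 0) :
    (glMk a b c d h).val = !![a, b; c, d] := rfl

theorem glMk_det (a b c d : ℝ) (h : a * d - b * c ≠ 0) :
    (glMk a b c d h).val.det = a * d - b * c := by simp [Matrix.det_fin_two_of]

/-- Any two points can be moved to the imaginary axis. -/
theorem exists_smul_mem_imAxis (z w : ℍ) :
    ∃ M : GL (Fin 2) ℝ, (M • z).re = 0 ∧ (M • w).re = 0 := by
  by_cases hre : z.re = w.re
  · refine ⟨glMk 1 (-z.re) 0 1 (by simp), ?_, ?_⟩ <;> rw [re_smul_formula] <;> simp [hre]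
  · have hne : w.re - z.re ≠ 0 := sub_ne_zero.2 (Ne.symm hre)
    -- the Euclidean centre and radius of the circle through the two points
    set x₀ : ℝ := (w.re ^ 2 + w.im ^ 2 - z.re ^ 2 - z.im ^ 2) / (2 * (w.re - z.re)) with hx₀
    set r : ℝ := √((z.re - x₀) ^ 2 + z.im ^ 2) with hr
    have hr2 : r ^ 2 = (z.re - x₀) ^ 2 + z.im ^ 2 := Real.sq_sqrt (by positivity)
    have hrpos : 0 < r := Real.sqrt_pos.2 (by have := z.im_pos; positivity)
    have hx : 2 * (w.re - z.re) * x₀ = w.re ^ 2 + w.im ^ 2 - z.re ^ 2 - z.im ^ 2 := by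
      rw [hx₀]; field_simp
    refine ⟨glMk 1 (-(x₀ - r)) (-1) (x₀ + r) (by nlinarith), ?_, ?_⟩ <;> rw [re_smul_formula] <;>
      rw [div_eq_zero_iff] <;> left <;> simp <;> nlinarith

/-- A point of the imaginary axis other than `i` can be moved above `i`, by the half turn about `i`
if necessary. -/
theorem exists_smul_eq_pair {z w : ℍ} (hz : z = UpperHalfPlane.I) (hw : w.re = 0) (hne : z ≠ w) :
    ∃ M : GL (Fin 2) ℝ, M • z = UpperHalfPlane.I ∧ (M • w).re = 0 ∧ 1 < (M • w).im := by
  subst hz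
  rcases lt_trichotomy w.im 1 with h | h | h
  · refine ⟨glMk 0 (-1) 1 0 (by simp), ?_, ?_, ?_⟩
    · apply UpperHalfPlane.ext_re_im
      · rw [re_smul_formula]; simp
      · rw [im_smul_formula]; simp
    · rw [re_smul_formula]; simp [hw]
    · rw [im_smul_formula]
      have := w.im_pos
      simp [hw]
      rw [lt_div_iff₀ (by positivity)]; nlinarith
  · exact absurd (UpperHalfPlane.ext_re_im (by simp [hw]) (by simp [h])) hne
  · exact ⟨1, by simp, by simpa using hw, by simpa using h⟩

/-- Any two distinct points can be moved to `i` and a point above `i` on the imaginary axis. -/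
theorem exists_smul_eq_I_of_ne {z w : ℍ} (h : z ≠ w) :
    ∃ M : GL (Fin 2) ℝ, M • z = UpperHalfPlane.I ∧ (M • w).re = 0 ∧ 1 < (M • w).im := by
  obtain ⟨M, h1, h2⟩ := exists_smul_mem_imAxis z w
  have hp : (M • z).im ≠ 0 := (M • z).im_ne_zero
  set S : GL (Fin 2) ℝ := glMk 1 0 0 (M • z).im (by simpa using hp)
  have e1 : S • M • z = UpperHalfPlane.I := by
    apply UpperHalfPlane.ext_re_im
    · rw [re_smul_formula]; simp [S, h1]
    · rw [im_smul_formula]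
      have := (M • z).im_pos
      simp only [S, glMk_det]
      simp [abs_of_pos this]
      field_simp
  have e2 : (S • M • w).re = 0 := by rw [re_smul_formula]; simp [S, h2]
  obtain ⟨N, n1, n2, n3⟩ := exists_smul_eq_pair e1 e2 (fun e => h (by simpa using e))
  exact ⟨N * S * M, by simpa [mul_smul] using n1, by simpa [mul_smul] using n2,
    by simpa [mul_smul] using n3⟩

theorem J_smul_re (z : ℍ) : (UpperHalfPlane.J • z).re = -z.re := by
  rw [re_smul_formula]; simp

theorem J_smul_im (z : ℍ) : (UpperHalfPlane.J • z).im = z.im := by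
  rw [im_smul_formula]; simp

/-- An isometry fixing `i` and a point above `i` on the imaginary axis is the identity or the
reflection in the imaginary axis. -/
theorem eq_one_or_eq_J_of_fixes (f : ℍ ≃ᵢ ℍ) (h1 : f UpperHalfPlane.I = UpperHalfPlane.I) {w : ℍ}
    (hw : w.re = 0) (hw1 : 1 < w.im) (h2 : f w = w) :
    f = 1 ∨ f = mobius UpperHalfPlane.J := by
  have key : ∀ z : ℍ, (f z).im = z.im ∧ ((f z).re = z.re ∨ (f z).re = -z.re) := by
    intro z
    have d1 : Real.cosh (dist (f z) UpperHalfPlane.I) = Real.cosh (dist z UpperHalfPlane.I) := by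
      conv_lhs => rw [← h1, f.isometry.dist_eq]
    have d2 : Real.cosh (dist (f z) w) = Real.cosh (dist z w) := by
      conv_lhs => rw [← h2, f.isometry.dist_eq]
    rw [cosh_dist_formula, cosh_dist_formula] at d1 d2
    have p1 := (f z).im_pos
    have p2 := z.im_pos
    have p3 := w.im_pos
    rw [div_eq_div_iff (by simp [p1.ne']) (by simp [p2.ne'])] at d1
    rw [div_eq_div_iff (by positivity) (by positivity)] at d2
    simp [hw] at d1 d2
    have e1 : ((f z).re ^ 2 + (f z).im ^ 2 + 1) * z.im = (z.re ^ 2 + z.im ^ 2 + 1) * (f z).im := by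
      linarith
    have e2 : ((f z).re ^ 2 + (f z).im ^ 2 + w.im ^ 2) * z.im
        = (z.re ^ 2 + z.im ^ 2 + w.im ^ 2) * (f z).im := by
      have : w.im * (((f z).re ^ 2 + (f z).im ^ 2 + w.im ^ 2) * z.im)
        = w.im * ((z.re ^ 2 + z.im ^ 2 + w.im ^ 2) * (f z).im) := by linarith
      exact mul_left_cancel₀ p3.ne' this
    have e3 : (w.im ^ 2 - 1) * ((f z).im - z.im) = 0 := by linarith
    have e4 : (f z).im = z.im := by
      rcases mul_eq_zero.1 e3 with h | h
      · nlinarith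
      · linarith
    refine ⟨e4, ?_⟩
    rw [e4] at e1
    have e5 : (f z).re ^ 2 = z.re ^ 2 := by
      have := mul_right_cancel₀ p2.ne' e1; linarith
    exact sq_eq_sq_iff_eq_or_eq_neg.1 e5
  -- a point off the axis decides between the two
  set z₀ : ℍ := UpperHalfPlane.mk ⟨1, 1⟩ (by simp) with hz₀
  have hre : z₀.re = 1 := rfl
  have him : z₀.im = 1 := rfl
  have dz : ∀ z : ℍ, ((f z).re - (f z₀).re) ^ 2 = (z.re - 1) ^ 2 := by
    intro z
    have d : Real.cosh (dist (f z) (f z₀)) = Real.cosh (dist z z₀) := by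
      rw [f.isometry.dist_eq]
    rw [cosh_dist_formula, cosh_dist_formula, (key z).1, (key z₀).1, hre, him] at d
    have p2 := z.im_pos
    rw [div_left_inj' (by positivity)] at d
    linarith
  rcases (key z₀).2 with h | h
  · left
    ext1 z
    refine UpperHalfPlane.ext_re_im ?_ (key z).1
    have := dz z
    rw [h, hre] at this
    show (f z).re = z.re
    rcases (key z).2 with h' | h'
    · exact h'
    · rw [h'] at this ⊢; linarith
  · right
    ext1 z
    rw [mobius_apply]
    refine UpperHalfPlane.ext_re_im ?_ (by rw [(key z).1, J_smul_im])
    have := dz z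
    rw [h, hre] at this
    rw [J_smul_re]
    rcases (key z).2 with h' | h'
    · rw [h'] at this ⊢; linarith
    · exact h'

/-- A nonzero multiple of a matrix defines the same isometry. -/
theorem mobius_eq_of_val_eq_smul {M N : GL (Fin 2) ℝ} {u : ℝ} (h : N.val = u • M.val) :
    mobius N = mobius M := by
  have hu : u ≠ 0 := by
    rintro rfl
    have := N.det_ne_zero
    rw [h] at this; simp at this
  have : N = Matrix.GeneralLinearGroup.scalar (Fin 2) (Units.mk0 u hu) * M := by
    ext i j
    rw [h]
    simp [Matrix.GeneralLinearGroup.scalar, Matrix.scalar]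
  rw [this]
  ext1 z
  simp

theorem mobius_neg (M : GL (Fin 2) ℝ) : mobius (-M) = mobius M :=
  mobius_eq_of_val_eq_smul (u := -1) (by simp)

theorem exists_abs_det_eq_one (M : GL (Fin 2) ℝ) :
    ∃ N : GL (Fin 2) ℝ, |N.val.det| = 1 ∧ mobius N = mobius M := by
  have hd : 0 < |M.val.det| := abs_pos.2 M.det_ne_zero
  have hs : √|M.val.det| ≠ 0 := (Real.sqrt_pos.2 hd).ne'
  have hdet : ((√|M.val.det|)⁻¹ • M.val).det ≠ 0 := by
    rw [Matrix.det_smul]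
    exact mul_ne_zero (pow_ne_zero _ (inv_ne_zero hs)) M.det_ne_zero
  refine ⟨.mkOfDetNeZero ((√|M.val.det|)⁻¹ • M.val) hdet, ?_, mobius_eq_of_val_eq_smul rfl⟩
  show |((√|M.val.det|)⁻¹ • M.val).det| = 1
  rw [Matrix.det_smul, abs_mul, abs_pow, abs_inv, abs_of_nonneg (Real.sqrt_nonneg _)]
  simp only [Fintype.card_fin, inv_pow, Real.sq_sqrt hd.le]
  exact inv_mul_cancel₀ hd.ne'

/-- Every isometry of the hyperbolic plane is given by a matrix of determinant `1` or `-1`. -/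
theorem exists_mobius_eq (g : ℍ ≃ᵢ ℍ) :
    ∃ M : GL (Fin 2) ℝ, |M.val.det| = 1 ∧ mobius M = g := by
  -- move the images of `i` and `2 i` back, so that only an isometry fixing `i` and `2 i` is left
  suffices h : ∃ M : GL (Fin 2) ℝ, mobius M = g by
    obtain ⟨M, rfl⟩ := h
    exact exists_abs_det_eq_one M
  set w : ℍ := UpperHalfPlane.mk ⟨0, 2⟩ (by simp) with hw
  have hwi : UpperHalfPlane.I ≠ w := fun e => by
    have := congrArg UpperHalfPlane.im e; simp [w] at this
  obtain ⟨M, h1, h2, h3⟩ := exists_smul_eq_I_of_ne (fun e => hwi (g.injective e))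
  have h4 : M • g w = w := by
    refine UpperHalfPlane.ext_re_im (by rw [h2]; rfl) ?_
    have d : Real.cosh (dist (M • g UpperHalfPlane.I) (M • g w)) =
        Real.cosh (dist UpperHalfPlane.I w) := by
      rw [dist_smul, g.isometry.dist_eq]
    rw [h1, cosh_dist_formula, cosh_dist_formula, h2] at d
    have e1 : w.re = 0 := rfl
    have e2 : w.im = 2 := rfl
    rw [div_eq_div_iff (by simp; positivity) (by simp; positivity)] at d
    simp [e1, e2] at d
    rw [e2]
    nlinarith
  rcases eq_one_or_eq_J_of_fixes (mobius M * g) h1 (w := w) rfl (by simp [w]) h4 with h | h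
  · exact ⟨M⁻¹, by rw [map_inv]; exact (eq_inv_of_mul_eq_one_right h).symm⟩
  · exact ⟨M⁻¹ * UpperHalfPlane.J, by rw [map_mul, ← h, map_inv]; simp⟩

noncomputable section

open CategoryTheory

/-! ### Singular chains -/

/-- If, modulo boundaries, every cycle is a multiple of one cycle, then the homology is at most
one-dimensional. -/
theorem rank_homology_le_one (K : ChainComplex (ModuleCat.{0} ℚ) ℕ) (v : K.X 1)
    (hv : (K.d 1 0).hom v = 0)
    (h : ∀ z : K.X 1, (K.d 1 0).hom z = 0 → ∃ (r : ℚ) (w : K.X 2), z = r • v + (K.d 2 1).hom w) :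
    Module.rank ℚ (K.homology 1) ≤ 1 := by
  rw [rank_le_one_iff]
  have hinj : Function.Injective (K.iCycles 1).hom :=
    (ModuleCat.mono_iff_injective _).1 inferInstance
  have hsurj : Function.Surjective (K.homologyπ 1).hom :=
    (ModuleCat.epi_iff_surjective _).1 inferInstance
  let φ : ModuleCat.of ℚ ℚ ⟶ K.X 1 := ModuleCat.ofHom (LinearMap.toSpanSingleton ℚ _ v)
  have hφ : φ ≫ K.d 1 0 = 0 := by
    ext
    simp [φ, hv]
  let ψ := K.liftCycles φ 0 (by simp) hφ
  refine ⟨(K.homologyπ 1).hom (ψ.hom (1 : ℚ)), fun x => ?_⟩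
  obtain ⟨c, rfl⟩ := hsurj x
  have hc : (K.d 1 0).hom ((K.iCycles 1).hom c) = 0 := by
    have := congrArg (fun f => f.hom c) (K.iCycles_d 1 0)
    exact this
  obtain ⟨r, w, hw⟩ := h _ hc
  refine ⟨r, ?_⟩
  have e1 : (K.iCycles 1).hom (ψ.hom (1 : ℚ)) = v := by
    have := congrArg (fun f => f.hom (1 : ℚ)) (K.liftCycles_i φ 0 (by simp) hφ)
    exact this.trans (one_smul ℚ v)
  have e2 : (K.iCycles 1).hom ((K.toCycles 2 1).hom w) = (K.d 2 1).hom w := by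
    have := congrArg (fun f => f.hom w) (K.toCycles_i 2 1)
    exact this
  have e3 : c = r • ψ.hom (1 : ℚ) + (K.toCycles 2 1).hom w := by
    apply hinj
    rw [map_add, map_smul, e1, e2, hw]
  have e4 : (K.homologyπ 1).hom ((K.toCycles 2 1).hom w) = 0 := by
    have := congrArg (fun f => f.hom w) (K.toCycles_comp_homologyπ 2 1)
    exact this
  rw [e3, map_add, map_smul, e4, add_zero]

/-- The rational singular chain complex of a space. -/
abbrev singChains (X : Type) [TopologicalSpace X] : ChainComplex (ModuleCat.{0} ℚ) ℕ :=
  (TopCat.toSSet.obj (TopCat.of X)).chainComplex (ModuleCat.of ℚ ℚ)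

/-- The chain consisting of a single singular simplex. -/
def singSimplex {X : Type} [TopologicalSpace X] (n : ℕ) (f : C(stdSimplex ℝ (Fin (n + 1)), X)) :
    (singChains X).X n :=
  ((TopCat.toSSet.obj (TopCat.of X)).ιChainComplex (R := ModuleCat.of ℚ ℚ)
    (((TopCat.of X).toSSetObjEquiv (Opposite.op (SimplexCategory.mk n))).symm f)).hom (1 : ℚ)

/-- The `i`-th face of a singular simplex. -/
def singFace {X : Type} [TopologicalSpace X] {n : ℕ} (i : Fin (n + 2))
    (f : C(stdSimplex ℝ (Fin (n + 2)), X)) : C(stdSimplex ℝ (Fin (n + 1)), X) :=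
  f.comp ⟨stdSimplex.map i.succAbove, stdSimplex.continuous_map _⟩

theorem singChains_d {X : Type} [TopologicalSpace X] (n : ℕ)
    (f : C(stdSimplex ℝ (Fin (n + 2)), X)) :
    ((singChains X).d (n + 1) n).hom (singSimplex (n + 1) f) =
      ∑ i : Fin (n + 2), (-1 : ℤ) ^ (i : ℕ) • singSimplex n (singFace i f) := by
  have h := congrArg (fun φ => φ.hom (1 : ℚ)) (SSet.ιChainComplex_d
    (TopCat.toSSet.obj (TopCat.of X)) (ModuleCat.of ℚ ℚ)
    (((TopCat.of X).toSSetObjEquiv (Opposite.op (SimplexCategory.mk (n + 1)))).symm f))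
  simp only [ModuleCat.hom_comp, LinearMap.comp_apply] at h
  refine h.trans ?_
  rw [ModuleCat.hom_sum, LinearMap.sum_apply]
  refine Finset.sum_congr rfl fun i _ => ?_
  rw [ModuleCat.hom_zsmul, LinearMap.smul_apply]
  rfl

/-- A linear map on singular chains is determined by, and can be prescribed on, simplices. -/
theorem exists_singChains_hom {X : Type} [TopologicalSpace X] (n : ℕ) {M : ModuleCat.{0} ℚ}
    (φ : C(stdSimplex ℝ (Fin (n + 1)), X) → M) :
    ∃ h : (singChains X).X n →ₗ[ℚ] M, ∀ f, h (singSimplex n f) = φ f := by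
  let S := TopCat.toSSet.obj (TopCat.of X)
  let E := (TopCat.of X).toSSetObjEquiv (Opposite.op (SimplexCategory.mk n))
  let s : Limits.Cofan (fun _ : S.obj (Opposite.op (SimplexCategory.mk n)) => ModuleCat.of ℚ ℚ) :=
    Limits.Cofan.mk M fun x => ModuleCat.ofHom (LinearMap.toSpanSingleton ℚ _ (φ (E x)))
  refine ⟨((S.isColimitChainComplexXCofan (ModuleCat.of ℚ ℚ) n).desc s).hom, fun f => ?_⟩
  have h := congrArg (fun φ => φ.hom (1 : ℚ))
    ((S.isColimitChainComplexXCofan (ModuleCat.of ℚ ℚ) n).fac s ⟨E.symm f⟩)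
  refine h.trans ?_
  simp [s]

theorem singChains_hom_ext {X : Type} [TopologicalSpace X] {n : ℕ} {M : ModuleCat.{0} ℚ}
    {h k : (singChains X).X n →ₗ[ℚ] M}
    (H : ∀ f, h (singSimplex n f) = k (singSimplex n f)) : h = k := by
  have : ModuleCat.ofHom h = ModuleCat.ofHom k := by
    apply SSet.chainComplex_hom_ext
    intro x
    ext
    have := H ((TopCat.of X).toSSetObjEquiv _ x)
    simp only [singSimplex, Equiv.symm_apply_apply] at this
    exact this
  exact congrArg ModuleCat.Hom.hom this

theorem span_singSimplex (X : Type) [TopologicalSpace X] (n : ℕ) :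
    Submodule.span ℚ (Set.range (singSimplex (X := X) n)) = ⊤ := by
  set P := Submodule.span ℚ (Set.range (singSimplex (X := X) n))
  have : P.mkQ = 0 := singChains_hom_ext (M := ModuleCat.of ℚ _) fun f => by
    simpa using Submodule.subset_span (Set.mem_range_self f)
  rw [← Submodule.ker_mkQ P, this, LinearMap.ker_zero]

end

noncomputable section

open CategoryTheory

/-! ### Segments, cones and loops as singular chains -/

theorem im_convexComb_pos (t : ℝ) (h0 : 0 ≤ t) (h1 : t ≤ 1) (z w : ℍ) :
    0 < (((1 - t : ℝ) : ℂ) * z + (t : ℂ) * w).im := by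
  have hz := z.im_pos
  have hw := w.im_pos
  simp
  rcases eq_or_lt_of_le h0 with rfl | h
  · simpa using hz
  · have : 0 ≤ (1 - t) * z.im := mul_nonneg (by linarith) hz.le
    have := mul_pos h hw
    linarith

/-- The Euclidean segment from `z` to `w`, constant outside of `[0, 1]`. -/
def seg (z w : ℍ) : C(ℝ, ℍ) where
  toFun s := ⟨((1 - max 0 (min s 1) : ℝ) : ℂ) * z + ((max 0 (min s 1) : ℝ) : ℂ) * w,
    im_convexComb_pos _ (le_max_left _ _) (max_le zero_le_one (min_le_right _ _)) z w⟩
  continuous_toFun := by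
    rw [UpperHalfPlane.isEmbedding_coe.continuous_iff]
    show Continuous fun s : ℝ =>
      ((1 - max 0 (min s 1) : ℝ) : ℂ) * z + ((max 0 (min s 1) : ℝ) : ℂ) * w
    fun_prop

theorem seg_coe (z w : ℍ) {s : ℝ} (h0 : 0 ≤ s) (h1 : s ≤ 1) :
    ((seg z w s : ℍ) : ℂ) = ((1 - s : ℝ) : ℂ) * z + (s : ℂ) * w := by
  simp [seg, h0, h1]

@[simp] theorem seg_zero (z w : ℍ) : seg z w 0 = z := by
  ext; rw [seg_coe z w le_rfl zero_le_one]; simp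

@[simp] theorem seg_one (z w : ℍ) : seg z w 1 = w := by
  ext; rw [seg_coe z w zero_le_one le_rfl]; simp

@[fun_prop] theorem continuous_stdSimplex_apply {n : ℕ} (i : Fin n) :
    Continuous fun t : stdSimplex ℝ (Fin n) => t i :=
  (continuous_apply i).comp continuous_subtype_val

/-- The singular `1`-simplex given by the restriction of a path to `[0, 1]`. -/
def edge (f : C(ℝ, ℍ)) : C(stdSimplex ℝ (Fin 2), ℍ) :=
  f.comp ⟨fun t => t 1, by fun_prop⟩

theorem simplex_nonneg {n : ℕ} (t : stdSimplex ℝ (Fin n)) (i : Fin n) : 0 ≤ t i := t.2.1 i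

theorem simplex_two_sum (t : stdSimplex ℝ (Fin 2)) : t 0 + t 1 = 1 := by
  have := t.2.2; rw [Fin.sum_univ_two] at this; exact this

theorem simplex_three_sum (t : stdSimplex ℝ (Fin 3)) : t 0 + t 1 + t 2 = 1 := by
  have := t.2.2; rw [Fin.sum_univ_three] at this; exact this

theorem coneParam_mem (t : stdSimplex ℝ (Fin 3)) : 0 ≤ t 2 / (1 - t 0) ∧ t 2 / (1 - t 0) ≤ 1 := by
  have h0 := simplex_nonneg t 0
  have h1 := simplex_nonneg t 1
  have h2 := simplex_nonneg t 2
  have hs := simplex_three_sum t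
  exact ⟨div_nonneg h2 (by linarith), div_le_one_of_le₀ (by linarith) (by linarith)⟩

/-- The cone with apex `z` over the restriction of the path `f` to `[0, 1]`: the vertex `0` is sent
to the apex, and the opposite face to the path. At the apex the parameter `t 2 / (1 - t 0)` of the
path is `0 / 0 = 0`, which does no harm as it is multiplied by `1 - t 0 = 0`. -/
def cone (z : ℍ) (f : C(ℝ, ℍ)) : C(stdSimplex ℝ (Fin 3), ℍ) where
  toFun t := ⟨((1 - (1 - t 0) : ℝ) : ℂ) * z + ((1 - t 0 : ℝ) : ℂ) * f (t 2 / (1 - t 0)),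
    im_convexComb_pos _ (by have := simplex_nonneg t 1; have := simplex_nonneg t 2
                            have := simplex_three_sum t; linarith)
      (by have := simplex_nonneg t 0; linarith) _ _⟩
  continuous_toFun := by
    rw [UpperHalfPlane.isEmbedding_coe.continuous_iff, continuous_iff_continuousAt]
    intro t
    show ContinuousAt (fun t : stdSimplex ℝ (Fin 3) =>
      ((1 - (1 - t 0) : ℝ) : ℂ) * z + ((1 - t 0 : ℝ) : ℂ) * f (t 2 / (1 - t 0))) t
    have c0 : Continuous fun t : stdSimplex ℝ (Fin 3) => t 0 := by fun_prop
    have c2 : Continuous fun t : stdSimplex ℝ (Fin 3) => t 2 := by fun_prop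
    by_cases h : 1 - t 0 = 0
    · -- at the apex the path contributes a bounded factor times one that tends to zero
      have hb : ∃ M : ℝ, ∀ s ∈ Set.Icc (0 : ℝ) 1, ‖((f s : ℍ) : ℂ)‖ ≤ M :=
        isCompact_Icc.exists_bound_of_continuousOn
          (UpperHalfPlane.continuous_coe.comp f.continuous).continuousOn
      obtain ⟨M, hM⟩ := hb
      have l1 : Tendsto (fun t : stdSimplex ℝ (Fin 3) =>
          ((1 - t 0 : ℝ) : ℂ) * f (t 2 / (1 - t 0))) (𝓝 t) (𝓝 0) := by
        refine squeeze_zero_norm (a := fun t : stdSimplex ℝ (Fin 3) => |1 - t 0| * M) ?_ ?_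
        · intro u
          rw [norm_mul, Complex.norm_real, Real.norm_eq_abs]
          exact mul_le_mul_of_nonneg_left (hM _ (coneParam_mem u)) (abs_nonneg _)
        · have : Continuous fun t : stdSimplex ℝ (Fin 3) => |1 - t 0| * M := by fun_prop
          have := this.tendsto t
          simpa [h] using this
      have l2 : Tendsto (fun t : stdSimplex ℝ (Fin 3) =>
          ((1 - (1 - t 0) : ℝ) : ℂ) * (z : ℂ)) (𝓝 t) (𝓝 (((1 - (1 - t 0) : ℝ) : ℂ) * z)) :=
        Continuous.tendsto (by fun_prop) t
      have l3 := l2.add l1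
      refine (by simpa [ContinuousAt, h] using l3)
    · have c3 : ContinuousAt (fun t : stdSimplex ℝ (Fin 3) => t 2 / (1 - t 0)) t :=
        c2.continuousAt.div (continuous_const.sub c0).continuousAt h
      have c4 : ContinuousAt (fun t : stdSimplex ℝ (Fin 3) =>
          ((f (t 2 / (1 - t 0)) : ℍ) : ℂ)) t :=
        (UpperHalfPlane.continuous_coe.comp f.continuous).continuousAt.comp c3
      have c5 : Continuous fun t : stdSimplex ℝ (Fin 3) => ((1 - t 0 : ℝ) : ℂ) := by fun_prop
      have c6 : Continuous fun t : stdSimplex ℝ (Fin 3) =>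
        ((1 - (1 - t 0) : ℝ) : ℂ) * (z : ℂ) := by fun_prop
      exact c6.continuousAt.add (c5.continuousAt.mul c4)

theorem face_zero_cone (z : ℍ) (f : C(ℝ, ℍ)) : singFace 0 (cone z f) = edge f := by
  ext t
  simp only [singFace, cone, edge, ContinuousMap.comp_apply, ContinuousMap.coe_mk]
  have e0 : (stdSimplex.map (Fin.succAbove (0 : Fin 3)) t) 0 = 0 := by
    simp [FunOnFinite.linearMap_apply_apply]
  have e2 : (stdSimplex.map (Fin.succAbove (0 : Fin 3)) t) 2 = t 1 := by
    simp [FunOnFinite.linearMap_apply_apply, Finset.sum_filter, Fin.sum_univ_two, Fin.ext_iff]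
  rw [e0, e2]
  simp

theorem face_one_cone (z : ℍ) (f : C(ℝ, ℍ)) : singFace 1 (cone z f) = edge (seg z (f 1)) := by
  ext t
  have h := simplex_two_sum t
  simp only [singFace, cone, edge, ContinuousMap.comp_apply, ContinuousMap.coe_mk]
  rw [seg_coe _ _ (simplex_nonneg t 1) (by have := simplex_nonneg t 0; linarith)]
  have e0 : (stdSimplex.map (Fin.succAbove (1 : Fin 3)) t) 0 = t 0 := by
    simp [FunOnFinite.linearMap_apply_apply, Finset.sum_filter, Fin.sum_univ_two, Fin.succAbove]
  have e2 : (stdSimplex.map (Fin.succAbove (1 : Fin 3)) t) 2 = t 1 := by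
    simp [FunOnFinite.linearMap_apply_apply, Finset.sum_filter, Fin.sum_univ_two, Fin.succAbove]
  have e3 : 1 - t 0 = t 1 := by linarith
  rw [e0, e2, e3]
  by_cases h1 : t 1 = 0
  · simp [h1]
  · rw [div_self h1]

theorem face_two_cone (z : ℍ) (f : C(ℝ, ℍ)) : singFace 2 (cone z f) = edge (seg z (f 0)) := by
  ext t
  have h := simplex_two_sum t
  simp only [singFace, cone, edge, ContinuousMap.comp_apply, ContinuousMap.coe_mk]
  rw [seg_coe _ _ (simplex_nonneg t 1) (by have := simplex_nonneg t 0; linarith)]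
  have e0 : (stdSimplex.map (Fin.succAbove (2 : Fin 3)) t) 0 = t 0 := by
    simp [FunOnFinite.linearMap_apply_apply, Finset.sum_filter, Fin.sum_univ_two, Fin.succAbove,
      Fin.lt_def]
  have e2 : (stdSimplex.map (Fin.succAbove (2 : Fin 3)) t) 2 = 0 := by
    simp [FunOnFinite.linearMap_apply_apply, Finset.sum_filter, Fin.sum_univ_two, Fin.succAbove,
      Fin.lt_def]
  have e3 : 1 - t 0 = t 1 := by linarith
  rw [e0, e2, e3, zero_div]

variable {Γ : Subgroup (ℍ ≃ᵢ ℍ)}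

theorem HypSurface.mk_eq_mk_iff {z w : ℍ} :
    HypSurface.mk Γ z = HypSurface.mk Γ w ↔ ∃ g ∈ Γ, g z = w := Quotient.eq (r := orbitSetoid Γ)

theorem HypSurface.mk_apply {g : ℍ ≃ᵢ ℍ} (hg : g ∈ Γ) (z : ℍ) :
    HypSurface.mk Γ (g z) = HypSurface.mk Γ z :=
  (HypSurface.mk_eq_mk_iff.2 ⟨g, hg, rfl⟩).symm

theorem HypSurface.mk_surjective : Function.Surjective (HypSurface.mk Γ) := Quotient.exists_rep

variable (Γ) in
/-- The universal covering as a continuous map. -/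
def HypSurface.proj : C(ℍ, HypSurface Γ) := ⟨HypSurface.mk Γ, continuous_quotient_mk'⟩

/-- An isometry as a continuous map. -/
def isomMap (g : ℍ ≃ᵢ ℍ) : C(ℍ, ℍ) := ⟨g, g.continuous⟩

variable (Γ) in
/-- The singular `1`-chain of `ℍ / Γ` given by the projection of a path in `ℍ`. -/
def edgeChain (f : C(ℝ, ℍ)) : (singChains (HypSurface Γ)).X 1 :=
  singSimplex 1 ((HypSurface.proj Γ).comp (edge f))

variable (Γ) in
/-- The singular `0`-chain given by a point of `ℍ / Γ`. -/
def pointChain (x : HypSurface Γ) : (singChains (HypSurface Γ)).X 0 :=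
  singSimplex 0 (ContinuousMap.const _ x)

theorem d_singSimplex_one (σ : C(stdSimplex ℝ (Fin 2), HypSurface Γ)) :
    ((singChains (HypSurface Γ)).d 1 0).hom (singSimplex 1 σ) =
      pointChain Γ (σ (stdSimplex.vertex 1)) - pointChain Γ (σ (stdSimplex.vertex 0)) := by
  rw [singChains_d, Fin.sum_univ_two]
  have h : ∀ t : stdSimplex ℝ (Fin (0 + 1)), t = stdSimplex.vertex 0 := fun t => by
    have : Subsingleton (stdSimplex ℝ (Fin (0 + 1))) :=
      inferInstanceAs (Subsingleton (stdSimplex ℝ (Fin 1)))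
    exact Subsingleton.elim _ _
  have e0 : singFace 0 σ = ContinuousMap.const _ (σ (stdSimplex.vertex 1)) := by
    ext t
    rw [h t]
    simp [singFace, stdSimplex.map_vertex]
  have e1 : singFace 1 σ = ContinuousMap.const _ (σ (stdSimplex.vertex 0)) := by
    ext t
    rw [h t]
    simp [singFace, stdSimplex.map_vertex]
  rw [e0, e1]
  simp [pointChain, sub_eq_add_neg]

theorem edge_vertex_one (f : C(ℝ, ℍ)) : edge f (stdSimplex.vertex 1) = f 1 := by
  simp [edge]

theorem edge_vertex_zero (f : C(ℝ, ℍ)) : edge f (stdSimplex.vertex 0) = f 0 := by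
  simp [edge]

theorem d_edgeChain (f : C(ℝ, ℍ)) :
    ((singChains (HypSurface Γ)).d 1 0).hom (edgeChain Γ f) =
      pointChain Γ (HypSurface.mk Γ (f 1)) - pointChain Γ (HypSurface.mk Γ (f 0)) := by
  rw [edgeChain, d_singSimplex_one]
  simp only [ContinuousMap.comp_apply, edge_vertex_one, edge_vertex_zero]
  rfl

theorem edgeChain_isomMap {g : ℍ ≃ᵢ ℍ} (hg : g ∈ Γ) (f : C(ℝ, ℍ)) :
    edgeChain Γ ((isomMap g).comp f) = edgeChain Γ f := by
  have : (HypSurface.proj Γ).comp (edge ((isomMap g).comp f)) =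
      (HypSurface.proj Γ).comp (edge f) := by
    ext t
    exact HypSurface.mk_apply hg _
  rw [edgeChain, edgeChain, this]

/-- The boundary of the cone over a path: the path is homologous to the broken path that joins its
ends by way of the apex. -/
theorem edgeChain_cone (z : ℍ) (f : C(ℝ, ℍ)) :
    edgeChain Γ f - edgeChain Γ (seg z (f 1)) + edgeChain Γ (seg z (f 0)) ∈
      LinearMap.range ((singChains (HypSurface Γ)).d 2 1).hom := by
  refine ⟨singSimplex 2 ((HypSurface.proj Γ).comp (cone z f)), ?_⟩
  rw [singChains_d, Fin.sum_univ_three]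
  have h : ∀ i, singFace i ((HypSurface.proj Γ).comp (cone z f)) =
      (HypSurface.proj Γ).comp (singFace i (cone z f)) := fun _ => rfl
  rw [h, h, h, face_zero_cone, face_one_cone, face_two_cone]
  simp [edgeChain, sub_eq_add_neg]

/-- The loop represented by `g`, based at the image of `i`. -/
def loopChain (Γ : Subgroup (ℍ ≃ᵢ ℍ)) (g : ℍ ≃ᵢ ℍ) : (singChains (HypSurface Γ)).X 1 :=
  edgeChain Γ (seg UpperHalfPlane.I (g UpperHalfPlane.I))

theorem d_loopChain {g : ℍ ≃ᵢ ℍ} (hg : g ∈ Γ) :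
    ((singChains (HypSurface Γ)).d 1 0).hom (loopChain Γ g) = 0 := by
  rw [loopChain, d_edgeChain, seg_one, seg_zero, HypSurface.mk_apply hg, sub_self]

/-- Modulo boundaries, sending `g` to the loop it represents is additive. -/
theorem loopChain_mul {g : ℍ ≃ᵢ ℍ} (hg : g ∈ Γ) (h : ℍ ≃ᵢ ℍ) :
    loopChain Γ h - loopChain Γ (g * h) + loopChain Γ g ∈
      LinearMap.range ((singChains (HypSurface Γ)).d 2 1).hom := by
  have := edgeChain_cone (Γ := Γ) UpperHalfPlane.I
    ((isomMap g).comp (seg UpperHalfPlane.I (h UpperHalfPlane.I)))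
  rw [edgeChain_isomMap hg] at this
  simpa [loopChain, isomMap, isometryEquiv_mul_apply] using this

end

noncomputable section

open CategoryTheory

/-! ### The first homology of the quotient surface -/

variable {Γ : Subgroup (ℍ ≃ᵢ ℍ)}

theorem isCoveringMap_mk (hΓ : IsSurfaceGroup Γ) : IsCoveringMap (HypSurface.mk Γ) := by
  let act : MulAction Γ ℍ :=
    { smul := fun g z => (g : ℍ ≃ᵢ ℍ) z
      one_smul := fun _ => rfl
      mul_smul := fun _ _ _ => rfl }
  have cont : ContinuousConstSMul Γ ℍ := ⟨fun g => (g : ℍ ≃ᵢ ℍ).continuous⟩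
  have pd : ProperlyDiscontinuousSMul Γ ℍ := by
    refine ⟨fun {K L} hK hL => ?_⟩
    have hfin := hΓ.properlyDiscontinuous (K ∪ L) (hK.union hL)
    refine (hfin.preimage (f := ((↑) : Γ → (ℍ ≃ᵢ ℍ))) Subtype.val_injective.injOn).subset ?_
    rintro g ⟨_, ⟨z, hz, rfl⟩, hw⟩
    exact ⟨g.2, _, ⟨z, Or.inl hz, rfl⟩, Or.inr hw⟩
  have canc : IsCancelSMul Γ ℍ := by
    rw [isCancelSMul_iff_eq_one_of_smul_eq]
    intro g z hz
    exact Subtype.ext (hΓ.free g g.2 z hz)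
  have hq : Topology.IsQuotientMap (HypSurface.mk Γ) := isQuotientMap_quotient_mk'
  refine (hq.isQuotientCoveringMap_of_properlyDiscontinuousSMul (G := Γ) ?_).isCoveringMap
  intro z w
  rw [HypSurface.mk_eq_mk_iff]
  constructor
  · rintro ⟨g, hg, rfl⟩
    exact ⟨⟨g⁻¹, Γ.inv_mem hg⟩, isometryEquiv_inv_apply_self g z⟩
  · rintro ⟨g, rfl⟩
    exact ⟨(g : ℍ ≃ᵢ ℍ)⁻¹, Γ.inv_mem g.2, isometryEquiv_inv_apply_self g w⟩

/-- Singular `1`-simplices lift to the universal cover. -/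
theorem exists_lift_simplex (hΓ : IsSurfaceGroup Γ) (σ : C(stdSimplex ℝ (Fin 2), HypSurface Γ))
    (z : ℍ) (hz : HypSurface.mk Γ z = σ (stdSimplex.vertex 0)) :
    ∃ f : C(ℝ, ℍ), (HypSurface.proj Γ).comp (edge f) = σ ∧ f 0 = z := by
  let e := stdSimplexHomeomorphUnitInterval
  obtain ⟨F, hF, hF0⟩ := (isCoveringMap_mk hΓ).exists_path_lifts
    (σ.comp ⟨e.symm, e.symm.continuous⟩) z (by
      have : e.symm 0 = stdSimplex.vertex 0 := e.symm_apply_eq.2 rfl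
      simp [this, hz])
  refine ⟨F.comp ⟨Set.projIcc 0 1 zero_le_one, continuous_projIcc⟩, ?_, ?_⟩
  · ext t
    have h1 : Set.projIcc (0 : ℝ) 1 zero_le_one (t 1) = e t :=
      Set.projIcc_of_mem zero_le_one (e t).2
    have h2 := congrFun hF (e t)
    simp only [Function.comp_apply, ContinuousMap.comp_apply, ContinuousMap.coe_mk,
      Homeomorph.symm_apply_apply] at h2
    rw [← h2, ← h1]
    rfl
  · rw [← hF0]
    simp

/-- Every singular `1`-chain is, up to boundaries and loops, determined by its boundary: `h` joins
the base point to each point of the surface by the projection of a segment. -/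
theorem exists_chain_decomposition (hΓ : IsSurfaceGroup Γ) :
    ∃ h : (singChains (HypSurface Γ)).X 0 →ₗ[ℚ] (singChains (HypSurface Γ)).X 1,
      ∀ z : (singChains (HypSurface Γ)).X 1,
        z - h (((singChains (HypSurface Γ)).d 1 0).hom z) ∈
          LinearMap.range ((singChains (HypSurface Γ)).d 2 1).hom ⊔
            Submodule.span ℚ (loopChain Γ '' (Γ : Set (ℍ ≃ᵢ ℍ))) := by
  choose s hs using HypSurface.mk_surjective (Γ := Γ)
  obtain ⟨h, hh⟩ := exists_singChains_hom (X := HypSurface Γ) 0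
    (M := (singChains (HypSurface Γ)).X 1)
    fun f => edgeChain Γ (seg UpperHalfPlane.I (s (f (stdSimplex.vertex 0))))
  have hpt : ∀ x, h (pointChain Γ x) = edgeChain Γ (seg UpperHalfPlane.I (s x)) := fun x => by
    rw [pointChain, hh]; rfl
  refine ⟨h, fun z => ?_⟩
  set B := LinearMap.range ((singChains (HypSurface Γ)).d 2 1).hom
  set L := Submodule.span ℚ (loopChain Γ '' (Γ : Set (ℍ ≃ᵢ ℍ)))
  have hz : z ∈ Submodule.span ℚ (Set.range (singSimplex (X := HypSurface Γ) 1)) := by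
    rw [span_singSimplex]; trivial
  induction hz using Submodule.span_induction with
  | mem z hz =>
    obtain ⟨σ, rfl⟩ := hz
    obtain ⟨f, rfl, hf0⟩ := exists_lift_simplex hΓ σ _ (hs (σ (stdSimplex.vertex 0)))
    obtain ⟨g, hg, hg1⟩ := HypSurface.mk_eq_mk_iff.1 (hs (HypSurface.mk Γ (f 1)))
    have hf0' : f 0 = s (HypSurface.mk Γ (f 0)) := by
      conv_lhs => rw [hf0]
      simp only [ContinuousMap.comp_apply]
      rw [edge_vertex_zero]
      rfl
    change edgeChain Γ f - h (((singChains (HypSurface Γ)).d 1 0).hom (edgeChain Γ f)) ∈ B ⊔ L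
    rw [d_edgeChain, map_sub, hpt, hpt, ← hf0']
    have c1 := edgeChain_cone (Γ := Γ) UpperHalfPlane.I f
    have c2 := edgeChain_cone (Γ := Γ) UpperHalfPlane.I
      ((isomMap g).comp (seg UpperHalfPlane.I (s (HypSurface.mk Γ (f 1)))))
    rw [edgeChain_isomMap hg] at c2
    have e1 : ((isomMap g).comp (seg UpperHalfPlane.I (s (HypSurface.mk Γ (f 1))))) 1 = f 1 := by
      simpa [isomMap] using hg1
    have e0 : ((isomMap g).comp (seg UpperHalfPlane.I (s (HypSurface.mk Γ (f 1))))) 0 =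
        g UpperHalfPlane.I := by
      simp [isomMap]
    rw [e1, e0] at c2
    have c3 : loopChain Γ g ∈ L := Submodule.subset_span ⟨g, hg, rfl⟩
    have : edgeChain Γ f - (edgeChain Γ (seg UpperHalfPlane.I (s (HypSurface.mk Γ (f 1)))) -
        edgeChain Γ (seg UpperHalfPlane.I (f 0))) =
      ((edgeChain Γ f - edgeChain Γ (seg UpperHalfPlane.I (f 1)) +
          edgeChain Γ (seg UpperHalfPlane.I (f 0))) -
        (edgeChain Γ (seg UpperHalfPlane.I (s (HypSurface.mk Γ (f 1)))) -
          edgeChain Γ (seg UpperHalfPlane.I (f 1)) + loopChain Γ g)) + loopChain Γ g := by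
      rw [loopChain]; abel
    rw [this]
    exact add_mem (Submodule.mem_sup_left (sub_mem c1 c2)) (Submodule.mem_sup_right c3)
  | zero => simp
  | add x y _ _ hx hy =>
    rw [map_add, map_add, add_sub_add_comm]
    exact add_mem hx hy
  | smul a x _ hx =>
    rw [map_smul, map_smul, ← smul_sub]
    exact Submodule.smul_mem _ _ hx

theorem loopChain_zpow {g : ℍ ≃ᵢ ℍ} (hg : g ∈ Γ) (n : ℤ) :
    loopChain Γ (g ^ n) - n • loopChain Γ g ∈
      LinearMap.range ((singChains (HypSurface Γ)).d 2 1).hom := by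
  set B := LinearMap.range ((singChains (HypSurface Γ)).d 2 1).hom
  have h1 : loopChain Γ (1 : ℍ ≃ᵢ ℍ) ∈ B := by
    have := loopChain_mul (Γ := Γ) Γ.one_mem 1
    rwa [mul_one, sub_self, zero_add] at this
  have step : ∀ k : ℤ, loopChain Γ (g ^ k) - loopChain Γ (g ^ (k + 1)) + loopChain Γ g ∈ B := by
    intro k
    have := loopChain_mul hg (g ^ k)
    rwa [← zpow_one_add, add_comm 1 k] at this
  induction n using Int.induction_on with
  | zero => simpa using h1
  | succ k ih =>
    have := sub_mem ih (step k)
    convert this using 1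
    rw [add_smul, one_smul]; abel
  | pred k ih =>
    have := add_mem ih (step (-k - 1))
    rw [sub_add_cancel] at this
    convert this using 1
    rw [sub_smul, one_smul]; abel

/-- The first Betti number of a surface with cyclic fundamental group is at most one. -/
theorem bettiNumber_one_le_of_cyclic (hΓ : IsSurfaceGroup Γ)
    (hc : ∃ g₀ ∈ Γ, ∀ g ∈ Γ, ∃ n : ℤ, g = g₀ ^ n) : bettiNumber (HypSurface Γ) 1 ≤ 1 := by
  obtain ⟨g₀, hg₀, hcyc⟩ := hc
  have : Module.rank ℚ ((singChains (HypSurface Γ)).homology 1) ≤ 1 := by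
    refine rank_homology_le_one _ (loopChain Γ g₀) (d_loopChain hg₀) fun z hz => ?_
    obtain ⟨h, hh⟩ := exists_chain_decomposition hΓ
    have h1 := hh z
    rw [hz, map_zero, sub_zero] at h1
    have hle : Submodule.span ℚ (loopChain Γ '' (Γ : Set (ℍ ≃ᵢ ℍ))) ≤
        LinearMap.range ((singChains (HypSurface Γ)).d 2 1).hom ⊔
          Submodule.span ℚ {loopChain Γ g₀} := by
      rw [Submodule.span_le]
      rintro _ ⟨g, hg, rfl⟩
      obtain ⟨n, rfl⟩ := hcyc g hg
      have e : loopChain Γ (g₀ ^ n) =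
          (loopChain Γ (g₀ ^ n) - n • loopChain Γ g₀) + (n : ℚ) • loopChain Γ g₀ := by
        rw [Int.cast_smul_eq_zsmul]; abel
      rw [SetLike.mem_coe, e]
      exact add_mem (Submodule.mem_sup_left (loopChain_zpow hg₀ n))
        (Submodule.mem_sup_right (Submodule.smul_mem _ _ (Submodule.mem_span_singleton_self _)))
    have h2 := (sup_le le_sup_left hle) h1
    obtain ⟨b, ⟨w, rfl⟩, c, hc, rfl⟩ := Submodule.mem_sup.1 h2
    obtain ⟨r, rfl⟩ := Submodule.mem_span_singleton.1 hc
    exact ⟨r, w, add_comm _ _⟩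
  have h3 : Cardinal.toENat _ ≤ Cardinal.toENat 1 := OrderHomClass.mono Cardinal.toENat this
  rw [map_one] at h3
  exact h3

theorem bettiNumber_zero_eq_one : bettiNumber (HypSurface Γ) 0 = 1 := by
  have : PathConnectedSpace ℍ := inferInstance
  have : PathConnectedSpace (TopCat.of (HypSurface Γ)) :=
    HypSurface.mk_surjective.pathConnectedSpace (HypSurface.proj Γ).continuous
  have e := (asIso ((TopCat.of (HypSurface Γ)).singularHomology₀ε (ModuleCat.of ℚ ℚ))).toLinearEquiv
  have : Module.rank ℚ (((AlgebraicTopology.singularHomologyFunctor (ModuleCat.{0} ℚ) 0).obj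
      (ModuleCat.of ℚ ℚ)).obj (TopCat.of (HypSurface Γ))) = 1 := by
    rw [e.rank_eq]
    exact Module.rank_self ℚ
  rw [bettiNumber, this, map_one]

/-- The fundamental group of a surface of negative Euler characteristic is not cyclic. -/
theorem not_cyclic_of_eulerChar_neg (hΓ : IsSurfaceGroup Γ)
    (hχ : surfaceEulerChar (HypSurface Γ) < 0) :
    ¬ ∃ g₀ ∈ Γ, ∀ g ∈ Γ, ∃ n : ℤ, g = g₀ ^ n := by
  intro hc
  have h1 := bettiNumber_one_le_of_cyclic hΓ hc
  rw [surfaceEulerChar, bettiNumber_zero_eq_one] at hχ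
  refine absurd hχ (not_lt.2 (add_nonneg ?_ (EReal.coe_ennreal_nonneg _)))
  have e1 : (((1 : ℕ∞) : ℝ≥0∞) : EReal) = 1 := by simp
  rw [EReal.sub_nonneg (Or.inl (by rw [e1]; exact EReal.coe_ne_top 1))
    (Or.inl (by rw [e1]; exact EReal.coe_ne_bot 1)), EReal.coe_ennreal_le_coe_ennreal_iff]
  exact_mod_cast h1

end

noncomputable section

/-! ### Matrix computations -/

/-- The matrix `diag(e^t, e^(-t))`, which translates the imaginary axis by `2 t`. -/
def hyp (t : ℝ) : GL (Fin 2) ℝ := glMk (Real.exp t) 0 0 (Real.exp (-t)) (by simp [← Real.exp_add])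

@[simp] theorem hyp_val (t : ℝ) : (hyp t).val = !![Real.exp t, 0; 0, Real.exp (-t)] := rfl

theorem hyp_det (t : ℝ) : (hyp t).val.det = 1 := by
  simp [Matrix.det_fin_two_of, ← Real.exp_add]

theorem hyp_add (s t : ℝ) : hyp (s + t) = hyp s * hyp t := by
  ext i j
  fin_cases i <;> fin_cases j <;> simp [← Real.exp_add, add_comm]

/-- The one-parameter group of translations along the imaginary axis. -/
def hypHom : Multiplicative ℝ →* GL (Fin 2) ℝ where
  toFun t := hyp t.toAdd
  map_one' := by ext i j; fin_cases i <;> fin_cases j <;> simp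
  map_mul' s t := hyp_add _ _

theorem hyp_zpow (t : ℝ) (n : ℤ) : hyp t ^ n = hyp (n * t) := by
  have := map_zpow hypHom (Multiplicative.ofAdd t) n
  rw [← zsmul_eq_mul]
  exact this.symm

theorem hyp_pow (t : ℝ) (n : ℕ) : hyp t ^ n = hyp (n * t) := by
  rw [← zpow_natCast, hyp_zpow, Int.cast_natCast]

theorem hyp_inv (t : ℝ) : (hyp t)⁻¹ = hyp (-t) := by
  have := hyp_zpow t (-1)
  simpa using this

/-- The trace of the commutator of two matrices. -/
def ctr (M V : GL (Fin 2) ℝ) : ℝ := (M * V * M⁻¹ * V⁻¹).val.trace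

theorem trace_conj (Q M : GL (Fin 2) ℝ) : (Q⁻¹ * M * Q).val.trace = M.val.trace := by
  rw [Units.val_mul, Matrix.trace_mul_comm, ← Units.val_mul]
  congr 2
  group

theorem det_conj (Q M : GL (Fin 2) ℝ) : (Q⁻¹ * M * Q).val.det = M.val.det := by
  rw [Units.val_mul, Matrix.det_mul_comm, ← Units.val_mul]
  congr 2
  group

theorem trace_conj_inv (Q M : GL (Fin 2) ℝ) : (Q * M * Q⁻¹).val.trace = M.val.trace := by
  simpa using trace_conj Q⁻¹ M

theorem det_conj_inv (Q M : GL (Fin 2) ℝ) : (Q * M * Q⁻¹).val.det = M.val.det := by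
  have := det_conj Q⁻¹ M
  rwa [inv_inv] at this

theorem ctr_conj (Q M V : GL (Fin 2) ℝ) : ctr (Q⁻¹ * M * Q) (Q⁻¹ * V * Q) = ctr M V := by
  rw [ctr, ctr, ← trace_conj Q (M * V * M⁻¹ * V⁻¹)]
  congr 2
  group

theorem inv_val (M : GL (Fin 2) ℝ) :
    (M⁻¹).val = (M.val.det)⁻¹ • !![M 1 1, -M 0 1; -M 1 0, M 0 0] := by
  rw [Matrix.coe_units_inv, Matrix.inv_def, Matrix.adjugate_fin_two, Ring.inverse_eq_inv']

theorem inv_val_of_det_one {M : GL (Fin 2) ℝ} (h : M.val.det = 1) :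
    (M⁻¹).val = !![M 1 1, -M 0 1; -M 1 0, M 0 0] := by
  rw [inv_val, h, inv_one, one_smul]

theorem det_eq (M : GL (Fin 2) ℝ) : M.val.det = M 0 0 * M 1 1 - M 0 1 * M 1 0 :=
  Matrix.det_fin_two _

theorem ctr_hyp (M : GL (Fin 2) ℝ) (t : ℝ) :
    ctr M (hyp t) = 2 - M 0 1 * M 1 0 * (Real.exp t - Real.exp (-t)) ^ 2 / M.val.det := by
  have hd : M.val.det ≠ 0 := M.det_ne_zero
  rw [ctr, hyp_inv, Units.val_mul, Units.val_mul, Units.val_mul, inv_val]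
  have e : Real.exp t * Real.exp (-t) = 1 := by rw [← Real.exp_add]; simp
  simp only [Matrix.mul_smul, Matrix.smul_mul, Matrix.trace_smul, smul_eq_mul]
  rw [inv_mul_eq_div, eq_sub_iff_add_eq, ← add_div, div_eq_iff hd, det_eq]
  simp [Matrix.trace_fin_two, Matrix.mul_apply, Fin.sum_univ_two]
  linear_combination (2 * M 0 0 * M 1 1 - 2 * M 0 1 * M 1 0) * e

theorem ctr_diag {p q : ℝ} (h : p * q - 0 * 0 ≠ 0) {V : GL (Fin 2) ℝ} (hV : V.val.det = 1) :
    ctr (glMk p 0 0 q h) V = 2 - V 0 1 * V 1 0 * (p - q) ^ 2 / (p * q) := by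
  have hpq : p * q ≠ 0 := by simpa using h
  rw [ctr, Units.val_mul, Units.val_mul, Units.val_mul, inv_val_of_det_one hV, inv_val]
  rw [det_eq] at hV
  simp only [Matrix.mul_smul, Matrix.smul_mul, Matrix.trace_smul, smul_eq_mul]
  rw [inv_mul_eq_div, eq_sub_iff_add_eq, glMk_det]
  rw [show p * q - 0 * 0 = p * q by ring, ← add_div, div_eq_iff hpq]
  obtain ⟨a, b, c, d, hV'⟩ : ∃ a b c d, V.val = !![a, b; c, d] :=
    ⟨_, _, _, _, Matrix.eta_fin_two V.val⟩
  rw [hV'] at hV ⊢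
  simp [Matrix.trace_fin_two] at hV ⊢
  linear_combination (2 * p * q) * hV

theorem exists_eigenbasis (V : Matrix (Fin 2) (Fin 2) ℝ) {p q : ℝ} (hne : p ≠ q)
    (htr : V.trace = p + q) (hdet : V.det = p * q) :
    ∃ Q : GL (Fin 2) ℝ, V * Q.val = Q.val * !![p, 0; 0, q] := by
  rw [Matrix.trace_fin_two] at htr
  rw [Matrix.det_fin_two] at hdet
  have hpq : p - q ≠ 0 := sub_ne_zero.2 hne
  obtain ⟨a, b, c, d, rfl⟩ : ∃ a b c d, V = !![a, b; c, d] := ⟨_, _, _, _, Matrix.eta_fin_two V⟩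
  simp at htr hdet
  have hd : d = p + q - a := by linarith
  subst hd
  by_cases hc : c = 0
  · by_cases hb : b = 0
    · subst hb hc
      have h : (a - p) * (a - q) = 0 := by linarith
      rcases mul_eq_zero.1 h with h | h
      · refine ⟨1, ?_⟩
        have : a = p := by linarith
        subst this
        ext i j; fin_cases i <;> fin_cases j <;> simp
      · refine ⟨glMk 0 1 1 0 (by simp), ?_⟩
        have : a = q := by linarith
        subst this
        ext i j; fin_cases i <;> fin_cases j <;> simp
    · refine ⟨glMk b b (p - a) (q - a) (by
        rw [← mul_sub]; refine mul_ne_zero hb ?_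
        intro h; apply hpq; linarith), ?_⟩
      ext i j; fin_cases i <;> fin_cases j <;> simp [Matrix.mul_apply, Fin.sum_univ_two] <;>
        linarith
  · refine ⟨glMk (a - q) (a - p) c c (by
        rw [mul_comm (a - p), mul_comm (a - q), ← mul_sub]; refine mul_ne_zero hc ?_
        intro h; apply hpq; linarith), ?_⟩
    ext i j; fin_cases i <;> fin_cases j <;> simp [Matrix.mul_apply, Fin.sum_univ_two] <;>
      linarith

/-- Diagonalization of a matrix with distinct nonzero real eigenvalues. -/
theorem exists_conj_eq_diag (V : GL (Fin 2) ℝ) {p q : ℝ} (h : p * q - 0 * 0 ≠ 0) (hne : p ≠ q)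
    (htr : V.val.trace = p + q) (hdet : V.val.det = p * q) :
    ∃ Q : GL (Fin 2) ℝ, Q⁻¹ * V * Q = glMk p 0 0 q h := by
  obtain ⟨Q, hQ⟩ := exists_eigenbasis V.val hne htr hdet
  refine ⟨Q, ?_⟩
  rw [mul_assoc, inv_mul_eq_iff_eq_mul]
  exact Units.ext hQ

/-- A matrix of determinant one and trace larger than two is conjugate to some `hyp t`. -/
theorem exists_conj_eq_hyp (V : GL (Fin 2) ℝ) (hdet : V.val.det = 1) (htr : 2 < V.val.trace) :
    ∃ (Q : GL (Fin 2) ℝ) (t : ℝ), 0 < t ∧ V.val.trace = Real.exp t + Real.exp (-t) ∧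
      Q⁻¹ * V * Q = hyp t := by
  set t := Real.arcosh (V.val.trace / 2) with ht
  have h1 : Real.cosh t = V.val.trace / 2 := Real.cosh_arcosh (by linarith)
  have h0 : 0 < t := Real.arcosh_pos (by linarith)
  rw [Real.cosh_eq] at h1
  have h2 : V.val.trace = Real.exp t + Real.exp (-t) := by linarith
  obtain ⟨Q, hQ⟩ := exists_conj_eq_diag V (p := Real.exp t) (q := Real.exp (-t))
    (by simp [← Real.exp_add]) (fun h => by have := Real.exp_injective h; linarith) h2
    (by rw [hdet, ← Real.exp_add]; simp)
  exact ⟨Q, t, h0, h2, hQ⟩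

/-- Matrices of determinant `±1` that define the same isometry agree up to sign. -/
theorem eq_or_eq_neg_of_mobius_eq {M N : GL (Fin 2) ℝ} (hM : |M.val.det| = 1)
    (hN : |N.val.det| = 1) (h : mobius M = mobius N) : M = N ∨ M = -N := by
  have hc : N⁻¹ * M ∈ Subgroup.center (GL (Fin 2) ℝ) := by
    rw [← UpperHalfPlane.forall_smul_eq_self_iff_mem_center]
    intro z
    have : mobius (N⁻¹ * M) = 1 := by rw [map_mul, map_inv, h, inv_mul_cancel]
    have := congrArg (fun g : ℍ ≃ᵢ ℍ => g z) this
    exact this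
  rw [Matrix.GeneralLinearGroup.mem_center_iff_val_mem_range_scalar] at hc
  obtain ⟨u, hu⟩ := hc
  have hMN : M.val = u • N.val := by
    have : M = N * (N⁻¹ * M) := by group
    rw [this, Units.val_mul, ← hu]
    ext i j
    simp [Matrix.scalar, mul_comm]
  have hu2 : |u| = 1 := by
    rw [hMN, Matrix.det_smul, abs_mul, hN, mul_one] at hM
    simp at hM
    rcases hM with h | h <;> simp [h]
  rcases (abs_eq zero_le_one).1 hu2 with rfl | rfl
  · left; exact Units.ext (by simpa using hMN)
  · right; exact Units.ext (by simpa using hMN)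

/-! ### Discreteness -/

theorem cosh_dist_smul_I {M : GL (Fin 2) ℝ} (hM : |M.val.det| = 1) :
    Real.cosh (dist (M • UpperHalfPlane.I) UpperHalfPlane.I) =
      (M 0 0 ^ 2 + M 0 1 ^ 2 + M 1 0 ^ 2 + M 1 1 ^ 2) / 2 := by
  have hp := smul_denom_pos M UpperHalfPlane.I
  have h2 : M.val.det ^ 2 = 1 := by rw [← sq_abs, hM]; norm_num
  rw [det_eq] at h2
  rw [cosh_dist_formula, re_smul_formula, im_smul_formula, hM]
  simp at hp ⊢
  field_simp
  linear_combination -h2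

variable {Γ : Subgroup (ℍ ≃ᵢ ℍ)}

/-- Only finitely many elements of a discrete group are given by matrices with bounded entries. -/
theorem IsSurfaceGroup.finite_bounded (hΓ : IsSurfaceGroup Γ) (R : ℝ) :
    {g : ℍ ≃ᵢ ℍ | g ∈ Γ ∧ ∃ M : GL (Fin 2) ℝ, |M.val.det| = 1 ∧ (∀ i j, |M i j| ≤ R) ∧
      mobius M = g}.Finite := by
  refine (hΓ.properlyDiscontinuous (Metric.closedBall UpperHalfPlane.I (4 * R ^ 2))
    (isCompact_closedBall _ _)).subset ?_
  rintro _ ⟨hg, M, hM, hb, rfl⟩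
  refine ⟨hg, mobius M UpperHalfPlane.I, ⟨_, Metric.mem_closedBall_self (by positivity), rfl⟩, ?_⟩
  rw [Metric.mem_closedBall, mobius_apply,
    ← abs_of_nonneg (dist_nonneg (x := M • UpperHalfPlane.I)),
    ← abs_of_nonneg (show 0 ≤ 4 * R ^ 2 by positivity), ← Real.cosh_le_cosh, cosh_dist_smul_I hM]
  have hsq : ∀ i j, M i j ^ 2 ≤ R ^ 2 := fun i j => sq_le_sq.2 ((hb i j).trans (le_abs_self R))
  have h1 := Real.add_one_le_exp (4 * R ^ 2)
  have h2 := Real.exp_pos (-(4 * R ^ 2))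
  rw [Real.cosh_eq]
  linarith [hsq 0 0, hsq 0 1, hsq 1 0, hsq 1 1]

/-- The group `Γ` in the coordinates given by `Q`. -/
def conjGroup (Γ : Subgroup (ℍ ≃ᵢ ℍ)) (Q : GL (Fin 2) ℝ) : Subgroup (ℍ ≃ᵢ ℍ) :=
  Γ.comap (MulAut.conj (mobius Q)).toMonoidHom

theorem mem_conjGroup {Q : GL (Fin 2) ℝ} {h : ℍ ≃ᵢ ℍ} :
    h ∈ conjGroup Γ Q ↔ mobius Q * h * (mobius Q)⁻¹ ∈ Γ := Iff.rfl

theorem mobius_conj_mem_conjGroup {Q M : GL (Fin 2) ℝ} :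
    mobius (Q⁻¹ * M * Q) ∈ conjGroup Γ Q ↔ mobius M ∈ Γ := by
  rw [mem_conjGroup, ← map_mul, ← map_inv, ← map_mul]
  have : Q * (Q⁻¹ * M * Q) * Q⁻¹ = M := by group
  rw [this]

theorem mobius_conj_inv_mem {Q N : GL (Fin 2) ℝ} (hN : mobius N ∈ conjGroup Γ Q) :
    mobius (Q * N * Q⁻¹) ∈ Γ := by
  rw [← mobius_conj_mem_conjGroup (Q := Q)]
  rwa [show Q⁻¹ * (Q * N * Q⁻¹) * Q = N by group]

theorem IsSurfaceGroup.conj (hΓ : IsSurfaceGroup Γ) (Q : GL (Fin 2) ℝ) :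
    IsSurfaceGroup (conjGroup Γ Q) where
  free g hg z hz := by
    have h := hΓ.free _ (mem_conjGroup.1 hg) (mobius Q z) (by
      simp only [isometryEquiv_mul_apply, isometryEquiv_inv_apply_self, hz])
    rwa [conj_eq_one_iff] at h
  properlyDiscontinuous K hK := by
    have h := hΓ.properlyDiscontinuous (mobius Q '' K) (hK.image (mobius Q).continuous)
    refine (h.preimage (f := MulAut.conj (mobius Q)) (MulEquiv.injective _).injOn).subset ?_
    rintro g ⟨hg, _, ⟨z, hz, rfl⟩, hw⟩
    refine ⟨hg, mobius Q (g z), ⟨mobius Q z, ⟨z, hz, rfl⟩, ?_⟩, ⟨_, hw, rfl⟩⟩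
    simp only [MulAut.conj_apply, isometryEquiv_mul_apply, isometryEquiv_inv_apply_self]

end

noncomputable section

/-! ### Elements that nearly preserve the axis of a hyperbolic element -/

variable {Γ : Subgroup (ℍ ≃ᵢ ℍ)}

theorem hyp_mul_mul_hyp (s t : ℝ) (M : GL (Fin 2) ℝ) :
    (hyp s * M * hyp t).val = !![Real.exp (s + t) * M 0 0, Real.exp (s - t) * M 0 1;
      Real.exp (-(s - t)) * M 1 0, Real.exp (-(s + t)) * M 1 1] := by
  obtain ⟨a, b, c, d, hM⟩ : ∃ a b c d, M.val = !![a, b; c, d] :=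
    ⟨_, _, _, _, Matrix.eta_fin_two M.val⟩
  rw [Units.val_mul, Units.val_mul, hM]
  ext i j
  fin_cases i <;> fin_cases j <;>
    simp [Real.exp_add, Real.exp_sub, Real.exp_neg] <;> field_simp

theorem det_mul_mul_hyp (s t : ℝ) (M : GL (Fin 2) ℝ) :
    (hyp s * M * hyp t).val.det = M.val.det := by
  rw [Units.val_mul, Units.val_mul, Matrix.det_mul, Matrix.det_mul, hyp_det, hyp_det]
  ring

theorem mobius_mul_mul_hyp_mem {t : ℝ} (ht : mobius (hyp t) ∈ Γ) {M : GL (Fin 2) ℝ}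
    (hM : mobius M ∈ Γ) (m n : ℤ) : mobius (hyp (m * t) * M * hyp (n * t)) ∈ Γ := by
  rw [map_mul, map_mul, ← hyp_zpow, ← hyp_zpow, map_zpow, map_zpow]
  exact Γ.mul_mem (Γ.mul_mem (Γ.zpow_mem ht m) hM) (Γ.zpow_mem ht n)

/-- In a discrete group that contains a translation of the imaginary axis, an element that preserves
one end of the axis preserves both. -/
theorem IsSurfaceGroup.offDiag_eq_zero (hΓ : IsSurfaceGroup Γ) {t : ℝ} (ht0 : 0 < t)
    (ht : mobius (hyp t) ∈ Γ) {M : GL (Fin 2) ℝ} (hM : |M.val.det| = 1) (hMΓ : mobius M ∈ Γ)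
    (h0 : M 0 1 * M 1 0 = 0) : M 0 1 = 0 ∧ M 1 0 = 0 := by
  by_contra hne
  -- conjugation by the translation contracts the nonzero off-diagonal entry
  obtain ⟨s, hs⟩ : ∃ s : ℤ, s = 1 ∧ M 0 1 = 0 ∨ s = -1 ∧ M 1 0 = 0 := by
    rcases mul_eq_zero.1 h0 with h | h
    · exact ⟨1, Or.inl ⟨rfl, h⟩⟩
    · exact ⟨-1, Or.inr ⟨rfl, h⟩⟩
  let N : ℕ → GL (Fin 2) ℝ := fun n => hyp ((s * n : ℤ) * t) * M * hyp ((-(s * n) : ℤ) * t)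
  have hval : ∀ n, (N n).val = !![M 0 0, Real.exp (2 * s * n * t) * M 0 1;
      Real.exp (-(2 * s * n * t)) * M 1 0, M 1 1] := by
    intro n
    simp only [N]
    rw [hyp_mul_mul_hyp]
    push_cast
    have e1 : (s : ℝ) * n * t + -(s * n) * t = 0 := by ring
    have e2 : (s : ℝ) * n * t - -(s * n) * t = 2 * s * n * t := by ring
    rw [e1, e2]
    simp
  have hdet : ∀ n, |(N n).val.det| = 1 := fun n => by rw [det_mul_mul_hyp, hM]
  set R : ℝ := |M 0 0| + |M 0 1| + |M 1 0| + |M 1 1|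
  have hR : ∀ n i j, |N n i j| ≤ R := by
    intro n i j
    have a0 := abs_nonneg (M 0 0); have a1 := abs_nonneg (M 0 1)
    have a2 := abs_nonneg (M 1 0); have a3 := abs_nonneg (M 1 1)
    have hnt : 0 ≤ (n : ℝ) * t := by positivity
    have hexp : Real.exp (-(2 * (n * t))) ≤ 1 := Real.exp_le_one_iff.2 (by linarith)
    rw [hval]
    rcases hs with ⟨rfl, h⟩ | ⟨rfl, h⟩
    · have : Real.exp (-(2 * (n * t))) * |M 1 0| ≤ |M 1 0| := mul_le_of_le_one_left a2 hexp
      fin_cases i <;> fin_cases j <;> simp [h, abs_mul, R, mul_assoc] <;> linarith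
    · have : Real.exp (-(2 * (n * t))) * |M 0 1| ≤ |M 0 1| := mul_le_of_le_one_left a1 hexp
      fin_cases i <;> fin_cases j <;> simp [h, abs_mul, R, mul_assoc] <;> linarith
  have hfin := hΓ.finite_bounded R
  have hmaps : ∀ n, mobius (N n) ∈ {g : ℍ ≃ᵢ ℍ | g ∈ Γ ∧ ∃ M : GL (Fin 2) ℝ, |M.val.det| = 1 ∧
      (∀ i j, |M i j| ≤ R) ∧ mobius M = g} :=
    fun n => ⟨mobius_mul_mul_hyp_mem ht hMΓ _ _, N n, hdet n, hR n, rfl⟩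
  obtain ⟨m, -, n, -, hmn, heq⟩ := Set.infinite_univ.exists_ne_map_eq_of_mapsTo
    (f := fun n => mobius (N n)) (fun n _ => hmaps n) hfin
  have habs : ∀ i j, |N m i j| = |N n i j| := by
    intro i j
    rcases eq_or_eq_neg_of_mobius_eq (hdet m) (hdet n) heq with h | h
    · rw [h]
    · rw [h]; simp
  have key : ∀ x : ℝ, x ≠ 0 → ∀ σ : ℝ, σ ≠ 0 →
      |Real.exp (σ * m) * x| = |Real.exp (σ * n) * x| → False := by
    intro x hx σ hσ h
    rw [abs_mul, abs_mul, abs_of_pos (Real.exp_pos _), abs_of_pos (Real.exp_pos _)] at h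
    have := Real.exp_injective (mul_right_cancel₀ (abs_ne_zero.2 hx) h)
    exact hmn (Nat.cast_injective (mul_left_cancel₀ hσ this))
  rcases hs with ⟨rfl, h⟩ | ⟨rfl, h⟩
  · have h10 : M 1 0 ≠ 0 := fun h' => hne ⟨h, h'⟩
    refine key _ h10 (-(2 * t)) (by simp [ht0.ne']) ?_
    have := habs 1 0
    rw [hval, hval] at this
    simp only [Matrix.of_apply, Matrix.cons_val', Matrix.cons_val_zero, Matrix.cons_val_one,
      Matrix.cons_val_fin_one] at this
    convert this using 4 <;> push_cast <;> ring
  · have h01 : M 0 1 ≠ 0 := fun h' => hne ⟨h', h⟩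
    refine key _ h01 (-(2 * t)) (by simp [ht0.ne']) ?_
    have := habs 0 1
    rw [hval, hval] at this
    simp only [Matrix.of_apply, Matrix.cons_val', Matrix.cons_val_zero, Matrix.cons_val_one,
      Matrix.cons_val_fin_one] at this
    convert this using 4 <;> push_cast <;> ring

/-- In a discrete group that contains a translation of the imaginary axis, an element that nearly
preserves the axis preserves it: up to multiplication by powers of the translation there are only
finitely many elements to consider. -/
theorem IsSurfaceGroup.exists_offDiag_gap (hΓ : IsSurfaceGroup Γ) {t : ℝ} (ht0 : 0 < t)
    (ht : mobius (hyp t) ∈ Γ) :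
    ∃ ε > 0, ∀ M : GL (Fin 2) ℝ, |M.val.det| = 1 → mobius M ∈ Γ → |M 0 1 * M 1 0| < ε →
      M 0 1 * M 1 0 = 0 := by
  set y : ℝ := Real.exp (2 * t) with hy
  have hy1 : 1 < y := Real.one_lt_exp_iff.2 (by linarith)
  set R : ℝ := y + 2
  have hfin := hΓ.finite_bounded R
  -- the finitely many values of the product of the off-diagonal entries
  let val : (ℍ ≃ᵢ ℍ) → ℝ := fun g =>
    |(exists_mobius_eq g).choose 0 1 * (exists_mobius_eq g).choose 1 0|
  have hval : ∀ M : GL (Fin 2) ℝ, |M.val.det| = 1 → val (mobius M) = |M 0 1 * M 1 0| := by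
    intro M hM
    obtain ⟨h1, h2⟩ := (exists_mobius_eq (mobius M)).choose_spec
    simp only [val]
    rcases eq_or_eq_neg_of_mobius_eq h1 hM h2 with h | h <;> simp [h]
  obtain ⟨ε, hε, hεv⟩ : ∃ ε > 0, ∀ g ∈ Γ, (∃ M : GL (Fin 2) ℝ, |M.val.det| = 1 ∧
      (∀ i j, |M i j| ≤ R) ∧ mobius M = g) → val g < ε → val g = 0 := by
    have hfin' := (hfin.image val).sdiff (t := {0})
    have hev : ∀ᶠ ε in 𝓝[>] (0 : ℝ), ∀ v ∈ (val '' {g : ℍ ≃ᵢ ℍ | g ∈ Γ ∧ ∃ M : GL (Fin 2) ℝ,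
        |M.val.det| = 1 ∧ (∀ i j, |M i j| ≤ R) ∧ mobius M = g}) \ {0}, ε < v := by
      rw [Filter.eventually_all_finite hfin']
      rintro v ⟨⟨g, -, rfl⟩, hv⟩
      have : 0 < val g := lt_of_le_of_ne (abs_nonneg _) (Ne.symm hv)
      exact nhdsWithin_le_nhds (eventually_lt_nhds this)
    obtain ⟨ε, h1, h2⟩ := (hev.and self_mem_nhdsWithin).exists
    refine ⟨ε, h2, fun g hg hM hlt => ?_⟩
    by_contra hne
    exact absurd (h1 (val g) ⟨⟨g, ⟨hg, hM⟩, rfl⟩, hne⟩) (not_lt.2 hlt.le)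
  refine ⟨min ε (1 / 2), lt_min hε (by norm_num), fun M hM hMΓ hlt => ?_⟩
  by_contra hne
  have hb : M 0 1 ≠ 0 := left_ne_zero_of_mul hne
  have hlt1 : |M 0 1 * M 1 0| < 1 / 2 := hlt.trans_le (min_le_right _ _)
  have had : |M 0 0 * M 1 1| ≤ 3 / 2 ∧ 1 / 2 < |M 0 0 * M 1 1| := by
    rw [det_eq] at hM
    have h1 := abs_sub_abs_le_abs_sub (M 0 0 * M 1 1) (M 0 1 * M 1 0)
    have h2 := abs_sub (M 0 0 * M 1 1) (M 0 1 * M 1 0)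
    constructor <;> linarith
  have ha : M 0 0 ≠ 0 := fun h => by rw [h] at had; norm_num at had
  obtain ⟨i, hi⟩ := exists_mem_Ico_zpow (abs_pos.2 ha) hy1
  obtain ⟨j, hj⟩ := exists_mem_Ico_zpow (abs_pos.2 hb) hy1
  have hpow : ∀ k : ℤ, y ^ k = Real.exp (2 * k * t) := by
    intro k
    rw [hy, ← Real.rpow_intCast, ← Real.exp_mul]; congr 1; ring
  set N := hyp ((-(i + j) : ℤ) * t) * M * hyp ((j - i : ℤ) * t) with hN
  have hNval : N.val = !![Real.exp (-(2 * i * t)) * M 0 0, Real.exp (-(2 * j * t)) * M 0 1;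
      Real.exp (2 * j * t) * M 1 0, Real.exp (2 * i * t) * M 1 1] := by
    rw [hN, hyp_mul_mul_hyp]
    push_cast
    have e1 : -((i : ℝ) + j) * t + (j - i) * t = -(2 * i * t) := by ring
    have e2 : -((i : ℝ) + j) * t - (j - i) * t = -(2 * j * t) := by ring
    rw [e1, e2, neg_neg, neg_neg]
  have hNdet : |N.val.det| = 1 := by rw [hN, det_mul_mul_hyp, hM]
  have hNprod : N 0 1 * N 1 0 = M 0 1 * M 1 0 := by
    rw [hNval]
    have e : Real.exp (-(2 * j * t)) * Real.exp (2 * j * t) = 1 := by rw [← Real.exp_add]; simp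
    simp
    linear_combination (M 0 1 * M 1 0) * e
  -- the translates can be chosen so that the entries become bounded
  have key : ∀ (k : ℤ) (u v r : ℝ), |u| ∈ Set.Ico (y ^ k) (y ^ (k + 1)) → |u * v| ≤ r →
      |Real.exp (-(2 * k * t)) * u| ≤ y ∧ |Real.exp (2 * k * t) * v| ≤ r := by
    intro k u v r hu huv
    have hE : Real.exp (-(2 * k * t)) * Real.exp (2 * k * t) = 1 := by rw [← Real.exp_add]; simp
    have hE1 := Real.exp_pos (-(2 * k * t))
    have hE2 := Real.exp_pos (2 * k * t)
    have hy0 : 0 < y := by linarith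
    rw [zpow_add_one₀ hy0.ne', hpow] at hu
    rw [abs_mul, abs_mul, abs_of_pos hE1, abs_of_pos hE2]
    constructor
    · calc Real.exp (-(2 * k * t)) * |u| ≤ Real.exp (-(2 * k * t)) * (Real.exp (2 * k * t) * y) :=
          mul_le_mul_of_nonneg_left hu.2.le hE1.le
        _ = y := by rw [← mul_assoc, hE, one_mul]
    · rw [abs_mul] at huv
      exact (mul_le_mul_of_nonneg_right hu.1 (abs_nonneg v)).trans huv
  obtain ⟨k1, k2⟩ := key i (M 0 0) (M 1 1) _ hi had.1
  obtain ⟨k3, k4⟩ := key j (M 0 1) (M 1 0) _ hj hlt1.le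
  rw [abs_mul, Real.abs_exp] at k1 k2 k3 k4
  have hR : ∀ i j, |N i j| ≤ R := by
    intro a b
    rw [hNval]
    fin_cases a <;> fin_cases b <;> simp [R] <;> linarith
  have := hεv (mobius N) (mobius_mul_mul_hyp_mem ht hMΓ _ _) ⟨N, hNdet, hR, rfl⟩ (by
    rw [hval N hNdet, hNprod]; exact hlt.trans_le (min_le_left _ _))
  rw [hval N hNdet, hNprod, abs_eq_zero] at this
  exact hne this

/-- In a discrete group, the traces of the commutators with a given hyperbolic element `V` do not
accumulate at two. -/
theorem IsSurfaceGroup.exists_ctr_gap (hΓ : IsSurfaceGroup Γ) {V : GL (Fin 2) ℝ}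
    (hV : V.val.det = 1) (htr : 2 < V.val.trace) (hVΓ : mobius V ∈ Γ) :
    ∃ ε > 0, ∀ M : GL (Fin 2) ℝ, |M.val.det| = 1 → mobius M ∈ Γ → |ctr M V - 2| < ε →
      ctr M V = 2 := by
  obtain ⟨Q, t, ht0, -, hQ⟩ := exists_conj_eq_hyp V hV htr
  have hmem : mobius (hyp t) ∈ conjGroup Γ Q := by rw [← hQ]; exact mobius_conj_mem_conjGroup.2 hVΓ
  obtain ⟨ε, hε, h⟩ := (hΓ.conj Q).exists_offDiag_gap ht0 hmem
  have hpos : 0 < (Real.exp t - Real.exp (-t)) ^ 2 := by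
    have : Real.exp (-t) < Real.exp t := Real.exp_lt_exp.2 (by linarith)
    exact pow_pos (by linarith) 2
  refine ⟨ε * (Real.exp t - Real.exp (-t)) ^ 2, by positivity, fun M hM hMΓ hlt => ?_⟩
  have hdet : |(Q⁻¹ * M * Q).val.det| = 1 := by rw [det_conj, hM]
  have hz := h (Q⁻¹ * M * Q) hdet (mobius_conj_mem_conjGroup.2 hMΓ) (by
    rw [← ctr_conj Q, hQ, ctr_hyp, sub_sub_cancel_left, abs_neg, abs_div, hdet, div_one, abs_mul,
      abs_of_pos hpos] at hlt
    exact lt_of_mul_lt_mul_right hlt hpos.le)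
  rw [← ctr_conj Q, hQ, ctr_hyp, hz]
  simp

end

noncomputable section

/-! ### Noncyclic groups contain hyperbolic elements with different axes -/

variable {Γ : Subgroup (ℍ ≃ᵢ ℍ)}

theorem IsSurfaceGroup.mobius_eq_one_of_fixed (hΓ : IsSurfaceGroup Γ) {M : GL (Fin 2) ℝ}
    (hM : |M.val.det| = 1) (hMΓ : mobius M ∈ Γ) (h : ∃ z : ℍ, M • z = z) : M = 1 ∨ M = -1 := by
  obtain ⟨z, hz⟩ := h
  have h1 := hΓ.free _ hMΓ z hz
  exact eq_or_eq_neg_of_mobius_eq hM (by simp) (by rw [h1, map_one])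

/-- A group acting freely contains no elliptic elements. -/
theorem IsSurfaceGroup.two_le_abs_trace (hΓ : IsSurfaceGroup Γ) {M : GL (Fin 2) ℝ}
    (hM : M.val.det = 1) (hMΓ : mobius M ∈ Γ) : 2 ≤ |M.val.trace| := by
  by_contra! hlt
  have hell : M.IsElliptic := by
    show M.val.discr < 0
    rw [Matrix.discr_fin_two, hM]
    have := sq_lt_sq' (abs_lt.1 hlt).1 (abs_lt.1 hlt).2
    linarith
  have hfix : ∃ z : ℍ, M • z = z :=
    ⟨_, (UpperHalfPlane.gl_smul_eq_self_iff_eq_fixedPt (by rw [hM]; exact one_pos) hell).2 rfl⟩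
  rcases hΓ.mobius_eq_one_of_fixed (by rw [hM, abs_one]) hMΓ hfix with rfl | rfl <;>
    simp at hlt

/-- A group acting freely contains no reflections. -/
theorem IsSurfaceGroup.trace_ne_zero (hΓ : IsSurfaceGroup Γ) {M : GL (Fin 2) ℝ}
    (hM : M.val.det = -1) (hMΓ : mobius M ∈ Γ) : M.val.trace ≠ 0 := by
  intro h0
  have hfix := (UpperHalfPlane.exists_gl_smul_eq_self_iff_trace_eq_zero
    (by rw [hM]; norm_num)).2 h0
  rcases hΓ.mobius_eq_one_of_fixed (by rw [hM]; simp) hMΓ hfix with rfl | rfl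
  · simp at hM; norm_num at hM
  · simp [Matrix.det_neg] at hM; norm_num at hM

/-- A discrete group with an injective and proper homomorphism to `ℝ` is cyclic. The homomorphism
`φ` is given on matrices; it takes the same value on `M` and `-M` because `φ (-1) = 0`. -/
theorem IsSurfaceGroup.cyclic_of_hom (hΓ : IsSurfaceGroup Γ) (φ : GL (Fin 2) ℝ → ℝ) (R : ℝ)
    (hmul : ∀ M N : GL (Fin 2) ℝ, |M.val.det| = 1 → |N.val.det| = 1 → mobius M ∈ Γ →
      mobius N ∈ Γ → φ (M * N) = φ M + φ N)
    (hker : ∀ M : GL (Fin 2) ℝ, |M.val.det| = 1 → mobius M ∈ Γ → φ M = 0 → mobius M = 1)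
    (hbdd : ∀ M : GL (Fin 2) ℝ, |M.val.det| = 1 → mobius M ∈ Γ → |φ M| ≤ 1 →
      ∀ i j, |M i j| ≤ R) :
    ∃ g₀ ∈ Γ, ∀ g ∈ Γ, ∃ n : ℤ, g = g₀ ^ n := by
  have h1 : |(1 : GL (Fin 2) ℝ).val.det| = 1 := by simp
  have hφ1 : φ 1 = 0 := by
    have := hmul 1 1 h1 h1 (by rw [map_one]; exact Γ.one_mem) (by rw [map_one]; exact Γ.one_mem)
    rw [mul_one] at this; linarith
  have hdetinv : ∀ M : GL (Fin 2) ℝ, |M.val.det| = 1 → |(M⁻¹).val.det| = 1 := by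
    intro M hM
    have : (M * M⁻¹).val.det = 1 := by simp
    rw [Units.val_mul, Matrix.det_mul] at this
    have h2 := congrArg abs this
    rwa [abs_mul, hM, one_mul, abs_one] at h2
  have hdetmul : ∀ M N : GL (Fin 2) ℝ, |M.val.det| = 1 → |N.val.det| = 1 →
      |(M * N).val.det| = 1 := by
    intro M N hM hN
    rw [Units.val_mul, Matrix.det_mul, abs_mul, hM, hN, one_mul]
  have hinv : ∀ M : GL (Fin 2) ℝ, |M.val.det| = 1 → mobius M ∈ Γ → φ M⁻¹ = -φ M := by
    intro M hM hMΓ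
    have := hmul M M⁻¹ hM (hdetinv M hM) hMΓ (by rw [map_inv]; exact Γ.inv_mem hMΓ)
    rw [mul_inv_cancel, hφ1] at this; linarith
  let S : AddSubgroup ℝ :=
    { carrier := {x | ∃ M : GL (Fin 2) ℝ, |M.val.det| = 1 ∧ mobius M ∈ Γ ∧ φ M = x}
      zero_mem' := ⟨1, h1, by rw [map_one]; exact Γ.one_mem, hφ1⟩
      add_mem' := by
        rintro _ _ ⟨M, hM, hMΓ, rfl⟩ ⟨N, hN, hNΓ, rfl⟩
        exact ⟨M * N, hdetmul M N hM hN, by rw [map_mul]; exact Γ.mul_mem hMΓ hNΓ,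
          hmul M N hM hN hMΓ hNΓ⟩
      neg_mem' := by
        rintro _ ⟨M, hM, hMΓ, rfl⟩
        exact ⟨M⁻¹, hdetinv M hM, by rw [map_inv]; exact Γ.inv_mem hMΓ, hinv M hM hMΓ⟩ }
  have hinj : ∀ M N : GL (Fin 2) ℝ, |M.val.det| = 1 → |N.val.det| = 1 → mobius M ∈ Γ →
      mobius N ∈ Γ → φ M = φ N → mobius M = mobius N := by
    intro M N hM hN hMΓ hNΓ h
    have hm : mobius (N⁻¹) ∈ Γ := by rw [map_inv]; exact Γ.inv_mem hNΓ
    have := hker (M * N⁻¹) (hdetmul _ _ hM (hdetinv N hN)) (by rw [map_mul]; exact Γ.mul_mem hMΓ hm)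
      (by rw [hmul _ _ hM (hdetinv N hN) hMΓ hm, hinv N hN hNΓ, h, add_neg_cancel])
    rwa [map_mul, map_inv, mul_inv_eq_one] at this
  -- `0` is isolated, because only finitely many elements are sent to the unit interval
  have hiso : ∃ a : ℝ, 0 < a ∧ Disjoint (S : Set ℝ) (Set.Ioo 0 a) := by
    have hfin : {x : ℝ | x ∈ S ∧ |x| ≤ 1}.Finite := by
      choose! ρ hρ using fun (x : ℝ) (hx : x ∈ S) => hx
      refine Set.Finite.of_finite_image (f := fun x => mobius (ρ x))
        ((hΓ.finite_bounded R).subset ?_) ?_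
      · rintro _ ⟨x, ⟨hx, hx1⟩, rfl⟩
        obtain ⟨r1, r2, r3⟩ := hρ x hx
        exact ⟨r2, ρ x, r1, hbdd _ r1 r2 (by rw [r3]; exact hx1), rfl⟩
      · rintro x ⟨hx, -⟩ y ⟨hy, -⟩ hxy
        obtain ⟨r1, r2, r3⟩ := hρ x hx
        obtain ⟨s1, s2, s3⟩ := hρ y hy
        rw [← r3, ← s3]
        rcases eq_or_eq_neg_of_mobius_eq r1 s1 hxy with h | h
        · rw [h]
        · -- a matrix and its negative have the same image
          have hneg : |(-1 : GL (Fin 2) ℝ).val.det| = 1 := by simp [Matrix.det_neg]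
          have hnegΓ : mobius (-1) ∈ Γ := by rw [mobius_neg, map_one]; exact Γ.one_mem
          have h2 := hmul (-1) (-1) hneg hneg hnegΓ hnegΓ
          rw [neg_mul_neg, mul_one, hφ1] at h2
          rw [h, ← neg_one_mul, hmul _ _ hneg s1 hnegΓ s2]
          linarith
    have hev : ∀ᶠ a in 𝓝[>] (0 : ℝ), ∀ x ∈ {x : ℝ | x ∈ S ∧ |x| ≤ 1} \ {0}, a < |x| := by
      rw [Filter.eventually_all_finite hfin.sdiff]
      rintro x ⟨-, hx⟩
      exact nhdsWithin_le_nhds (eventually_lt_nhds (abs_pos.2 hx))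
    have hev1 : ∀ᶠ a in 𝓝[>] (0 : ℝ), a < 1 := nhdsWithin_le_nhds (eventually_lt_nhds one_pos)
    obtain ⟨a, ⟨h2, h3⟩, h4⟩ := ((hev.and hev1).and self_mem_nhdsWithin).exists
    refine ⟨a, h4, Set.disjoint_left.2 fun x hx hxa => ?_⟩
    have habs : |x| = x := abs_of_pos hxa.1
    have := h2 x ⟨⟨hx, by rw [habs]; linarith [hxa.2]⟩, hxa.1.ne'⟩
    rw [habs] at this
    exact absurd hxa.2 (not_lt.2 this.le)
  obtain ⟨a, ha, hd⟩ := hiso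
  obtain ⟨b, hb⟩ := AddSubgroup.cyclic_of_isolated_zero ha hd
  have hbS : b ∈ S := by rw [hb]; exact AddSubgroup.mem_closure_singleton_self b
  obtain ⟨M₀, hM₀, hM₀Γ, rfl⟩ := hbS
  refine ⟨mobius M₀, hM₀Γ, fun g hg => ?_⟩
  obtain ⟨M, hM, rfl⟩ := exists_mobius_eq g
  have hMS : φ M ∈ S := ⟨M, hM, hg, rfl⟩
  rw [hb, AddSubgroup.mem_closure_singleton] at hMS
  obtain ⟨n, hn⟩ := hMS
  refine ⟨n, ?_⟩
  have hzdet : ∀ k : ℤ, |(M₀ ^ k).val.det| = 1 ∧ φ (M₀ ^ k) = k • φ M₀ := by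
    have hstep : ∀ k : ℤ, |(M₀ ^ k).val.det| = 1 → mobius (M₀ ^ k) ∈ Γ := fun k _ => by
      rw [map_zpow]; exact Γ.zpow_mem hM₀Γ k
    intro k
    induction k using Int.induction_on with
    | zero => simp [hφ1]
    | succ k ih =>
      have e := hdetmul _ _ ih.1 hM₀
      refine ⟨by rw [zpow_add_one]; exact e, ?_⟩
      rw [zpow_add_one, hmul _ _ ih.1 hM₀ (hstep _ ih.1) hM₀Γ, ih.2, add_smul, one_smul]
    | pred k ih =>
      have e := hdetmul _ _ ih.1 (hdetinv _ hM₀)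
      refine ⟨by rw [zpow_sub_one]; exact e, ?_⟩
      rw [zpow_sub_one, hmul _ _ ih.1 (hdetinv _ hM₀) (hstep _ ih.1)
        (by rw [map_inv]; exact Γ.inv_mem hM₀Γ), ih.2, hinv _ hM₀ hM₀Γ, sub_smul, one_smul,
        sub_eq_add_neg]
  rw [← map_zpow]
  exact hinj _ _ hM (hzdet n).1 hg (by rw [map_zpow]; exact Γ.zpow_mem hM₀Γ n)
    (by rw [(hzdet n).2, hn])

theorem cyclic_of_conjGroup {Q : GL (Fin 2) ℝ}
    (h : ∃ g₀ ∈ conjGroup Γ Q, ∀ g ∈ conjGroup Γ Q, ∃ n : ℤ, g = g₀ ^ n) :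
    ∃ g₀ ∈ Γ, ∀ g ∈ Γ, ∃ n : ℤ, g = g₀ ^ n := by
  obtain ⟨g₀, hg₀, h⟩ := h
  refine ⟨_, mem_conjGroup.1 hg₀, fun g hg => ?_⟩
  obtain ⟨n, hn⟩ := h ((mobius Q)⁻¹ * g * mobius Q) (by
    rw [mem_conjGroup]
    have : mobius Q * ((mobius Q)⁻¹ * g * mobius Q) * (mobius Q)⁻¹ = g := by group
    rwa [this])
  refine ⟨n, ?_⟩
  rw [conj_zpow, ← hn]
  group

/-- If all elements of a discrete group preserve the ends of the imaginary axis then the group is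
cyclic. -/
theorem IsSurfaceGroup.cyclic_of_diag (hΓ : IsSurfaceGroup Γ)
    (h : ∀ M : GL (Fin 2) ℝ, |M.val.det| = 1 → mobius M ∈ Γ → M 0 1 = 0 ∧ M 1 0 = 0) :
    ∃ g₀ ∈ Γ, ∀ g ∈ Γ, ∃ n : ℤ, g = g₀ ^ n := by
  have hprod : ∀ M : GL (Fin 2) ℝ, |M.val.det| = 1 → mobius M ∈ Γ → |M 0 0| * |M 1 1| = 1 := by
    intro M hM hMΓ
    have hb := (h M hM hMΓ).1
    rw [det_eq, hb] at hM
    rw [← abs_mul]; simpa using hM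
  have hne : ∀ M : GL (Fin 2) ℝ, |M.val.det| = 1 → mobius M ∈ Γ → M 0 0 ≠ 0 := by
    intro M hM hMΓ h0
    have := hprod M hM hMΓ
    rw [h0] at this; simp at this
  refine hΓ.cyclic_of_hom (fun M => Real.log |M 0 0|) (Real.exp 1) ?_ ?_ ?_
  · intro M N hM hN hMΓ hNΓ
    rw [← Real.log_mul (abs_ne_zero.2 (hne M hM hMΓ)) (abs_ne_zero.2 (hne N hN hNΓ)), ← abs_mul,
      Units.val_mul, Matrix.mul_apply, Fin.sum_univ_two, (h M hM hMΓ).1]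
    simp
  · intro M hM hMΓ h0
    have ha : |M 0 0| = 1 := by
      rcases Real.log_eq_zero.1 h0 with h' | h' | h'
      · exact absurd h' (abs_ne_zero.2 (hne M hM hMΓ))
      · exact h'
      · linarith [abs_nonneg (M 0 0)]
    have hd : |M 1 1| = 1 := by
      have := hprod M hM hMΓ
      rwa [ha, one_mul] at this
    obtain ⟨hb, hc⟩ := h M hM hMΓ
    have hcase : M.val.trace ≠ 0 ∨ M.val.det ≠ -1 := by
      by_contra! hcon
      exact hΓ.trace_ne_zero hcon.2 hMΓ hcon.1
    rw [det_eq, Matrix.trace_fin_two, hb] at hcase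
    have hI : M.val = 1 ∨ M.val = -1 := by
      rw [Matrix.eta_fin_two M.val, hb, hc]
      rcases (abs_eq zero_le_one).1 ha with h1 | h1 <;>
        rcases (abs_eq zero_le_one).1 hd with h2 | h2 <;> rw [h1, h2] at hcase ⊢
      · left; rw [Matrix.one_fin_two]
      · simp at hcase
      · simp at hcase
      · right; rw [Matrix.one_fin_two]; simp
    rcases hI with h1 | h1
    · rw [show M = 1 from Units.ext h1, map_one]
    · rw [show M = -1 from Units.ext h1, mobius_neg, map_one]
  · intro M hM hMΓ hle i j
    obtain ⟨hb, hc⟩ := h M hM hMΓ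
    have hpos : 0 < |M 0 0| := abs_pos.2 (hne M hM hMΓ)
    rw [abs_le] at hle
    have h1 : |M 0 0| ≤ Real.exp 1 := (Real.log_le_iff_le_exp hpos).1 hle.2
    have h2 : Real.exp (-1) ≤ |M 0 0| := (Real.le_log_iff_exp_le hpos).1 hle.1
    have h3 : |M 1 1| ≤ Real.exp 1 := by
      have hp := hprod M hM hMΓ
      have e : Real.exp 1 * Real.exp (-1) = 1 := by rw [← Real.exp_add]; simp
      have := Real.exp_pos 1
      have := abs_nonneg (M 1 1)
      have : Real.exp (-1) * |M 1 1| ≤ 1 := by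
        exact (mul_le_mul_of_nonneg_right h2 (abs_nonneg _)).trans hp.le
      calc |M 1 1| = Real.exp 1 * (Real.exp (-1) * |M 1 1|) := by rw [← mul_assoc, e, one_mul]
        _ ≤ Real.exp 1 * 1 := mul_le_mul_of_nonneg_left this (Real.exp_pos 1).le
        _ = Real.exp 1 := mul_one _
    have h4 := (Real.exp_pos 1).le
    fin_cases i <;> fin_cases j <;> simp [hb, hc, h1, h3, h4]

/-- A discrete group of translations fixing the point at infinity is cyclic. -/
theorem IsSurfaceGroup.cyclic_of_unipotent (hΓ : IsSurfaceGroup Γ)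
    (h : ∀ M : GL (Fin 2) ℝ, |M.val.det| = 1 → mobius M ∈ Γ →
      M 1 0 = 0 ∧ |M 0 0| = 1 ∧ M 1 1 = M 0 0) :
    ∃ g₀ ∈ Γ, ∀ g ∈ Γ, ∃ n : ℤ, g = g₀ ^ n := by
  have hsq : ∀ M : GL (Fin 2) ℝ, |M.val.det| = 1 → mobius M ∈ Γ → M 0 0 ^ 2 = 1 := by
    intro M hM hMΓ
    rw [← sq_abs, (h M hM hMΓ).2.1, one_pow]
  refine hΓ.cyclic_of_hom (fun M => M 0 1 * M 0 0) 1 ?_ ?_ ?_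
  · intro M N hM hN hMΓ hNΓ
    obtain ⟨c1, -, d1⟩ := h M hM hMΓ
    obtain ⟨c2, -, d2⟩ := h N hN hNΓ
    have s1 := hsq M hM hMΓ
    have s2 := hsq N hN hNΓ
    rw [Units.val_mul, Matrix.mul_apply, Matrix.mul_apply, Fin.sum_univ_two, Fin.sum_univ_two,
      c2, d2]
    linear_combination (M 0 1 * M 0 0) * s2 + (N 0 1 * N 0 0) * s1
  · intro M hM hMΓ h0
    obtain ⟨hc, ha, hd⟩ := h M hM hMΓ
    have hb : M 0 1 = 0 := by
      rcases mul_eq_zero.1 h0 with h' | h'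
      · exact h'
      · rw [h'] at ha; simp at ha
    have hI : M.val = 1 ∨ M.val = -1 := by
      rw [Matrix.eta_fin_two M.val, hb, hc, hd]
      rcases (abs_eq zero_le_one).1 ha with h1 | h1 <;> rw [h1]
      · left; rw [Matrix.one_fin_two]
      · right; rw [Matrix.one_fin_two]; simp
    rcases hI with h1 | h1
    · rw [show M = 1 from Units.ext h1, map_one]
    · rw [show M = -1 from Units.ext h1, mobius_neg, map_one]
  · intro M hM hMΓ hle i j
    obtain ⟨hc, ha, hd⟩ := h M hM hMΓ
    rw [abs_mul, ha, mul_one] at hle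
    fin_cases i <;> fin_cases j <;> simp [hc, hd, ha, hle]

/-- A parabolic matrix is conjugate to an upper unitriangular one. -/
theorem exists_conj_eq_parabolic (M : GL (Fin 2) ℝ) (hdet : M.val.det = 1)
    (htr : M.val.trace = 2) (hne : M ≠ 1) :
    ∃ (Q : GL (Fin 2) ℝ) (p : ℝ), p ≠ 0 ∧ (Q⁻¹ * M * Q).val = !![1, p; 0, 1] := by
  rw [det_eq] at hdet
  rw [Matrix.trace_fin_two] at htr
  have hd : M 1 1 = 2 - M 0 0 := by linarith
  rw [hd] at hdet
  by_cases hc : M 1 0 = 0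
  · have ha : M 0 0 = 1 := by
      have : (M 0 0 - 1) ^ 2 = 0 := by rw [hc] at hdet; linarith
      have := pow_eq_zero_iff (two_ne_zero) |>.1 this
      linarith
    have hM : M.val = !![1, M 0 1; 0, 1] := by
      conv_lhs => rw [Matrix.eta_fin_two M.val, hc, hd, ha]
      norm_num
    refine ⟨1, M 0 1, fun h => hne (Units.ext ?_), by simpa using hM⟩
    rw [hM, h, Units.val_one, Matrix.one_fin_two]
  · refine ⟨glMk (M 0 0 - 1) 1 (M 1 0) 0 (by simpa using hc), 1, one_ne_zero, ?_⟩
    have : (glMk (M 0 0 - 1) 1 (M 1 0) 0 (by simpa using hc))⁻¹ * M *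
        (glMk (M 0 0 - 1) 1 (M 1 0) 0 (by simpa using hc)) = glMk 1 1 0 1 (by simp) := by
      rw [mul_assoc, inv_mul_eq_iff_eq_mul]
      apply Units.ext
      rw [Units.val_mul, Units.val_mul, glMk_val, glMk_val]
      ext i j
      fin_cases i <;> fin_cases j <;>
        simp [Matrix.mul_apply, Fin.sum_univ_two, hd] <;> linarith
    rw [this]; rfl

/-- A noncyclic surface group contains a hyperbolic element and an orientation preserving element
that preserves neither end of its axis. -/
theorem IsSurfaceGroup.exists_hyperbolic_pair (hΓ : IsSurfaceGroup Γ)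
    (hnc : ¬ ∃ g₀ ∈ Γ, ∀ g ∈ Γ, ∃ n : ℤ, g = g₀ ^ n) :
    ∃ (Q : GL (Fin 2) ℝ) (t : ℝ), 0 < t ∧ mobius (hyp t) ∈ conjGroup Γ Q ∧
      ∃ B : GL (Fin 2) ℝ, B.val.det = 1 ∧ mobius B ∈ conjGroup Γ Q ∧ B 0 1 * B 1 0 ≠ 0 := by
  have htrsq : ∀ M : GL (Fin 2) ℝ, (M * M).val.trace = M.val.trace ^ 2 - 2 * M.val.det := by
    intro M
    rw [det_eq, Units.val_mul, Matrix.trace_fin_two, Matrix.trace_fin_two, Matrix.mul_apply,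
      Matrix.mul_apply, Fin.sum_univ_two, Fin.sum_univ_two]
    ring
  by_cases hhyp : ∃ V : GL (Fin 2) ℝ, V.val.det = 1 ∧ mobius V ∈ Γ ∧ 2 < |V.val.trace|
  · obtain ⟨V, hV, hVΓ, htr⟩ : ∃ V : GL (Fin 2) ℝ, V.val.det = 1 ∧ mobius V ∈ Γ ∧
        2 < V.val.trace := by
      obtain ⟨V, hV, hVΓ, htr⟩ := hhyp
      rcases lt_abs.1 htr with h | h
      · exact ⟨V, hV, hVΓ, h⟩
      · exact ⟨-V, by simpa [Matrix.det_neg] using hV, by rwa [mobius_neg], by simpa using h⟩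
    obtain ⟨Q, t, ht0, -, hQ⟩ := exists_conj_eq_hyp V hV htr
    have hmem : mobius (hyp t) ∈ conjGroup Γ Q := by
      rw [← hQ]; exact mobius_conj_mem_conjGroup.2 hVΓ
    refine ⟨Q, t, ht0, hmem, ?_⟩
    by_contra! hcon
    refine hnc (cyclic_of_conjGroup (Q := Q) ((hΓ.conj Q).cyclic_of_diag fun M hM hMΓ => ?_))
    rcases (abs_eq zero_le_one).1 hM with h1 | h1
    · exact (hΓ.conj Q).offDiag_eq_zero ht0 hmem hM hMΓ (hcon M h1 hMΓ)
    · -- the square preserves orientation, and the trace of `M` is not zero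
      have hsqΓ : mobius (M * M) ∈ conjGroup Γ Q := by
        rw [map_mul]; exact Subgroup.mul_mem _ hMΓ hMΓ
      have hsq : (M * M).val.det = 1 := by rw [Units.val_mul, Matrix.det_mul, h1]; norm_num
      obtain ⟨hb, hc⟩ := (hΓ.conj Q).offDiag_eq_zero ht0 hmem (by rw [hsq, abs_one]) hsqΓ
        (hcon _ hsq hsqΓ)
      have htr0 := (hΓ.conj Q).trace_ne_zero h1 hMΓ
      rw [Matrix.trace_fin_two] at htr0
      rw [Units.val_mul, Matrix.mul_apply, Fin.sum_univ_two] at hb hc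
      constructor
      · exact (mul_eq_zero.1 (show M 0 1 * (M 0 0 + M 1 1) = 0 by linarith)).resolve_right htr0
      · exact (mul_eq_zero.1 (show M 1 0 * (M 0 0 + M 1 1) = 0 by linarith)).resolve_right htr0
  · exfalso
    -- without hyperbolic elements the group would consist of parabolics with a common fixed point
    push Not at hhyp
    have htr2 : ∀ M : GL (Fin 2) ℝ, M.val.det = 1 → mobius M ∈ Γ → |M.val.trace| = 2 :=
      fun M hM hMΓ => le_antisymm (hhyp M hM hMΓ) (hΓ.two_le_abs_trace hM hMΓ)
    have hdet : ∀ M : GL (Fin 2) ℝ, |M.val.det| = 1 → mobius M ∈ Γ → M.val.det = 1 := by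
      intro M hM hMΓ
      rcases (abs_eq zero_le_one).1 hM with h1 | h1
      · exact h1
      · exfalso
        have h2 := htr2 (M * M) (by rw [Units.val_mul, Matrix.det_mul, h1]; norm_num)
          (by rw [map_mul]; exact Γ.mul_mem hMΓ hMΓ)
        have h3 : 0 < M.val.trace ^ 2 := by
          have := hΓ.trace_ne_zero h1 hMΓ
          positivity
        rw [htrsq, h1, abs_of_pos (by linarith)] at h2
        linarith
    by_cases htriv : ∀ M : GL (Fin 2) ℝ, M.val.det = 1 → mobius M ∈ Γ → M.val.trace = 2 → M = 1
    · refine hnc ⟨1, Γ.one_mem, fun g hg => ⟨0, ?_⟩⟩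
      obtain ⟨M, hM, rfl⟩ := exists_mobius_eq g
      have hd := hdet M hM hg
      rcases (abs_eq zero_le_two).1 (htr2 M hd hg) with h | h
      · rw [htriv M hd hg h]; simp
      · have := htriv (-M) (by simpa [Matrix.det_neg] using hd) (by rwa [mobius_neg]) (by simp [h])
        rw [← mobius_neg, this]; simp
    · push Not at htriv
      obtain ⟨U, hU, hUΓ, hUtr, hU1⟩ := htriv
      obtain ⟨Q, p, hp, hQ⟩ := exists_conj_eq_parabolic U hU hUtr hU1
      refine hnc (cyclic_of_conjGroup (Q := Q) ((hΓ.conj Q).cyclic_of_unipotent fun M hM hMΓ => ?_))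
      have hMdet : M.val.det = 1 := by
        rw [← det_conj_inv]; exact hdet _ (by rw [det_conj_inv, hM]) (mobius_conj_inv_mem hMΓ)
      have htr' : ∀ N : GL (Fin 2) ℝ, N.val.det = 1 → mobius N ∈ conjGroup Γ Q →
          |N.val.trace| = 2 := by
        intro N hN hNΓ
        rw [← trace_conj_inv]; exact htr2 _ (by rw [det_conj_inv, hN]) (mobius_conj_inv_mem hNΓ)
      obtain ⟨P, hP⟩ : ∃ P, P = Q⁻¹ * U * Q := ⟨_, rfl⟩
      rw [← hP] at hQ
      have hPΓ : mobius P ∈ conjGroup Γ Q := by rw [hP]; exact mobius_conj_mem_conjGroup.2 hUΓ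
      have hPdet : P.val.det = 1 := by rw [hP, det_conj, hU]
      -- the traces of `P ^ n * M` are affine in `n` and bounded
      have hc : M 1 0 = 0 := by
        have h0 := htr' M hMdet hMΓ
        have h1 := htr' (P * M) (by rw [Units.val_mul, Matrix.det_mul, hPdet, hMdet, one_mul])
          (by rw [map_mul]; exact Subgroup.mul_mem _ hPΓ hMΓ)
        have h2 := htr' (P * (P * M))
          (by rw [Units.val_mul, Units.val_mul, Matrix.det_mul, Matrix.det_mul, hPdet, hMdet]
              norm_num)
          (by rw [map_mul, map_mul]
              exact Subgroup.mul_mem _ hPΓ (Subgroup.mul_mem _ hPΓ hMΓ))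
        rw [Units.val_mul, Units.val_mul, hQ] at h2
        rw [Units.val_mul, hQ] at h1
        simp [Matrix.trace_fin_two, Matrix.vecMul, dotProduct, Fin.sum_univ_two] at h0 h1 h2
        have hpc : p * M 1 0 = 0 := by
          rcases (abs_eq zero_le_two).1 h0 with h0 | h0 <;>
            rcases (abs_eq zero_le_two).1 h1 with h1 | h1 <;>
            rcases (abs_eq zero_le_two).1 h2 with h2 | h2 <;> linarith
        exact (mul_eq_zero.1 hpc).resolve_left hp
      have h0 := htr' M hMdet hMΓ
      rw [det_eq, hc, mul_zero, sub_zero] at hMdet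
      rw [Matrix.trace_fin_two] at h0
      have hs : (M 0 0 + M 1 1) ^ 2 = 4 := by rw [← sq_abs, h0]; norm_num
      have hda : M 1 1 = M 0 0 := by
        have : (M 1 1 - M 0 0) ^ 2 = 0 := by linarith
        have := pow_eq_zero_iff (two_ne_zero) |>.1 this
        linarith
      refine ⟨hc, ?_, hda⟩
      rw [hda, ← two_mul, abs_mul, abs_two] at h0
      linarith

end

noncomputable section

/-! ### Pairs of hyperbolic elements with the traces of a three-holed sphere -/

variable {Γ : Subgroup (ℍ ≃ᵢ ℍ)}

theorem exists_lt_exp_nat_mul {t : ℝ} (ht : 0 < t) (K : ℝ) :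
    ∃ k : ℕ, 0 < k ∧ K < Real.exp (k * t) := by
  obtain ⟨k, hk⟩ := exists_nat_gt (K / t)
  refine ⟨k + 1, k.succ_pos, ?_⟩
  rw [div_lt_iff₀ ht] at hk
  have := Real.add_one_le_exp (((k + 1 : ℕ) : ℝ) * t)
  push_cast at this ⊢
  linarith

theorem conj_hyp_val (B : GL (Fin 2) ℝ) (hB : B.val.det = 1) (s : ℝ) :
    (B * hyp s * B⁻¹).val =
      !![B 0 0 * B 1 1 * Real.exp s - B 0 1 * B 1 0 * Real.exp (-s),
        B 0 0 * B 0 1 * (Real.exp (-s) - Real.exp s);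
        B 1 0 * B 1 1 * (Real.exp s - Real.exp (-s)),
        B 0 0 * B 1 1 * Real.exp (-s) - B 0 1 * B 1 0 * Real.exp s] := by
  rw [Units.val_mul, Units.val_mul, inv_val_of_det_one hB, hyp_val]
  ext i j
  fin_cases i <;> fin_cases j <;> simp [Matrix.mul_apply, Fin.sum_univ_two] <;> ring

theorem two_lt_trace_hyp {s : ℝ} (hs : s ≠ 0) : 2 < (hyp s).val.trace := by
  have := Real.one_lt_cosh.2 hs
  rw [Real.cosh_eq] at this
  rw [hyp_val]
  simp [Matrix.trace_fin_two]
  linarith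

/-- The trace of `(hyp (k * t))⁻¹ * Y` is dominated, for large `k`, by the lower right entry of
`Y`. -/
theorem exists_separated_pair_of_neg {t : ℝ} (ht : 0 < t)
    {Y : GL (Fin 2) ℝ} (hY : Y 1 1 < 0) :
    ∃ k : ℕ, 0 < k ∧ ((hyp (k * t))⁻¹ * Y).val.trace < -2 := by
  obtain ⟨k, hk0, hk⟩ := exists_lt_exp_nat_mul ht ((|Y 0 0| + 2) / (-Y 1 1))
  refine ⟨k, hk0, ?_⟩
  rw [div_lt_iff₀ (by linarith)] at hk
  have h1 : Real.exp (-(k * t)) * Y 0 0 ≤ |Y 0 0| := by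
    have : Real.exp (-(k * t)) ≤ 1 := Real.exp_le_one_iff.2 (by have := ht.le; simp; positivity)
    calc _ ≤ Real.exp (-(k * t)) * |Y 0 0| :=
          mul_le_mul_of_nonneg_left (le_abs_self _) (Real.exp_pos _).le
      _ ≤ 1 * |Y 0 0| := mul_le_mul_of_nonneg_right this (abs_nonneg _)
      _ = _ := one_mul _
  rw [hyp_inv, Units.val_mul, hyp_val, Matrix.trace_fin_two, Matrix.mul_apply, Matrix.mul_apply]
  simp [Fin.sum_univ_two]
  linarith

/-- From a hyperbolic element and an element moving both ends of its axis one obtains two elements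
with the traces of standard generators of a three-holed sphere: `X` is a power of the hyperbolic
element and `Y` a conjugate of such a power. -/
theorem IsSurfaceGroup.exists_separated_pair_of_hyp (hΓ : IsSurfaceGroup Γ) {t : ℝ} (ht : 0 < t)
    (htΓ : mobius (hyp t) ∈ Γ) {B : GL (Fin 2) ℝ} (hB : B.val.det = 1) (hBΓ : mobius B ∈ Γ)
    (hbc : B 0 1 * B 1 0 ≠ 0) :
    ∃ X Y : GL (Fin 2) ℝ, X.val.det = 1 ∧ Y.val.det = 1 ∧ mobius X ∈ Γ ∧ mobius Y ∈ Γ ∧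
      2 < X.val.trace ∧ 2 < Y.val.trace ∧ (X⁻¹ * Y).val.trace < -2 := by
  have hpow : ∀ n : ℤ, mobius (hyp (n * t)) ∈ Γ := fun n => by
    rw [← hyp_zpow, map_zpow]; exact Γ.zpow_mem htΓ n
  have hconj : ∀ (C : GL (Fin 2) ℝ) (n : ℤ), mobius C ∈ Γ →
      mobius (C * hyp (n * t) * C⁻¹) ∈ Γ := fun C n hC => by
    rw [map_mul, map_mul, map_inv]
    exact Γ.mul_mem (Γ.mul_mem hC (hpow n)) (Γ.inv_mem hC)
  have hconjdet : ∀ (C : GL (Fin 2) ℝ) (s : ℝ), (C * hyp s * C⁻¹).val.det = 1 := fun C s => by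
    rw [det_conj_inv, hyp_det]
  -- it suffices to find a conjugate of a power of `hyp t` with negative lower right entry
  have key : ∀ (C : GL (Fin 2) ℝ) (n : ℤ), C.val.det = 1 → mobius C ∈ Γ → n ≠ 0 →
      C 0 0 * C 1 1 * Real.exp (-(n * t)) - C 0 1 * C 1 0 * Real.exp (n * t) < 0 →
      ∃ X Y : GL (Fin 2) ℝ, X.val.det = 1 ∧ Y.val.det = 1 ∧ mobius X ∈ Γ ∧ mobius Y ∈ Γ ∧
        2 < X.val.trace ∧ 2 < Y.val.trace ∧ (X⁻¹ * Y).val.trace < -2 := by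
    intro C n hC hCΓ hn h
    obtain ⟨k, hk0, hk⟩ := exists_separated_pair_of_neg ht
      (Y := C * hyp (n * t) * C⁻¹) (by rw [conj_hyp_val C hC]; simpa using h)
    refine ⟨hyp (k * t), C * hyp (n * t) * C⁻¹, hyp_det _, hconjdet _ _, ?_, hconj C n hCΓ,
      two_lt_trace_hyp (by positivity), ?_, hk⟩
    · simpa using hpow k
    · rw [trace_conj_inv]
      exact two_lt_trace_hyp (mul_ne_zero (by exact_mod_cast hn) ht.ne')
  have hpos : ∀ C : GL (Fin 2) ℝ, C.val.det = 1 → mobius C ∈ Γ → 0 < C 0 1 * C 1 0 →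
      ∃ X Y : GL (Fin 2) ℝ, X.val.det = 1 ∧ Y.val.det = 1 ∧ mobius X ∈ Γ ∧ mobius Y ∈ Γ ∧
        2 < X.val.trace ∧ 2 < Y.val.trace ∧ (X⁻¹ * Y).val.trace < -2 := by
    intro C hC hCΓ h
    obtain ⟨k, hk0, hk⟩ := exists_lt_exp_nat_mul ht (C 0 0 * C 1 1 / (C 0 1 * C 1 0))
    rw [div_lt_iff₀ h] at hk
    refine key C k hC hCΓ (by exact_mod_cast hk0.ne') ?_
    rw [det_eq] at hC
    have h1 : Real.exp (-(k * t)) ≤ 1 := Real.exp_le_one_iff.2 (by have := ht.le; simp; positivity)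
    have h2 : C 0 0 * C 1 1 * Real.exp (-(k * t)) ≤ C 0 0 * C 1 1 * 1 :=
      mul_le_mul_of_nonneg_left h1 (by linarith)
    push_cast
    linarith
  have hsq : ∀ s : ℝ, (B * hyp s * B⁻¹) 0 1 * (B * hyp s * B⁻¹) 1 0 =
      -(B 0 0 * B 1 1) * (B 0 1 * B 1 0) * (Real.exp s - Real.exp (-s)) ^ 2 := by
    intro s
    rw [conj_hyp_val B hB]
    simp
    ring
  have hd := hB
  rw [det_eq] at hd
  have hsinh : 0 < (Real.exp t - Real.exp (-t)) ^ 2 := by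
    have : Real.exp (-t) < Real.exp t := Real.exp_lt_exp.2 (by linarith)
    have : 0 < Real.exp t - Real.exp (-t) := by linarith
    positivity
  rcases lt_or_gt_of_ne hbc with hneg | h
  swap
  · exact hpos B hB hBΓ h
  rcases lt_trichotomy (B 0 0 * B 1 1) 0 with h | h | h
  · obtain ⟨k, hk0, hk⟩ := exists_lt_exp_nat_mul ht (B 0 1 * B 1 0 / (B 0 0 * B 1 1))
    rw [div_lt_iff_of_neg h] at hk
    refine key B (-k) hB hBΓ (by simpa using hk0.ne') ?_
    have h1 : Real.exp (-(k * t)) ≤ 1 := Real.exp_le_one_iff.2 (by have := ht.le; simp; positivity)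
    have h2 : -(B 0 1 * B 1 0) * Real.exp (-(k * t)) ≤ -(B 0 1 * B 1 0) * 1 :=
      mul_le_mul_of_nonneg_left h1 (by linarith)
    push_cast
    rw [show -(-(k : ℝ) * t) = k * t by ring, show -(k : ℝ) * t = -(k * t) by ring]
    linarith
  · -- here `B` would interchange the two ends of the axis of `hyp t`
    exfalso
    have h0 := hconj B 1 hBΓ
    rw [Int.cast_one, one_mul] at h0
    obtain ⟨h1, h2⟩ := hΓ.offDiag_eq_zero ht htΓ (by rw [hconjdet, abs_one]) h0
      (by rw [hsq, h]; ring)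
    rw [conj_hyp_val B hB] at h1 h2
    have hs : Real.exp t - Real.exp (-t) ≠ 0 := fun h => by rw [h] at hsinh; simp at hsinh
    have hs' : Real.exp (-t) - Real.exp t ≠ 0 := fun h => hs (by linarith)
    have hb : B 0 1 ≠ 0 := left_ne_zero_of_mul hbc
    have hc : B 1 0 ≠ 0 := right_ne_zero_of_mul hbc
    have ha : B 0 0 = 0 := by simpa [hs', hb] using h1
    have hd : B 1 1 = 0 := by simpa [hs, hc] using h2
    have := hΓ.two_le_abs_trace hB hBΓ
    rw [Matrix.trace_fin_two, ha, hd] at this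
    norm_num at this
  · refine hpos (B * hyp t * B⁻¹) (hconjdet _ _) ?_ ?_
    · have := hconj B 1 hBΓ
      rwa [Int.cast_one, one_mul] at this
    · rw [hsq]
      have := mul_pos h (neg_pos.2 hneg)
      have := mul_pos this hsinh
      linarith

theorem IsSurfaceGroup.exists_separated_pair (hΓ : IsSurfaceGroup Γ)
    (hnc : ¬ ∃ g₀ ∈ Γ, ∀ g ∈ Γ, ∃ n : ℤ, g = g₀ ^ n) :
    ∃ X Y : GL (Fin 2) ℝ, X.val.det = 1 ∧ Y.val.det = 1 ∧ mobius X ∈ Γ ∧ mobius Y ∈ Γ ∧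
      2 < X.val.trace ∧ 2 < Y.val.trace ∧ (X⁻¹ * Y).val.trace < -2 := by
  obtain ⟨Q, t, ht, htΓ, B, hB, hBΓ, hbc⟩ := hΓ.exists_hyperbolic_pair hnc
  obtain ⟨X, Y, hX, hY, hXΓ, hYΓ, h1, h2, h3⟩ :=
    (hΓ.conj Q).exists_separated_pair_of_hyp ht htΓ hB hBΓ hbc
  refine ⟨Q * X * Q⁻¹, Q * Y * Q⁻¹, by rwa [det_conj_inv], by rwa [det_conj_inv],
    mobius_conj_inv_mem hXΓ, mobius_conj_inv_mem hYΓ,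
    by rwa [trace_conj_inv], by rwa [trace_conj_inv], ?_⟩
  rw [show (Q * X * Q⁻¹)⁻¹ * (Q * Y * Q⁻¹) = Q * (X⁻¹ * Y) * Q⁻¹ by group, trace_conj_inv]
  exact h3

end

noncomputable section

/-! ### Reflections and triangles -/

/-- The imaginary axis, upwards at unit speed. -/
def axis (t : ℝ) : ℍ := UpperHalfPlane.mk ⟨0, Real.exp t⟩ (Real.exp_pos t)

theorem isometry_axis : Isometry axis := UpperHalfPlane.isometry_vertical_line 0

@[simp] theorem axis_re (t : ℝ) : (axis t).re = 0 := rfl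

@[simp] theorem axis_im (t : ℝ) : (axis t).im = Real.exp t := rfl

theorem range_axis : Set.range axis = {z : ℍ | z.re = 0} := by
  ext z
  constructor
  · rintro ⟨t, rfl⟩; rfl
  · intro hz
    exact ⟨Real.log z.im, UpperHalfPlane.ext_re_im hz.symm (by simp [Real.exp_log z.im_pos])⟩

/-- The reflection in the imaginary axis. -/
def axisReflection : GL (Fin 2) ℝ := glMk 1 0 0 (-1) (by norm_num)

theorem axisReflection_smul_eq_iff (z : ℍ) : axisReflection • z = z ↔ z.re = 0 := by
  have h1 := re_smul_formula axisReflection z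
  have h2 := im_smul_formula axisReflection z
  simp [axisReflection] at h1 h2
  constructor
  · intro h
    have : z.re = -z.re := by rw [← h1]; exact congrArg UpperHalfPlane.re h.symm
    linarith
  · intro h
    exact UpperHalfPlane.ext_re_im (by simp [axisReflection, h1, h]) (by simp [axisReflection, h2])

theorem exists_conj_eq_axisReflection {R : GL (Fin 2) ℝ} (hdet : R.val.det = -1)
    (htr : R.val.trace = 0) : ∃ Q : GL (Fin 2) ℝ, Q⁻¹ * R * Q = axisReflection :=
  exists_conj_eq_diag R (p := 1) (q := -1) (by norm_num) (by norm_num) (by rw [htr]; norm_num)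
    (by rw [hdet]; norm_num)

theorem smul_eq_iff_of_conj {Q R S : GL (Fin 2) ℝ} (h : Q⁻¹ * R * Q = S) (z : ℍ) :
    R • z = z ↔ S • (Q⁻¹ • z) = Q⁻¹ • z := by
  rw [← h, smul_smul, mul_inv_cancel_right, mul_smul]
  exact ⟨fun h => by rw [h], fun h => smul_left_cancel _ h⟩

/-- The fixed points of a reflection whose line lies on one side of the imaginary axis, the side
being read off from the sign of the lower left entry. -/
theorem re_mul_neg_of_fixed {R : GL (Fin 2) ℝ} (hdet : R.val.det = -1) (htr : R.val.trace = 0)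
    (hp : R 0 0 < -1) {z : ℍ} (hz : R • z = z) : z.re * R 1 0 < 0 := by
  have hi := im_smul_formula R z
  have hpos := smul_denom_pos R z
  rw [hz, hdet, abs_neg, abs_one, one_mul, eq_div_iff hpos.ne'] at hi
  rw [Matrix.trace_fin_two] at htr
  have hs : R 1 1 = -R 0 0 := by linarith
  rw [det_eq, hs] at hdet
  rw [hs] at hi
  have hD : (R 1 0 * z.re + -R 0 0) ^ 2 + (R 1 0 * z.im) ^ 2 = 1 :=
    mul_left_cancel₀ z.im_pos.ne' (by rw [hi, mul_one])
  -- with `p` and `r` the entries of the first column, `hD` gives `2 p r x ≥ p ^ 2 - 1`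
  have h1 : 0 < 2 * (R 0 0) * (z.re * R 1 0) := by
    nlinarith [sq_nonneg (R 1 0 * z.re), sq_nonneg (R 1 0 * z.im)]
  by_contra! hcon
  have := mul_nonneg (show 0 ≤ -R 0 0 by linarith) hcon
  linarith

theorem axisReflection_mul_trace {S : GL (Fin 2) ℝ} (htr : S.val.trace = 0) :
    (axisReflection * S).val.trace = 2 * S 0 0 := by
  rw [Matrix.trace_fin_two] at htr
  rw [Units.val_mul, Matrix.trace_fin_two, Matrix.mul_apply, Matrix.mul_apply]
  simp [axisReflection, Fin.sum_univ_two]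
  linarith

/-- Two lines on either side of the imaginary axis have reflections for which the trace of the
product is larger than two, if the matrices are normalized to have negative upper left entries. -/
theorem lowerLeft_mul_pos {S T : GL (Fin 2) ℝ} (hS : S.val.det = -1) (hS0 : S.val.trace = 0)
    (hT : T.val.det = -1) (hT0 : T.val.trace = 0) (hSp : S 0 0 < -1) (hTp : T 0 0 < -1)
    (hST : S = T ∨ (S * T).val.trace < -2) : 0 < S 1 0 * T 1 0 := by
  rw [Matrix.trace_fin_two] at hS0 hT0
  rw [det_eq, show S 1 1 = -S 0 0 by linarith] at hS
  rw [det_eq, show T 1 1 = -T 0 0 by linarith] at hT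
  have hS1 : S 0 1 * S 1 0 < 0 := by nlinarith
  have hT1 : T 0 1 * T 1 0 < 0 := by nlinarith
  have hSr : S 1 0 ≠ 0 := right_ne_zero_of_mul hS1.ne
  have hTr : T 1 0 ≠ 0 := right_ne_zero_of_mul hT1.ne
  rcases hST with rfl | h
  · exact mul_self_pos.2 hSr
  · rw [Units.val_mul, Matrix.trace_fin_two, Matrix.mul_apply, Matrix.mul_apply, Fin.sum_univ_two,
      Fin.sum_univ_two, show S 1 1 = -S 0 0 by linarith, show T 1 1 = -T 0 0 by linarith] at h
    by_contra! hcon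
    have hneg : S 1 0 * T 1 0 < 0 := lt_of_le_of_ne hcon (mul_ne_zero hSr hTr)
    have h1 : 0 ≤ S 0 1 * T 1 0 := by
      have h2 := mul_pos_of_neg_of_neg hS1 hneg
      have : S 0 1 * S 1 0 * (S 1 0 * T 1 0) = S 1 0 ^ 2 * (S 0 1 * T 1 0) := by ring
      rw [this] at h2
      exact (pos_of_mul_pos_right h2 (sq_nonneg _)).le
    have h3 : 0 ≤ S 1 0 * T 0 1 := by
      have h2 := mul_pos_of_neg_of_neg hT1 hneg
      have : T 0 1 * T 1 0 * (S 1 0 * T 1 0) = T 1 0 ^ 2 * (S 1 0 * T 0 1) := by ring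
      rw [this] at h2
      exact (pos_of_mul_pos_right h2 (sq_nonneg _)).le
    nlinarith

theorem joinedIn_of_re_mul_pos {z w : ℍ} (h : 0 < z.re * w.re) :
    JoinedIn {z : ℍ | z.re = 0}ᶜ z w := by
  refine JoinedIn.ofLine (f := seg z w) (seg z w).continuous.continuousOn (seg_zero z w)
    (seg_one z w) ?_
  rintro _ ⟨s, ⟨h0, h1⟩, rfl⟩
  have hre : (seg z w s).re = (1 - s) * z.re + s * w.re := by
    have := congrArg Complex.re (seg_coe z w h0 h1)
    simpa using this
  simp only [Set.mem_compl_iff, Set.mem_ofPred_eq, hre]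
  rcases pos_and_pos_or_neg_and_neg_of_mul_pos h with ⟨hz, hw⟩ | ⟨hz, hw⟩
  · rcases h0.eq_or_lt with rfl | h0
    · simpa using hz.ne'
    · have := mul_nonneg (sub_nonneg.2 h1) hz.le
      have := mul_pos h0 hw
      linarith
  · rcases h0.eq_or_lt with rfl | h0
    · simpa using hz.ne
    · have := mul_nonneg (sub_nonneg.2 h1) (neg_nonneg.2 hz.le)
      have := mul_pos h0 (neg_pos.2 hw)
      linarith

/-- If the products of any two of three matrices of reflections have traces below `-2`, then the
mirrors are the edges of a triangle with ultra-ideal vertices. The absolute values of the traces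
make the mirrors disjoint, and their signs make none of them separate the other two. -/
theorem isIdealTriangle_of_trace_lt (R : Fin 3 → GL (Fin 2) ℝ) (hdet : ∀ i, (R i).val.det = -1)
    (htr : ∀ i, (R i).val.trace = 0) (hneg : ∀ i j, i ≠ j → (R i * R j).val.trace < -2) :
    IsIdealTriangle fun i => {z : ℍ | mobius (R i) z = z} := by
  have hconj : ∀ i, ∃ Q : GL (Fin 2) ℝ, Q⁻¹ * R i * Q = axisReflection := fun i =>
    exists_conj_eq_axisReflection (hdet i) (htr i)
  choose Q hQ using hconj
  have hfix : ∀ i (z : ℍ), mobius (R i) z = z ↔ ((Q i)⁻¹ • z).re = 0 := fun i z => by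
    rw [mobius_apply, smul_eq_iff_of_conj (hQ i), axisReflection_smul_eq_iff]
  have hcoord : ∀ i j, i ≠ j → ((Q i)⁻¹ * R j * Q i).val 0 0 < -1 := fun i j hij => by
    have h1 := hneg i j hij
    rw [← trace_conj (Q i), show (Q i)⁻¹ * (R i * R j) * Q i =
      ((Q i)⁻¹ * R i * Q i) * ((Q i)⁻¹ * R j * Q i) by group, hQ,
      axisReflection_mul_trace (by rw [trace_conj, htr])] at h1
    linarith
  have hfix' : ∀ i j (z : ℍ), mobius (R j) z = z →
      ((Q i)⁻¹ * R j * Q i) • ((Q i)⁻¹ • z) = (Q i)⁻¹ • z := fun i j z hz =>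
    (smul_eq_iff_of_conj rfl z).1 hz
  have hside : ∀ i j, i ≠ j → ∀ z : ℍ, mobius (R j) z = z →
      ((Q i)⁻¹ • z).re * ((Q i)⁻¹ * R j * Q i).val 1 0 < 0 := fun i j hij z hz =>
    re_mul_neg_of_fixed (by rw [det_conj, hdet]) (by rw [trace_conj, htr]) (hcoord i j hij)
      (hfix' i j z hz)
  refine ⟨fun i => ⟨fun t => Q i • axis t, (isometry_smul ℍ (Q i)).comp isometry_axis, ?_⟩, ?_, ?_⟩
  · ext z
    rw [Set.mem_ofPred_eq, hfix]
    constructor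
    · rintro ⟨t, rfl⟩
      rw [inv_smul_smul, axis_re]
    · intro h
      obtain ⟨t, ht⟩ : (Q i)⁻¹ • z ∈ Set.range axis := by rw [range_axis]; exact h
      exact ⟨t, by simp only [ht, smul_inv_smul]⟩
  · intro i j hij
    rw [Set.disjoint_left]
    intro z hi hj
    have h1 := hside i j hij z hj
    rw [(hfix i z).1 hi, zero_mul] at h1
    exact lt_irrefl _ h1
  · intro i j k hj hk p hp q hq
    have h1 := hside i j hj.symm p hp
    have h2 := hside i k hk.symm q hq
    have h3 : 0 < ((Q i)⁻¹ * R j * Q i).val 1 0 * ((Q i)⁻¹ * R k * Q i).val 1 0 := by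
      refine lowerLeft_mul_pos (by rw [det_conj, hdet]) (by rw [trace_conj, htr])
        (by rw [det_conj, hdet]) (by rw [trace_conj, htr]) (hcoord i j hj.symm)
        (hcoord i k hk.symm) ?_
      rcases eq_or_ne j k with rfl | hjk
      · exact Or.inl rfl
      · right
        rw [show (Q i)⁻¹ * R j * Q i * ((Q i)⁻¹ * R k * Q i) = (Q i)⁻¹ * (R j * R k) * Q i by group,
          trace_conj]
        exact hneg j k hjk
    have h4 : 0 < ((Q i)⁻¹ • p).re * ((Q i)⁻¹ • q).re := by
      have h5 := mul_pos_of_neg_of_neg h1 h2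
      rw [mul_mul_mul_comm] at h5
      exact pos_of_mul_pos_left h5 h3.le
    have h5 := (joinedIn_of_re_mul_pos h4).map (isometry_smul ℍ (Q i)).continuous
    simp only [smul_inv_smul] at h5
    refine h5.mono ?_
    rintro _ ⟨z, hz, rfl⟩ hcon
    exact hz (by simpa using (hfix i _).1 hcon)

end

noncomputable section

/-! ### Generators of a three-holed sphere from trace inequalities -/

/-- The trace identity of Fricke for the commutator. -/
theorem ctr_eq {X Y : GL (Fin 2) ℝ} (hX : X.val.det = 1) (hY : Y.val.det = 1) :
    ctr X Y = X.val.trace ^ 2 + Y.val.trace ^ 2 + (X * Y).val.trace ^ 2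
      - X.val.trace * Y.val.trace * (X * Y).val.trace - 2 := by
  have hX' := hX
  have hY' := hY
  rw [det_eq] at hX' hY'
  rw [ctr, Units.val_mul, Units.val_mul, Units.val_mul, inv_val_of_det_one hX,
    inv_val_of_det_one hY]
  generalize X.val = M at *
  generalize Y.val = N at *
  rw [Matrix.eta_fin_two M, Matrix.eta_fin_two N]
  generalize M 0 0 = a at *
  generalize M 0 1 = b at *
  generalize M 1 0 = c at *
  generalize M 1 1 = d at *
  generalize N 0 0 = e at *
  generalize N 0 1 = f at *
  generalize N 1 0 = g at *
  generalize N 1 1 = h at *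
  simp [Matrix.trace_fin_two]
  linear_combination ((e + h) ^ 2 - 2 * (e * h - f * g)) * hX' + ((a + d) ^ 2 - 2) * hY'

theorem trace_inv_mul {X Y : GL (Fin 2) ℝ} (hX : X.val.det = 1) :
    (X⁻¹ * Y).val.trace = X.val.trace * Y.val.trace - (X * Y).val.trace := by
  rw [Units.val_mul, Units.val_mul, inv_val_of_det_one hX]
  simp [Matrix.trace_fin_two, Matrix.mul_apply, Matrix.vecMul, dotProduct, Fin.sum_univ_two]
  ring

/-- If the trace of the commutator of `X` and `Y` exceeds two, then `X = R * (R * X)` and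
`Y = R * (R * Y)` are products of reflections, `R` being the normalized Lie bracket of `X` and `Y`.
-/
theorem exists_reflection_factor {X Y : GL (Fin 2) ℝ} (hX : X.val.det = 1) (hY : Y.val.det = 1)
    (hκ : 2 < ctr X Y) :
    ∃ R : GL (Fin 2) ℝ, R.val.det = -1 ∧ R.val.trace = 0 ∧
      (R * X).val.trace = 0 ∧ (R * Y).val.trace = 0 := by
  set s := √(ctr X Y - 2) with hs
  have hs0 : s ≠ 0 := (Real.sqrt_pos.2 (by linarith)).ne'
  have hs2 : s ^ 2 = ctr X Y - 2 := Real.sq_sqrt (by linarith)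
  rw [ctr_eq hX hY] at hs2
  rw [det_eq] at hX hY
  simp only [Units.val_mul, Matrix.trace_fin_two, Matrix.mul_apply, Fin.sum_univ_two] at hs2
  set u := X 0 1 * Y 1 0 - Y 0 1 * X 1 0 with hu
  set v := X 0 0 * Y 0 1 + X 0 1 * Y 1 1 - Y 0 0 * X 0 1 - Y 0 1 * X 1 1 with hv
  set w := X 1 0 * Y 0 0 + X 1 1 * Y 1 0 - Y 1 0 * X 0 0 - Y 1 1 * X 1 0 with hw
  have hW : u * u + v * w = s ^ 2 := by
    rw [hs2, hu, hv, hw]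
    linear_combination (-4 * (Y 0 0 * Y 1 1 - Y 0 1 * Y 1 0) + (Y 0 0 + Y 1 1) ^ 2) * hX +
      ((X 0 0 + X 1 1) ^ 2 - 4) * hY
  -- `u`, `v`, `w`, `-u` are the entries of the bracket, whose determinant is `2 - ctr X Y`
  have hdet : u / s * (-u / s) - v / s * (w / s) = -1 := by
    field_simp
    linarith
  refine ⟨glMk (u / s) (v / s) (w / s) (-u / s) (by rw [hdet]; norm_num), ?_, ?_, ?_, ?_⟩
  · rw [glMk_det, hdet]
  · simp [Matrix.trace_fin_two, neg_div]
  · rw [Units.val_mul, glMk_val, Matrix.trace_fin_two, Matrix.mul_apply, Matrix.mul_apply]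
    simp [Fin.sum_univ_two]
    field_simp
    rw [hu, hv, hw]; ring
  · rw [Units.val_mul, glMk_val, Matrix.trace_fin_two, Matrix.mul_apply, Matrix.mul_apply]
    simp [Fin.sum_univ_two]
    field_simp
    rw [hu, hv, hw]; ring

theorem mul_self_eq_one_of_reflection {R : GL (Fin 2) ℝ} (hdet : R.val.det = -1)
    (htr : R.val.trace = 0) : R * R = 1 := by
  rw [Matrix.trace_fin_two] at htr
  rw [det_eq, show R 1 1 = -R 0 0 by linarith] at hdet
  apply Units.ext
  ext i j
  fin_cases i <;> fin_cases j <;>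
    simp [Matrix.mul_apply, Fin.sum_univ_two, show R 1 1 = -R 0 0 by linarith] <;> linarith

theorem two_lt_ctr {X Y : GL (Fin 2) ℝ} (hX : X.val.det = 1) (hY : Y.val.det = 1)
    (hX2 : 2 < X.val.trace) (hY2 : 2 < Y.val.trace) (hXY : (X⁻¹ * Y).val.trace < -2) :
    2 < ctr X Y := by
  rw [trace_inv_mul hX] at hXY
  rw [ctr_eq hX hY]
  have h1 := mul_pos (sub_pos.2 hX2) (sub_pos.2 hY2)
  set x := X.val.trace
  set y := Y.val.trace
  set z := (X * Y).val.trace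
  have h2 : 0 ≤ x * y * -(x * y - z) :=
    mul_nonneg (mul_nonneg (by linarith) (by linarith)) (by linarith)
  nlinarith

theorem isThreeHoledSpherePair_mobius {X Y : GL (Fin 2) ℝ} (hX : X.val.det = 1)
    (hY : Y.val.det = 1) (hX2 : 2 < X.val.trace) (hY2 : 2 < Y.val.trace)
    (hXY : (X⁻¹ * Y).val.trace < -2) : IsThreeHoledSpherePair (mobius X) (mobius Y) := by
  obtain ⟨R, hR, hR0, hRX, hRY⟩ :=
    exists_reflection_factor hX hY (two_lt_ctr hX hY hX2 hY2 hXY)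
  have hRXdet : (R * X).val.det = -1 := by rw [Units.val_mul, Matrix.det_mul, hR, hX, mul_one]
  have hRYdet : (R * Y).val.det = -1 := by rw [Units.val_mul, Matrix.det_mul, hR, hY, mul_one]
  have hRXR : R * X * R = X⁻¹ := by
    rw [eq_inv_iff_mul_eq_one, mul_assoc, mul_self_eq_one_of_reflection hRXdet hRX]
  have htr : ∀ M N : GL (Fin 2) ℝ, (M * N).val.trace = (N * M).val.trace := fun M N => by
    rw [Units.val_mul, Units.val_mul, Matrix.trace_mul_comm]
  have hRR := mul_self_eq_one_of_reflection hR hR0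
  have hRRM : ∀ M : GL (Fin 2) ℝ, R * (R * M) = M := fun M => by rw [← mul_assoc, hRR, one_mul]
  have h01 : R * X * (R * Y) = X⁻¹ * Y := by rw [← mul_assoc, hRXR]
  -- the sign of the third matrix is chosen so as to make all three traces negative
  have hT := isIdealTriangle_of_trace_lt ![R * X, R * Y, -R]
    (by
      intro i
      fin_cases i
      · exact hRXdet
      · exact hRYdet
      · simp [hR, Matrix.det_neg])
    (by
      intro i
      fin_cases i
      · exact hRX
      · exact hRY
      · simp [hR0])
    (by
      have e1 : (R * X * -R).val.trace < -2 := by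
        rw [htr, neg_mul, hRRM, Units.val_neg, Matrix.trace_neg]; linarith
      have e2 : (R * Y * -R).val.trace < -2 := by
        rw [htr, neg_mul, hRRM, Units.val_neg, Matrix.trace_neg]; linarith
      have e3 : (R * X * (R * Y)).val.trace < -2 := by rwa [h01]
      intro i j hij
      fin_cases i <;> fin_cases j
      · exact absurd rfl hij
      · exact e3
      · exact e1
      · exact (htr _ _).trans_lt e3
      · exact absurd rfl hij
      · exact e2
      · exact (htr _ _).trans_lt e1
      · exact (htr _ _).trans_lt e2
      · exact absurd rfl hij)
  refine ⟨_, fun i => mobius (![R * X, R * Y, -R] i), hT, fun i => rfl, ?_, ?_⟩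
  · change mobius X = mobius (-R) * mobius (R * X)
    rw [mobius_neg, ← map_mul, hRRM]
  · change mobius Y = mobius (-R) * mobius (R * Y)
    rw [mobius_neg, ← map_mul, hRRM]

end

noncomputable section

/-! ### Orthogonal projections to the imaginary axis -/

/-- The coordinate on the imaginary axis of the orthogonal projection of `z`: the geodesic through
`z` orthogonal to the imaginary axis is the half circle of radius `|z|` centred at `0`. -/
def height (z : ℍ) : ℝ := Real.log (z.re ^ 2 + z.im ^ 2) / 2

theorem exp_height_sq (z : ℍ) : Real.exp (height z) ^ 2 = z.re ^ 2 + z.im ^ 2 := by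
  have := z.im_pos
  rw [← Real.exp_nat_mul, height, Nat.cast_ofNat, mul_div_cancel₀ _ two_ne_zero,
    Real.exp_log (by positivity)]

theorem cosh_dist_axis (z : ℍ) (t : ℝ) :
    Real.cosh (dist z (axis t)) =
      Real.exp (height z) / z.im + (Real.exp (height z) - Real.exp t) ^ 2 /
        (2 * z.im * Real.exp t) := by
  have h := exp_height_sq z
  have := z.im_pos
  have := Real.exp_pos t
  rw [cosh_dist_formula, axis_re, axis_im]
  field_simp
  linear_combination -h

theorem cosh_dist_axis_height (z : ℍ) :
    Real.cosh (dist z (axis (height z))) = Real.exp (height z) / z.im := by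
  rw [cosh_dist_axis]; simp

theorem dist_axis_height_le (z : ℍ) (t : ℝ) : dist z (axis (height z)) ≤ dist z (axis t) := by
  have := z.im_pos
  have := Real.exp_pos t
  rw [← abs_of_nonneg (dist_nonneg (x := z) (y := axis (height z))),
    ← abs_of_nonneg (dist_nonneg (x := z) (y := axis t)), ← Real.cosh_le_cosh,
    cosh_dist_axis_height, cosh_dist_axis z t]
  have : 0 ≤ (Real.exp (height z) - Real.exp t) ^ 2 / (2 * z.im * Real.exp t) := by positivity
  linarith

theorem infDist_range_axis (z : ℍ) :
    Metric.infDist z (Set.range axis) = dist z (axis (height z)) := by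
  refine le_antisymm (Metric.infDist_le_dist_of_mem ⟨_, rfl⟩) ?_
  refine (Metric.le_infDist (Set.range_nonempty _)).2 ?_
  rintro _ ⟨t, rfl⟩
  exact dist_axis_height_le z t

theorem dist_axis_eq_infDist_iff (z : ℍ) (t : ℝ) :
    dist z (axis t) = Metric.infDist z (Set.range axis) ↔ height z = t := by
  rw [infDist_range_axis]
  constructor
  · intro h
    have h1 := cosh_dist_axis z t
    have := z.im_pos
    have := Real.exp_pos t
    rw [h, cosh_dist_axis_height] at h1
    have h2 : (Real.exp (height z) - Real.exp t) ^ 2 / (2 * z.im * Real.exp t) = 0 := by linarith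
    rw [div_eq_zero_iff, or_iff_left (by positivity), sq_eq_zero_iff, sub_eq_zero] at h2
    exact Real.exp_injective h2
  · rintro rfl; rfl

theorem orthProj_range_axis (m : Set ℍ) : orthProj m (Set.range axis) = axis '' (height '' m) := by
  ext w
  constructor
  · rintro ⟨⟨t, rfl⟩, z, hz, h⟩
    exact ⟨t, ⟨z, hz, (dist_axis_eq_infDist_iff z t).1 h⟩, rfl⟩
  · rintro ⟨_, ⟨z, hz, rfl⟩, rfl⟩
    exact ⟨⟨_, rfl⟩, z, hz, (dist_axis_eq_infDist_iff z _).2 rfl⟩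

theorem orthProjLength_range_axis (m : Set ℍ) :
    orthProjLength m (Set.range axis) = MeasureTheory.volume (height '' m) := by
  rw [orthProjLength, orthProj_range_axis, isometry_axis.hausdorffMeasure_image
    (Or.inl zero_le_one), MeasureTheory.hausdorffMeasure_real]

theorem orthProj_image (g : ℍ ≃ᵢ ℍ) (m l : Set ℍ) :
    orthProj (g '' m) (g '' l) = g '' orthProj m l := by
  ext w
  constructor
  · rintro ⟨⟨w, hw, rfl⟩, _, ⟨z, hz, rfl⟩, h⟩
    rw [g.isometry.dist_eq, Metric.infDist_image g.isometry] at h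
    exact ⟨w, ⟨hw, z, hz, h⟩, rfl⟩
  · rintro ⟨w, ⟨hw, z, hz, h⟩, rfl⟩
    refine ⟨⟨w, hw, rfl⟩, g z, ⟨z, hz, rfl⟩, ?_⟩
    rwa [g.isometry.dist_eq, Metric.infDist_image g.isometry]

theorem orthProjLength_image (g : ℍ ≃ᵢ ℍ) (m l : Set ℍ) :
    orthProjLength (g '' m) (g '' l) = orthProjLength m l := by
  rw [orthProjLength, orthProjLength, orthProj_image, g.hausdorffMeasure_image]

theorem re_smul_axis (M : GL (Fin 2) ℝ) (t : ℝ) :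
    (M • axis t).re = (M 0 0 * M 1 0 * Real.exp t ^ 2 + M 0 1 * M 1 1) /
      (M 1 0 ^ 2 * Real.exp t ^ 2 + M 1 1 ^ 2) := by
  rw [re_smul_formula, axis_re, axis_im]
  congr 1 <;> ring

theorem normSq_smul_axis {M : GL (Fin 2) ℝ} (hM : M.val.det = 1) (t : ℝ) :
    (M • axis t).re ^ 2 + (M • axis t).im ^ 2 =
      (M 0 0 ^ 2 * Real.exp t ^ 2 + M 0 1 ^ 2) / (M 1 0 ^ 2 * Real.exp t ^ 2 + M 1 1 ^ 2) := by
  have hpos := smul_denom_pos M (axis t)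
  rw [axis_re, axis_im] at hpos
  have hpos' : M 1 0 ^ 2 * Real.exp t ^ 2 + M 1 1 ^ 2 ≠ 0 := by
    have : M 1 0 ^ 2 * Real.exp t ^ 2 + M 1 1 ^ 2 =
      (M 1 0 * 0 + M 1 1) ^ 2 + (M 1 0 * Real.exp t) ^ 2 := by ring
    rw [this]; exact hpos.ne'
  have him : (M • axis t).im = Real.exp t / (M 1 0 ^ 2 * Real.exp t ^ 2 + M 1 1 ^ 2) := by
    rw [im_smul_formula, axis_re, axis_im, hM, abs_one, one_mul]
    congr 1; ring
  rw [re_smul_axis, him, div_pow, div_pow, ← add_div, div_eq_div_iff (pow_ne_zero 2 hpos') hpos']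
  rw [det_eq] at hM
  linear_combination (-(Real.exp t ^ 2 * (M 1 0 ^ 2 * Real.exp t ^ 2 + M 1 1 ^ 2)) *
    (M 0 0 * M 1 1 - M 0 1 * M 1 0 + 1)) * hM

/-- The projection of the line `M • axis` to the imaginary axis lies between the projections of the
ends `b / d` and `a / c` of that line; the bound on `b * c` tells which of the two is lower. -/
theorem height_image_smul_axis {M : GL (Fin 2) ℝ} (hM : M.val.det = 1)
    (hbc : M 0 1 * M 1 0 ≠ 0) (hbc' : -(1 / 2) < M 0 1 * M 1 0) :
    height '' Set.range (fun t => M • axis t) =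
      Set.Ioo (Real.log (M 0 1 ^ 2 / M 1 1 ^ 2) / 2) (Real.log (M 0 0 ^ 2 / M 1 0 ^ 2) / 2) := by
  have hdet := hM
  rw [det_eq] at hdet
  have hb := left_ne_zero_of_mul hbc
  have hc := right_ne_zero_of_mul hbc
  have had : 1 / 2 < M 0 0 * M 1 1 := by linarith
  have ha : M 0 0 ≠ 0 := left_ne_zero_of_mul (by linarith : M 0 0 * M 1 1 ≠ 0)
  have hd : M 1 1 ≠ 0 := right_ne_zero_of_mul (by linarith : M 0 0 * M 1 1 ≠ 0)
  have hsq : (M 0 1 * M 1 0) ^ 2 < (M 0 0 * M 1 1) ^ 2 := by nlinarith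
  have hb2 : 0 < M 0 1 ^ 2 := by positivity
  have hc2 : 0 < M 1 0 ^ 2 := by positivity
  have ha2 : 0 < M 0 0 ^ 2 := by positivity
  have hd2 : 0 < M 1 1 ^ 2 := by positivity
  ext v
  have hv := Real.exp_pos (2 * v)
  have hlow : Real.log (M 0 1 ^ 2 / M 1 1 ^ 2) / 2 < v ↔
      M 0 1 ^ 2 < Real.exp (2 * v) * M 1 1 ^ 2 := by
    rw [div_lt_iff₀ two_pos, mul_comm v, Real.log_lt_iff_lt_exp (by positivity), div_lt_iff₀ hd2]
  have hup : v < Real.log (M 0 0 ^ 2 / M 1 0 ^ 2) / 2 ↔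
      Real.exp (2 * v) * M 1 0 ^ 2 < M 0 0 ^ 2 := by
    rw [lt_div_iff₀ two_pos, mul_comm v, Real.lt_log_iff_exp_lt (by positivity), lt_div_iff₀ hc2]
  rw [Set.mem_Ioo, hlow, hup]
  have hheight : ∀ t, height (M • axis t) = v ↔
      M 0 0 ^ 2 * Real.exp t ^ 2 + M 0 1 ^ 2 =
        Real.exp (2 * v) * (M 1 0 ^ 2 * Real.exp t ^ 2 + M 1 1 ^ 2) := by
    intro t
    have := Real.exp_pos t
    rw [height, normSq_smul_axis hM, div_eq_iff two_ne_zero, mul_comm v]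
    rw [← div_eq_iff (show M 1 0 ^ 2 * Real.exp t ^ 2 + M 1 1 ^ 2 ≠ 0 by positivity)]
    exact ⟨fun h => by rw [← h, Real.exp_log (by positivity)], fun h => by rw [h, Real.log_exp]⟩
  constructor
  · rintro ⟨_, ⟨t, rfl⟩, h⟩
    have h := (hheight t).1 h
    have hu : 0 < Real.exp t ^ 2 := by positivity
    constructor
    · by_contra! hcon
      have h1 : Real.exp (2 * v) * M 1 0 ^ 2 < M 0 0 ^ 2 := by
        have : Real.exp (2 * v) * M 1 0 ^ 2 * M 1 1 ^ 2 < M 0 0 ^ 2 * M 1 1 ^ 2 := by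
          calc _ = Real.exp (2 * v) * M 1 1 ^ 2 * M 1 0 ^ 2 := by ring
            _ ≤ M 0 1 ^ 2 * M 1 0 ^ 2 := mul_le_mul_of_nonneg_right hcon hc2.le
            _ < _ := by rw [← mul_pow, ← mul_pow]; exact hsq
        exact lt_of_mul_lt_mul_right this hd2.le
      have := mul_pos (sub_pos.2 h1) hu
      linarith
    · by_contra! hcon
      have h1 : M 0 1 ^ 2 < Real.exp (2 * v) * M 1 1 ^ 2 := by
        have : M 0 1 ^ 2 * M 1 0 ^ 2 < Real.exp (2 * v) * M 1 1 ^ 2 * M 1 0 ^ 2 := by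
          calc _ < M 0 0 ^ 2 * M 1 1 ^ 2 := by rw [← mul_pow, ← mul_pow]; exact hsq
            _ ≤ Real.exp (2 * v) * M 1 0 ^ 2 * M 1 1 ^ 2 := mul_le_mul_of_nonneg_right hcon hd2.le
            _ = _ := by ring
        exact lt_of_mul_lt_mul_right this hc2.le
      have := mul_nonneg (sub_nonneg.2 hcon) hu.le
      linarith
  · rintro ⟨h1, h2⟩
    set u := (Real.exp (2 * v) * M 1 1 ^ 2 - M 0 1 ^ 2) /
      (M 0 0 ^ 2 - Real.exp (2 * v) * M 1 0 ^ 2) with hu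
    have hu0 : 0 < u := div_pos (by linarith) (by linarith)
    refine ⟨_, ⟨Real.log u / 2, rfl⟩, (hheight _).2 ?_⟩
    rw [← Real.exp_nat_mul, Nat.cast_ofNat, mul_div_cancel₀ _ two_ne_zero, Real.exp_log hu0]
    rw [eq_div_iff (by linarith)] at hu
    linarith

theorem orthProjLength_smul_axis {M : GL (Fin 2) ℝ} (hM : M.val.det = 1)
    (hbc : M 0 1 * M 1 0 ≠ 0) (hbc' : -(1 / 2) < M 0 1 * M 1 0) :
    orthProjLength (Set.range fun t => M • axis t) (Set.range axis) =
      ENNReal.ofReal (Real.log (1 + 1 / (M 0 1 * M 1 0))) := by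
  rw [orthProjLength_range_axis, height_image_smul_axis hM hbc hbc', Real.volume_Ioo]
  rw [det_eq] at hM
  have hb := left_ne_zero_of_mul hbc
  have hc := right_ne_zero_of_mul hbc
  have ha : M 0 0 ≠ 0 := left_ne_zero_of_mul (by linarith : M 0 0 * M 1 1 ≠ 0)
  have hd : M 1 1 ≠ 0 := right_ne_zero_of_mul (by linarith : M 0 0 * M 1 1 ≠ 0)
  congr 1
  have : 1 + 1 / (M 0 1 * M 1 0) = (M 0 0 * M 1 1) / (M 0 1 * M 1 0) := by
    field_simp; linarith
  rw [this, Real.log_div (by positivity) (by positivity), Real.log_div (by positivity)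
    (by positivity), Real.log_div (by positivity) (by positivity), Real.log_mul ha hd,
    Real.log_mul hb hc, Real.log_pow, Real.log_pow, Real.log_pow, Real.log_pow]
  push_cast
  ring

theorem disjoint_smul_axis {M : GL (Fin 2) ℝ} (hM : M.val.det = 1) (hbc : 0 < M 0 1 * M 1 0) :
    Disjoint (Set.range axis) (Set.range fun t => M • axis t) := by
  rw [Set.disjoint_right, range_axis]
  rintro _ ⟨t, rfl⟩ h
  have hdet := hM
  rw [det_eq] at hdet
  have h : (M • axis t).re = 0 := h
  have hd : M 1 1 ≠ 0 := right_ne_zero_of_mul (by linarith : M 0 0 * M 1 1 ≠ 0)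
  have hden : 0 < M 1 0 ^ 2 * Real.exp t ^ 2 + M 1 1 ^ 2 := by positivity
  rw [re_smul_axis, div_eq_zero_iff, or_iff_left hden.ne'] at h
  have h1 : 0 < M 0 0 * M 1 1 * (M 0 1 * M 1 0) := mul_pos (by linarith) hbc
  have hu : 0 < Real.exp t ^ 2 := by positivity
  -- multiply the equation by `a c`
  have h2 : (M 0 0 * M 1 0) ^ 2 * Real.exp t ^ 2 + M 0 0 * M 1 1 * (M 0 1 * M 1 0) = 0 := by
    linear_combination (M 0 0 * M 1 0) * h
  have : 0 ≤ (M 0 0 * M 1 0) ^ 2 * Real.exp t ^ 2 := by positivity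
  linarith

theorem crossing_smul_axis {M : GL (Fin 2) ℝ} (hM : M.val.det = 1) (hbc : M 0 1 * M 1 0 < 0)
    (hbc' : -(1 / 2) < M 0 1 * M 1 0) :
    Set.range axis ≠ Set.range (fun t => M • axis t) ∧
      (Set.range axis ∩ Set.range fun t => M • axis t).Nonempty := by
  have hdet := hM
  rw [det_eq] at hdet
  have had : 0 < M 0 0 * M 1 1 := by linarith
  have ha : M 0 0 ≠ 0 := left_ne_zero_of_mul had.ne'
  have hd : M 1 1 ≠ 0 := right_ne_zero_of_mul had.ne'
  have hc : M 1 0 ≠ 0 := right_ne_zero_of_mul hbc.ne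
  have hac : M 0 0 * M 1 0 ≠ 0 := mul_ne_zero ha hc
  have hre : ∀ t, (M • axis t).re = 0 ↔ M 0 0 * M 1 0 * Real.exp t ^ 2 + M 0 1 * M 1 1 = 0 := by
    intro t
    have hden : 0 < M 1 0 ^ 2 * Real.exp t ^ 2 + M 1 1 ^ 2 := by positivity
    rw [re_smul_axis, div_eq_zero_iff, or_iff_left hden.ne']
  constructor
  · intro h
    have h1 : ∀ t, (M • axis t).re = 0 := fun t => by
      have : M • axis t ∈ Set.range axis := by rw [h]; exact ⟨t, rfl⟩
      rwa [range_axis] at this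
    have h2 := (hre 0).1 (h1 0)
    have h3 := (hre (Real.log 2)).1 (h1 _)
    rw [Real.exp_zero] at h2
    rw [Real.exp_log two_pos] at h3
    exact hac (by linarith)
  · set u := -(M 0 1 * M 1 1) / (M 0 0 * M 1 0) with hu
    have hu0 : 0 < u := by
      have : u = (-(M 0 1 * M 1 0) * (M 0 0 * M 1 1)) / (M 0 0 * M 1 0) ^ 2 := by
        rw [hu]; field_simp
      rw [this]
      have := neg_pos.2 hbc
      positivity
    refine ⟨M • axis (Real.log u / 2), ?_, ⟨_, rfl⟩⟩
    rw [range_axis]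
    refine (hre _).2 ?_
    rw [← Real.exp_nat_mul, Nat.cast_ofNat, mul_div_cancel₀ _ two_ne_zero, Real.exp_log hu0, hu]
    field_simp
    ring

end

noncomputable section

/-! ### Periods of geodesics in the quotient -/

variable {Γ : Subgroup (ℍ ≃ᵢ ℍ)}

theorem hyp_smul_axis (t s : ℝ) : hyp t • axis s = axis (s + 2 * t) := by
  have h : Real.exp t * Real.exp (-t) = 1 := by rw [← Real.exp_add]; simp
  refine UpperHalfPlane.ext_re_im ?_ ?_
  · rw [re_smul_axis, hyp_val]; simp
  · rw [im_smul_formula, hyp_det, hyp_val]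
    simp only [axis_re, axis_im]
    simp
    rw [div_eq_iff (by positivity), Real.exp_add, two_mul, Real.exp_add]
    linear_combination -(Real.exp s * (Real.exp t * Real.exp (-t) + 1)) * h

/-- A matrix translating two points of the imaginary axis by the same amount is diagonal. -/
theorem diag_of_smul_axis {M : GL (Fin 2) ℝ} (hM : |M.val.det| = 1) {s₁ s₂ T : ℝ} (hne : s₁ ≠ s₂)
    (h₁ : M • axis s₁ = axis (s₁ + T)) (h₂ : M • axis s₂ = axis (s₂ + T)) :
    M 0 1 = 0 ∧ M 1 0 = 0 ∧ M 1 1 ^ 2 = Real.exp (-T) := by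
  have key : ∀ s, M • axis s = axis (s + T) →
      M 1 0 ^ 2 * Real.exp s ^ 2 + M 1 1 ^ 2 = Real.exp (-T) := by
    intro s h
    have h1 := im_smul_formula M (axis s)
    have hpos := smul_denom_pos M (axis s)
    rw [axis_re, axis_im] at hpos
    rw [h, hM, axis_re, axis_im, axis_im, eq_div_iff hpos.ne', one_mul, Real.exp_add, mul_assoc]
      at h1
    have h2 := mul_left_cancel₀ (Real.exp_pos s).ne' (h1.trans (mul_one _).symm)
    have h3 : Real.exp T * Real.exp (-T) = 1 := by rw [← Real.exp_add]; simp
    refine mul_left_cancel₀ (Real.exp_pos T).ne' ?_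
    linear_combination h2 - h3
  have e1 := key s₁ h₁
  have e2 := key s₂ h₂
  have hc : M 1 0 = 0 := by
    have h3 : M 1 0 ^ 2 * (Real.exp s₁ ^ 2 - Real.exp s₂ ^ 2) = 0 := by linear_combination e1 - e2
    rcases mul_eq_zero.1 h3 with h | h
    · exact pow_eq_zero_iff (two_ne_zero) |>.1 h
    · exfalso
      rw [sub_eq_zero, ← Real.exp_nat_mul, ← Real.exp_nat_mul, Real.exp_eq_exp] at h
      exact hne (mul_left_cancel₀ (by norm_num) h)
  rw [hc] at e1
  have hd : M 1 1 ^ 2 = Real.exp (-T) := by linarith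
  refine ⟨?_, hc, hd⟩
  have h3 := re_smul_axis M s₁
  have hd0 : M 1 1 ^ 2 ≠ 0 := by rw [hd]; exact (Real.exp_pos _).ne'
  rw [h₁, axis_re, hc, eq_div_iff (by simpa using hd0)] at h3
  have h4 : M 0 1 * M 1 1 = 0 := by linarith
  exact (mul_eq_zero.1 h4).resolve_right fun h => hd0 (by rw [h]; ring)

/-- A period of the image of a geodesic in the surface is realized along it by a single element of
the group. -/
theorem IsSurfaceGroup.exists_translation (hΓ : IsSurfaceGroup Γ) {c : ℝ → ℍ} (hc : Continuous c)
    {T : ℝ} (hT : Function.Periodic (fun s => HypSurface.mk Γ (c s)) T) :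
    ∃ g ∈ Γ, ∃ s₁ s₂ : ℝ, s₁ ≠ s₂ ∧ g (c s₁) = c (s₁ + T) ∧ g (c s₂) = c (s₂ + T) := by
  have hg : ∀ s : ℝ, ∃ g ∈ Γ, g (c s) = c (s + T) := fun s =>
    HypSurface.mk_eq_mk_iff.1 (hT s).symm
  choose g hgΓ hg using hg
  set K := c '' Set.Icc 0 1 ∪ (fun s => c (s + T)) '' Set.Icc 0 1 with hK
  have hKc : IsCompact K := (isCompact_Icc.image hc).union (isCompact_Icc.image (by fun_prop))
  have hfin := hΓ.properlyDiscontinuous K hKc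
  have hmem : ∀ s : Set.Icc (0 : ℝ) 1, g s ∈ {g : ℍ ≃ᵢ ℍ | g ∈ Γ ∧ (g '' K ∩ K).Nonempty} :=
    fun s => ⟨hgΓ s, c (s + T), ⟨c s, Or.inl ⟨s, s.2, rfl⟩, hg s⟩, Or.inr ⟨s, s.2, rfl⟩⟩
  have := hfin.to_subtype
  have : Infinite (Set.Icc (0 : ℝ) 1) := (Set.Icc_infinite zero_lt_one).to_subtype
  obtain ⟨s₁, s₂, hne, h⟩ := Finite.exists_ne_map_eq_of_infinite
    (fun s : Set.Icc (0 : ℝ) 1 => (⟨g s, hmem s⟩ :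
      {g : ℍ ≃ᵢ ℍ | g ∈ Γ ∧ (g '' K ∩ K).Nonempty}))
  have h : g s₁ = g s₂ := congrArg Subtype.val h
  exact ⟨g s₁, hgΓ _, s₁, s₂, fun h => hne (Subtype.ext h), hg _, by rw [h]; exact hg _⟩

/-- The translation length of `A = Q * hyp t * Q⁻¹` is the least period of its axis in the surface,
if `V` moves both ends of the axis but little. Otherwise there would be a period of at most half the
translation length, and an element of the group realizing it would have a commutator with `V` of
trace close to, but different from, two. -/
theorem IsSurfaceGroup.length_le_of_periodic (hΓ : IsSurfaceGroup Γ) {V Q : GL (Fin 2) ℝ} {t ε : ℝ}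
    (hV : V.val.det = 1) (htΓ : mobius (Q * hyp t * Q⁻¹) ∈ Γ)
    (hgap : ∀ M : GL (Fin 2) ℝ, |M.val.det| = 1 → mobius M ∈ Γ → |ctr M V - 2| < ε → ctr M V = 2)
    (hr : (Q⁻¹ * V * Q) 0 1 * (Q⁻¹ * V * Q) 1 0 ≠ 0)
    (hε : |(Q⁻¹ * V * Q) 0 1 * (Q⁻¹ * V * Q) 1 0| * (4 * Real.exp t) < ε)
    {T : ℝ} (hT0 : 0 < T) (hT : Function.Periodic (fun s => HypSurface.mk Γ (Q • axis s)) T) :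
    2 * t ≤ T := by
  have hc : Continuous fun s => Q • axis s :=
    ((isometry_smul ℍ Q).comp isometry_axis).continuous
  -- there is no period in the first half
  have key : ∀ T : ℝ, 0 < T → T ≤ t →
      ¬ Function.Periodic (fun s => HypSurface.mk Γ (Q • axis s)) T := by
    intro T hT0 hTt hT
    obtain ⟨g, hg, s₁, s₂, hne, h₁, h₂⟩ := hΓ.exists_translation hc hT
    obtain ⟨M, hM, rfl⟩ := exists_mobius_eq g
    have hconj : ∀ s, mobius M (Q • axis s) = Q • axis (s + T) →
        (Q⁻¹ * M * Q) • axis s = axis (s + T) := by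
      intro s h
      rw [mul_assoc, mul_smul, mul_smul, inv_smul_eq_iff]; exact h
    have hM' : |(Q⁻¹ * M * Q).val.det| = 1 := by rw [det_conj, hM]
    obtain ⟨hb, hc, hd⟩ := diag_of_smul_axis hM' hne (hconj _ h₁) (hconj _ h₂)
    have hctr : ctr M V = ctr (Q⁻¹ * M * Q) (Q⁻¹ * V * Q) := (ctr_conj Q M V).symm
    obtain ⟨N, hN⟩ : ∃ N, N = Q⁻¹ * M * Q := ⟨_, rfl⟩
    rw [← hN] at hM' hb hc hd hctr
    rw [det_eq, hb, zero_mul, sub_zero] at hM'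
    have hpq : N 0 0 * N 1 1 - 0 * 0 ≠ 0 := fun h => by
      rw [show N 0 0 * N 1 1 = 0 by linarith] at hM'; simp at hM'
    have hNval : N = glMk (N 0 0) 0 0 (N 1 1) hpq := by
      apply Units.ext
      rw [glMk_val, Matrix.eta_fin_two N.val, hb, hc]; rfl
    rw [hNval, ctr_diag hpq (by rw [det_conj, hV])] at hctr
    set r := (Q⁻¹ * V * Q) 0 1 * (Q⁻¹ * V * Q) 1 0
    have hE : Real.exp T * Real.exp (-T) = 1 := by rw [← Real.exp_add]; simp
    have ha : N 0 0 ^ 2 = Real.exp T := by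
      have h1 : N 0 0 ^ 2 * N 1 1 ^ 2 = 1 := by rw [← mul_pow, ← sq_abs, hM', one_pow]
      rw [hd] at h1
      have := (Real.exp_pos (-T)).ne'
      exact mul_right_cancel₀ this (h1.trans hE.symm)
    have hlt : Real.exp (-T) < Real.exp T := Real.exp_lt_exp.2 (by linarith)
    have hne' : (N 0 0 - N 1 1) ^ 2 ≠ 0 := by
      intro h
      have h2 := pow_eq_zero_iff (two_ne_zero) |>.1 h
      rw [sub_eq_zero] at h2
      rw [h2, hd] at ha
      exact hlt.ne ha
    have hdiff : ctr M V - 2 = -(r * (N 0 0 - N 1 1) ^ 2 / (N 0 0 * N 1 1)) := by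
      rw [hctr]; ring
    have habs : |ctr M V - 2| = |r| * (N 0 0 - N 1 1) ^ 2 := by
      rw [hdiff, abs_neg, abs_div, hM', div_one, abs_mul, abs_of_nonneg (sq_nonneg (N 0 0 - N 1 1))]
    have hle : (N 0 0 - N 1 1) ^ 2 ≤ 4 * Real.exp t := by
      have h1 : (N 0 0 - N 1 1) ^ 2 ≤ 2 * (N 0 0 ^ 2 + N 1 1 ^ 2) := by
        linarith [sq_nonneg (N 0 0 + N 1 1)]
      have h2 : Real.exp T ≤ Real.exp t := Real.exp_le_exp.2 hTt
      rw [ha, hd] at h1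
      linarith
    have h2 := hgap M hM hg (by
      rw [habs]; exact (mul_le_mul_of_nonneg_left hle (abs_nonneg _)).trans_lt hε)
    rw [h2, sub_self, abs_zero] at habs
    exact mul_ne_zero (abs_ne_zero.2 hr) hne' habs.symm
  have hper : Function.Periodic (fun s => HypSurface.mk Γ (Q • axis s)) (2 * t) := by
    intro s
    refine (HypSurface.mk_eq_mk_iff.2 ⟨_, htΓ, ?_⟩).symm
    rw [mobius_apply, mul_smul, mul_smul, inv_smul_smul, hyp_smul_axis]
  by_contra! hlt
  rcases le_total T t with h | h
  · exact key T hT0 h hT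
  · exact key (2 * t - T) (by linarith) (by linarith) (hper.sub_period hT)

end

noncomputable section

/-! ### Closed geodesics with long projections -/

variable {Γ P : Subgroup (ℍ ≃ᵢ ℍ)}

/-- The closed geodesic covered by the axis of a hyperbolic isometry, in the quotient by a group for
which the translation length of that isometry is the least period. -/
def closedGeodesicOfAxis (Γ : Subgroup (ℍ ≃ᵢ ℍ)) (Q : GL (Fin 2) ℝ) {t : ℝ} (ht : 0 < t)
    (htΓ : mobius (Q * hyp t * Q⁻¹) ∈ Γ)
    (hmin : ∀ T : ℝ, 0 < T → Function.Periodic (fun s => HypSurface.mk Γ (Q • axis s)) T →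
      2 * t ≤ T) : ClosedGeodesic Γ where
  toFun s := HypSurface.mk Γ (Q • axis s)
  length := 2 * t
  exists_lift := ⟨fun s => Q • axis s, (isometry_smul ℍ Q).comp isometry_axis, fun _ => rfl⟩
  length_pos := by positivity
  periodic := fun s => by
    refine (HypSurface.mk_eq_mk_iff.2 ⟨_, htΓ, ?_⟩).symm
    rw [mobius_apply, mul_smul, mul_smul, inv_smul_smul, hyp_smul_axis]
  length_le := hmin

theorem closedGeodesicOfAxis_isLift {V Q : GL (Fin 2) ℝ} {t : ℝ} (ht : 0 < t)
    (htΓ : mobius (Q * hyp t * Q⁻¹) ∈ Γ)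
    (hmin : ∀ T : ℝ, 0 < T → Function.Periodic (fun s => HypSurface.mk Γ (Q • axis s)) T →
      2 * t ≤ T) (hV : mobius V ∈ Γ) :
    (closedGeodesicOfAxis Γ Q ht htΓ hmin).IsLift fun s => V • Q • axis s :=
  ⟨((isometry_smul ℍ V).comp (isometry_smul ℍ Q)).comp isometry_axis,
    fun s => (HypSurface.mk_apply hV (Q • axis s)).symm⟩

theorem ctr_hyp_left (t : ℝ) {V : GL (Fin 2) ℝ} (hV : V.val.det = 1) :
    ctr (hyp t) V = 2 - V 0 1 * V 1 0 * (Real.exp t - Real.exp (-t)) ^ 2 := by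
  refine (ctr_diag _ hV).trans ?_
  rw [← Real.exp_add, add_neg_cancel, Real.exp_zero, div_one]

/-- An element `A` of large trace, for which the trace of the commutator with `V` has a given value,
represents a closed geodesic covered by its axis `l`. The projection to `l` of the image `m` of `l`
under `V` has a length determined by these two traces. -/
theorem IsSurfaceGroup.exists_closedGeodesic (hΓ : IsSurfaceGroup Γ) (hP : P ≤ Γ)
    {V : GL (Fin 2) ℝ} (hV : V.val.det = 1) (hVtr : 2 < V.val.trace) (hVP : mobius V ∈ P) {κ : ℝ}
    (hκ : κ ≠ 2) :
    ∃ τ₀ : ℝ, ∀ A : GL (Fin 2) ℝ, A.val.det = 1 → mobius A ∈ P → ctr A V = κ → τ₀ < A.val.trace →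
      ∃ (t : ℝ) (δ : ClosedGeodesic P) (γ : ClosedGeodesic Γ) (l m : Set ℍ),
        0 < t ∧ A.val.trace = Real.exp t + Real.exp (-t) ∧ γ.length = 2 * t ∧
        δ.IsRepresentedBy (mobius A) ∧ ClosedGeodesic.ProjectsTo hP δ γ ∧
        δ.IsLineAbove l ∧ δ.IsLineAbove m ∧ γ.IsLineAbove l ∧ γ.IsLineAbove m ∧
        orthProjLength m l =
          ENNReal.ofReal (Real.log (1 - (Real.exp t - Real.exp (-t)) ^ 2 / (κ - 2))) ∧
        (2 < κ → l ≠ m ∧ (l ∩ m).Nonempty) ∧ (κ < 2 → Disjoint l m) := by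
  obtain ⟨ε, hε, hgap⟩ := hΓ.exists_ctr_gap hV hVtr (hP hVP)
  have hk : κ - 2 ≠ 0 := sub_ne_zero.2 hκ
  have hk0 : 0 < |κ - 2| := abs_pos.2 hk
  -- `τ² - 4` has to exceed both `2 |κ - 2|` and `4 τ |κ - 2| / ε`
  refine ⟨3 + 2 * |κ - 2| + 8 * |κ - 2| / ε, fun A hA hAP hAκ hτ => ?_⟩
  have hq : 0 < 8 * |κ - 2| / ε := by positivity
  obtain ⟨Q, t, ht, htr, hQ⟩ := exists_conj_eq_hyp A hA (by linarith)
  have hAQ : Q * hyp t * Q⁻¹ = A := by rw [← hQ]; group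
  have hE : Real.exp t * Real.exp (-t) = 1 := by rw [← Real.exp_add]; simp
  set D := (Real.exp t - Real.exp (-t)) ^ 2 with hD
  set τ := A.val.trace with hτdef
  have hDτ : D = τ ^ 2 - 4 := by rw [htr, hD]; linear_combination -4 * hE
  have hD1 : 2 * |κ - 2| < D := by rw [hDτ]; nlinarith
  have hD2 : |κ - 2| * (4 * τ) < ε * D := by
    have h1 : 8 * |κ - 2| < ε * τ := by
      rw [mul_comm ε, ← div_lt_iff₀ hε]; linarith
    have h2 : τ ^ 2 / 2 < D := by rw [hDτ]; nlinarith
    have h3 : ε * (τ ^ 2 / 2) < ε * D := mul_lt_mul_of_pos_left h2 hε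
    have h4 : 8 * |κ - 2| * τ < ε * τ * τ := mul_lt_mul_of_pos_right h1 (by linarith)
    linarith
  have hD0 : 0 < D := by linarith
  have htP : mobius (Q * hyp t * Q⁻¹) ∈ P := by rwa [hAQ]
  have hV' : (Q⁻¹ * V * Q).val.det = 1 := by rw [det_conj, hV]
  have hbc : (Q⁻¹ * V * Q) 0 1 * (Q⁻¹ * V * Q) 1 0 = -(κ - 2) / D := by
    have h1 : κ = ctr (hyp t) (Q⁻¹ * V * Q) := by rw [← hQ, ctr_conj, hAκ]
    rw [eq_div_iff hD0.ne', h1, ctr_hyp_left t hV']; ring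
  obtain ⟨W, hW⟩ : ∃ W, W = Q⁻¹ * V * Q := ⟨_, rfl⟩
  have hbc_ne : -(κ - 2) / D ≠ 0 := div_ne_zero (neg_ne_zero.2 hk) hD0.ne'
  have hmin : ∀ T : ℝ, 0 < T → Function.Periodic (fun s => HypSurface.mk Γ (Q • axis s)) T →
      2 * t ≤ T := by
    intro T hT0 hT
    refine hΓ.length_le_of_periodic hV (hP htP) hgap (by rw [hbc]; exact hbc_ne) ?_ hT0 hT
    rw [hbc, abs_div, abs_neg, abs_of_pos hD0, div_mul_eq_mul_div, div_lt_iff₀ hD0]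
    refine lt_of_le_of_lt ?_ hD2
    have := Real.exp_pos (-t)
    exact mul_le_mul_of_nonneg_left (by linarith) hk0.le
  have hminP : ∀ T : ℝ, 0 < T → Function.Periodic (fun s => HypSurface.mk P (Q • axis s)) T →
      2 * t ≤ T := by
    intro T hT0 hT
    refine hmin T hT0 fun s => ?_
    obtain ⟨g, hg, h⟩ := HypSurface.mk_eq_mk_iff.1 (hT s)
    exact HypSurface.mk_eq_mk_iff.2 ⟨g, hP hg, h⟩
  rw [← hW] at hbc hV'
  have hl : Set.range (fun s => Q • axis s) = mobius Q '' Set.range axis := by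
    rw [← Set.range_comp]; rfl
  have hm : Set.range (fun s => V • Q • axis s) = mobius Q '' Set.range (fun s => W • axis s) := by
    rw [← Set.range_comp]
    congr 1
    funext s
    rw [Function.comp_apply, mobius_apply, hW, mul_assoc, mul_smul, smul_inv_smul, mul_smul]
  have hhalf : -(1 / 2) < -(κ - 2) / D := by
    rw [lt_div_iff₀ hD0]
    have := le_abs_self (κ - 2)
    linarith
  have h1P : mobius (1 : GL (Fin 2) ℝ) ∈ P := by rw [map_one]; exact P.one_mem
  have hδ₁ := closedGeodesicOfAxis_isLift (V := 1) ht htP hminP h1P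
  have hγ₁ := closedGeodesicOfAxis_isLift (V := 1) ht (hP htP) hmin (hP h1P)
  simp only [one_smul] at hδ₁ hγ₁
  refine ⟨t, closedGeodesicOfAxis P Q ht htP hminP, closedGeodesicOfAxis Γ Q ht (hP htP) hmin,
    Set.range (fun s => Q • axis s), Set.range (fun s => V • Q • axis s), ht, htr, rfl,
    ⟨hAP, _, hδ₁, fun s => ?_⟩, ⟨rfl, fun s => rfl⟩, ⟨_, hδ₁, rfl⟩,
    ⟨_, closedGeodesicOfAxis_isLift ht htP hminP hVP, rfl⟩, ⟨_, hγ₁, rfl⟩,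
    ⟨_, closedGeodesicOfAxis_isLift ht (hP htP) hmin (hP hVP), rfl⟩, ?_, ?_, ?_⟩
  · rw [← hAQ, mobius_apply, mul_smul, mul_smul, inv_smul_smul, hyp_smul_axis]; rfl
  · rw [hl, hm, orthProjLength_image, orthProjLength_smul_axis hV' (by rw [hbc]; exact hbc_ne)
      (by rw [hbc]; exact hhalf), hbc]
    rw [one_div_div, div_neg, ← sub_eq_add_neg]
  · intro hκ2
    have h := crossing_smul_axis hV' (by rw [hbc]; exact div_neg_of_neg_of_pos (by linarith) hD0)
      (by rw [hbc]; exact hhalf)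
    rw [hl, hm, ← Set.image_inter (mobius Q).injective]
    exact ⟨fun he => h.1 ((mobius Q).injective.image_injective he), h.2.image _⟩
  · intro hκ2
    rw [hl, hm, Set.disjoint_image_iff (mobius Q).injective]
    exact disjoint_smul_axis hV' (by rw [hbc]; exact div_pos (by linarith) hD0)

/-- Both `log |1 - (e^t - e^(-t))² / k|` and `2 t` are `2 t` up to a bounded error. -/
theorem tendsto_log_ratio {k : ℝ} (hk : k ≠ 0) :
    Tendsto (fun t : ℝ => Real.log (1 - (Real.exp t - Real.exp (-t)) ^ 2 / k) / (2 * t)) atTop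
      (𝓝 1) := by
  have hexp : Tendsto (fun t : ℝ => Real.exp (-(2 * t))) atTop (𝓝 0) :=
    Real.tendsto_exp_neg_atTop_nhds_zero.comp (tendsto_id.const_mul_atTop two_pos)
  have h1 : Tendsto (fun t : ℝ => Real.exp (-(2 * t)) - (1 - Real.exp (-(2 * t))) ^ 2 / k) atTop
      (𝓝 (0 - (1 - 0) ^ 2 / k)) :=
    hexp.sub (((tendsto_const_nhds.sub hexp).pow 2).div_const k)
  have hne : (0 : ℝ) - (1 - 0) ^ 2 / k ≠ 0 := by simpa using hk
  have h2 := (h1.log hne)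
  have h3 : Tendsto (fun t : ℝ => 2 * t) atTop atTop := tendsto_id.const_mul_atTop two_pos
  have h4 := (h2.div_atTop h3).const_add 1
  rw [add_zero] at h4
  refine h4.congr' ?_
  filter_upwards [h1.eventually_ne hne, eventually_gt_atTop 0] with t ht ht0
  have e : 1 - (Real.exp t - Real.exp (-t)) ^ 2 / k =
      Real.exp (2 * t) * (Real.exp (-(2 * t)) - (1 - Real.exp (-(2 * t))) ^ 2 / k) := by
    have e1 : Real.exp (2 * t) = Real.exp t ^ 2 := by rw [← Real.exp_nat_mul]; norm_num
    have e2 : Real.exp (-(2 * t)) = Real.exp (-t) ^ 2 := by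
      rw [← Real.exp_nat_mul]; congr 1; push_cast; ring
    have hE : Real.exp t * Real.exp (-t) = 1 := by rw [← Real.exp_add]; simp
    rw [e1, e2]
    field_simp
    generalize Real.exp t = x at *
    generalize Real.exp (-t) = y at *
    have : x ^ 2 * y ^ 2 = 1 := by rw [← mul_pow, hE, one_pow]
    have e3 : x ^ 2 * (y ^ 2 * k - (1 - y ^ 2) ^ 2) =
      k * (x ^ 2 * y ^ 2) - (x - (x * y) * y) ^ 2 := by ring
    rw [e3, this, hE]; ring
  rw [e, Real.log_mul (Real.exp_pos _).ne' ht, Real.log_exp, add_div, div_self (by positivity)]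

/-- A sequence of elements of `P` with traces tending to infinity whose commutators with `V` all
have the same trace gives a sequence of closed geodesics as desired. -/
theorem IsSurfaceGroup.exists_closedGeodesic_seq (hΓ : IsSurfaceGroup Γ) (hP : P ≤ Γ)
    {V : GL (Fin 2) ℝ} (hV : V.val.det = 1) (hVtr : 2 < V.val.trace) (hVP : mobius V ∈ P) {κ : ℝ}
    (hκ : κ ≠ 2) (A : ℕ → GL (Fin 2) ℝ) (hA : ∀ n, (A n).val.det = 1) (hAP : ∀ n, mobius (A n) ∈ P)
    (hAκ : ∀ n, ctr (A n) V = κ) (hlim : Tendsto (fun n => |(A n).val.trace|) atTop atTop) :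
    ∃ (N : ℕ) (δ : ℕ → ClosedGeodesic P) (γ : ℕ → ClosedGeodesic Γ) (l m : ℕ → Set ℍ),
      (∀ n, ((δ n).IsRepresentedBy (mobius (A (N + n))) ∧
        ClosedGeodesic.ProjectsTo hP (δ n) (γ n) ∧
        (δ n).IsLineAbove (l n) ∧ (δ n).IsLineAbove (m n) ∧
        (γ n).IsLineAbove (l n) ∧ (γ n).IsLineAbove (m n)) ∧
        (2 < κ → l n ≠ m n ∧ (l n ∩ m n).Nonempty) ∧ (κ < 2 → Disjoint (l n) (m n))) ∧
      Tendsto (fun n => orthProjLength (m n) (l n) / ENNReal.ofReal (γ n).length) atTop (𝓝 1) := by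
  obtain ⟨τ₀, hτ₀⟩ := hΓ.exists_closedGeodesic hP hV hVtr hVP hκ
  obtain ⟨N, hN⟩ := (hlim.eventually_gt_atTop τ₀).exists_forall_of_atTop
  -- change signs so as to make the traces positive
  have hB : ∀ n, ∃ B : GL (Fin 2) ℝ, B.val.det = 1 ∧ mobius B = mobius (A (N + n)) ∧
      ctr B V = κ ∧ B.val.trace = |(A (N + n)).val.trace| := by
    intro n
    rcases abs_choice (A (N + n)).val.trace with h | h
    · exact ⟨_, hA _, rfl, hAκ _, h.symm⟩
    · refine ⟨-A (N + n), by simp [Matrix.det_neg, hA], mobius_neg _, ?_, by simp [h]⟩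
      rw [← hAκ (N + n), ctr, ctr]
      congr 2
      rw [inv_neg]
      simp only [neg_mul, mul_neg, neg_neg]
  choose B hBdet hBA hBκ hBtr using hB
  have hex := fun n => hτ₀ (B n) (hBdet n) (by rw [hBA]; exact hAP _) (hBκ n)
    (by rw [hBtr]; exact hN _ (Nat.le_add_right N n))
  choose t δ γ l m ht htr hlen hrep hproj h1 h2 h3 h4 horth hcross hdisj using hex
  refine ⟨N, δ, γ, l, m, fun n => ⟨⟨hBA n ▸ hrep n, hproj n, h1 n, h2 n, h3 n, h4 n⟩, hcross n,
    hdisj n⟩, ?_⟩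
  have hBlim : Tendsto (fun n => (B n).val.trace) atTop atTop := by
    simp only [hBtr]
    exact hlim.comp (tendsto_atTop_mono (fun n => Nat.le_add_left n N) tendsto_id)
  have htlim : Tendsto t atTop atTop := by
    refine tendsto_atTop_mono' _ ?_
      (Real.tendsto_log_atTop.comp (tendsto_atTop_add_const_right _ (-1) hBlim))
    filter_upwards [hBlim.eventually_gt_atTop 1] with n hn
    rw [Function.comp_apply, Real.log_le_iff_le_exp (by linarith), htr]
    have : Real.exp (-t n) ≤ 1 := Real.exp_le_one_iff.2 (by linarith [ht n])
    linarith
  have hr := (ENNReal.continuous_ofReal.tendsto 1).comp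
    ((tendsto_log_ratio (sub_ne_zero.2 hκ)).comp htlim)
  rw [ENNReal.ofReal_one] at hr
  refine hr.congr fun n => ?_
  rw [horth, hlen]
  exact ENNReal.ofReal_div_of_pos (by linarith [ht n])

end

noncomputable section

/-! ### The two families of words -/

theorem ctr_pow_mul (U W : GL (Fin 2) ℝ) (k : ℕ) : ctr (U ^ k * W) U = ctr W U := by
  have h : U ^ k * W * U * (U ^ k * W)⁻¹ * U⁻¹ = U ^ k * (W * U * W⁻¹ * U⁻¹) * (U ^ k)⁻¹ := by
    have hc : (U ^ k)⁻¹ * U⁻¹ = U⁻¹ * (U ^ k)⁻¹ := by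
      rw [← mul_inv_rev, ← mul_inv_rev, pow_mul_comm']
    rw [mul_inv_rev]
    simp only [mul_assoc, hc]
  rw [ctr, h, trace_conj_inv, ctr]

/-- The trace of `U ^ k * W` tends to infinity if `W` does not carry one end of the axis of `U` to
the other, which the condition on the trace of the commutator excludes. -/
theorem tendsto_abs_trace_pow_mul {U W : GL (Fin 2) ℝ} (hU : U.val.det = 1)
    (hU2 : 2 < U.val.trace) (hW : W.val.det = 1) (hne : ctr W U ≠ U.val.trace ^ 2 - 2) :
    Tendsto (fun k : ℕ => |(U ^ k * W).val.trace|) atTop atTop := by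
  obtain ⟨Q, t, ht, htr, hQ⟩ := exists_conj_eq_hyp U hU hU2
  have hdet : (Q⁻¹ * W * Q).val.det = 1 := by rw [det_conj, hW]
  have hE : Real.exp t * Real.exp (-t) = 1 := by rw [← Real.exp_add]; simp
  have htrace : ∀ k : ℕ, (U ^ k * W).val.trace =
      Real.exp (k * t) * (Q⁻¹ * W * Q) 0 0 + Real.exp (-(k * t)) * (Q⁻¹ * W * Q) 1 1 := by
    intro k
    have h1 : Q⁻¹ * (U ^ k * W) * Q = hyp (k * t) * (Q⁻¹ * W * Q) := by
      rw [← hyp_pow, ← hQ]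
      have h2 : (Q⁻¹ * U * Q) ^ k = Q⁻¹ * U ^ k * Q := by
        have := conj_pow (i := k) (a := Q⁻¹) (b := U)
        rwa [inv_inv] at this
      rw [h2]; group
    rw [← trace_conj Q, h1, Units.val_mul, hyp_val, Matrix.trace_fin_two, Matrix.mul_apply,
      Matrix.mul_apply]
    simp [Fin.sum_univ_two]
  have hctr : ctr W U = ctr (Q⁻¹ * W * Q) (hyp t) := by rw [← hQ, ctr_conj]
  rw [ctr_hyp, hdet, div_one] at hctr
  rw [det_eq] at hdet
  have ha : (Q⁻¹ * W * Q) 0 0 ≠ 0 := by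
    intro ha
    rw [ha, zero_mul, zero_sub] at hdet
    refine hne ?_
    rw [hctr, htr]
    linear_combination (Real.exp t - Real.exp (-t)) ^ 2 * hdet - 4 * hE
  have hlim : Tendsto (fun k : ℕ => Real.exp (k * t) * |(Q⁻¹ * W * Q) 0 0| +
      -|(Q⁻¹ * W * Q) 1 1|) atTop atTop := by
    refine tendsto_atTop_add_const_right _ _ (Tendsto.atTop_mul_const (abs_pos.2 ha) ?_)
    exact Real.tendsto_exp_atTop.comp (tendsto_natCast_atTop_atTop.atTop_mul_const ht)
  refine tendsto_atTop_mono (fun k => ?_) hlim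
  rw [htrace]
  have h1 : Real.exp (-(k * t)) ≤ 1 := Real.exp_le_one_iff.2 (by have := ht.le; simp; positivity)
  have h2 := abs_sub_abs_le_abs_sub (Real.exp (k * t) * (Q⁻¹ * W * Q) 0 0)
    (-(Real.exp (-(k * t)) * (Q⁻¹ * W * Q) 1 1))
  rw [abs_neg, abs_mul, abs_mul, Real.abs_exp, Real.abs_exp, sub_neg_eq_add] at h2
  have h3 := mul_le_mul_of_nonneg_right h1 (abs_nonneg ((Q⁻¹ * W * Q) 1 1))
  linarith

theorem trace_mul_mul_mul {X Y : GL (Fin 2) ℝ} (hX : X.val.det = 1) (hY : Y.val.det = 1) :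
    (Y * X * (X * Y)).val.trace = X.val.trace * Y.val.trace * (X * Y).val.trace
      - X.val.trace ^ 2 - Y.val.trace ^ 2 + 2 := by
  rw [det_eq] at hX hY
  simp only [Units.val_mul, Matrix.trace_fin_two, Matrix.mul_apply, Fin.sum_univ_two]
  linear_combination (-(Y 0 0 + Y 1 1) ^ 2 + 2 * (Y 0 0 * Y 1 1 - Y 0 1 * Y 1 0)) * hX +
    (-(X 0 0 + X 1 1) ^ 2 + 2) * hY

/-- The values of `ctr (Y * X) (X * Y) - 2` and `ctr X Y - 2` have opposite signs, their quotient
being the negative of the quantity in `hpos`. -/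
theorem ctr_mul_mul_lt_two {X Y : GL (Fin 2) ℝ} (hX : X.val.det = 1) (hY : Y.val.det = 1)
    (hκ : 2 < ctr X Y)
    (hpos : 0 < X.val.trace * Y.val.trace * (X * Y).val.trace - X.val.trace ^ 2 - Y.val.trace ^ 2) :
    ctr (Y * X) (X * Y) < 2 := by
  have hXY : (X * Y).val.det = 1 := by rw [Units.val_mul, Matrix.det_mul, hX, hY, one_mul]
  have hYX : (Y * X).val.det = 1 := by rw [Units.val_mul, Matrix.det_mul, hX, hY, one_mul]
  have htr : (Y * X).val.trace = (X * Y).val.trace := by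
    rw [Units.val_mul, Units.val_mul, Matrix.trace_mul_comm]
  have h := ctr_eq hYX hXY
  rw [trace_mul_mul_mul hX hY, htr] at h
  rw [ctr_eq hX hY] at hκ
  have h1 := mul_pos hpos (sub_pos.2 hκ)
  rw [h]
  linarith

end

theorem mainTheorem6 (Γ : Subgroup (ℍ ≃ᵢ ℍ)) (hΓ : IsSurfaceGroup Γ)
    (hχ : surfaceEulerChar (HypSurface Γ) < 0) :
    ∃ (x y : ℍ ≃ᵢ ℍ) (hP : Subgroup.closure {x, y} ≤ Γ),
      IsThreeHoledSpherePair x y ∧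
      -- crossing lines, with the words `(xy)^k x`
      (∃ (N : ℕ) (δ : ℕ → ClosedGeodesic (Subgroup.closure {x, y})) (γ : ℕ → ClosedGeodesic Γ)
          (l m : ℕ → Set ℍ),
        (∀ n, (δ n).IsRepresentedBy ((x * y) ^ (N + n) * x) ∧
          ClosedGeodesic.ProjectsTo hP (δ n) (γ n) ∧
          (δ n).IsLineAbove (l n) ∧ (δ n).IsLineAbove (m n) ∧
          (γ n).IsLineAbove (l n) ∧ (γ n).IsLineAbove (m n) ∧
          l n ≠ m n ∧ (l n ∩ m n).Nonempty) ∧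
        Tendsto (fun n => orthProjLength (m n) (l n) / ENNReal.ofReal (γ n).length)
          atTop (𝓝 1)) ∧
      -- disjoint lines, with the words `x (xy)^k y`
      (∃ (N : ℕ) (δ : ℕ → ClosedGeodesic (Subgroup.closure {x, y})) (γ : ℕ → ClosedGeodesic Γ)
          (l m : ℕ → Set ℍ),
        (∀ n, (δ n).IsRepresentedBy (x * (x * y) ^ (N + n) * y) ∧
          ClosedGeodesic.ProjectsTo hP (δ n) (γ n) ∧
          (δ n).IsLineAbove (l n) ∧ (δ n).IsLineAbove (m n) ∧
          (γ n).IsLineAbove (l n) ∧ (γ n).IsLineAbove (m n) ∧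
          Disjoint (l n) (m n)) ∧
        Tendsto (fun n => orthProjLength (m n) (l n) / ENNReal.ofReal (γ n).length)
          atTop (𝓝 1)) := by
  obtain ⟨X, Y, hX, hY, hXΓ, hYΓ, hX2, hY2, hXY2⟩ :=
    hΓ.exists_separated_pair (not_cyclic_of_eulerChar_neg hΓ hχ)
  have hκ := two_lt_ctr hX hY hX2 hY2 hXY2
  have hP : Subgroup.closure {mobius X, mobius Y} ≤ Γ := by
    rw [Subgroup.closure_le]
    rintro g (rfl | rfl)
    · exact hXΓ
    · exact hYΓ
  have hXP : mobius X ∈ Subgroup.closure {mobius X, mobius Y} :=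
    Subgroup.subset_closure (Set.mem_insert _ _)
  have hYP : mobius Y ∈ Subgroup.closure {mobius X, mobius Y} :=
    Subgroup.subset_closure (Set.mem_insert_of_mem _ rfl)
  have hUP : mobius (X * Y) ∈ Subgroup.closure {mobius X, mobius Y} := by
    rw [map_mul]; exact Subgroup.mul_mem _ hXP hYP
  have hU : (X * Y).val.det = 1 := by rw [Units.val_mul, Matrix.det_mul, hX, hY, one_mul]
  have hz : X.val.trace * Y.val.trace + 2 < (X * Y).val.trace := by
    rw [trace_inv_mul hX] at hXY2; linarith
  have hxy : 4 < X.val.trace * Y.val.trace := by nlinarith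
  have hU2 : 2 < (X * Y).val.trace := by linarith
  have hpos : 0 < X.val.trace * Y.val.trace * (X * Y).val.trace -
      X.val.trace ^ 2 - Y.val.trace ^ 2 := by
    have h1 := mul_pos (show 0 < X.val.trace * Y.val.trace by linarith) (sub_pos.2 hz)
    have h2 := mul_pos (show 0 < X.val.trace ^ 2 - 2 by nlinarith)
      (show 0 < Y.val.trace ^ 2 - 2 by nlinarith)
    nlinarith
  have hκ' := ctr_mul_mul_lt_two hX hY hκ hpos
  refine ⟨mobius X, mobius Y, hP, isThreeHoledSpherePair_mobius hX hY hX2 hY2 hXY2, ?_, ?_⟩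
  · have hctr : ctr X (X * Y) = ctr X Y := by
      rw [ctr, show X * (X * Y) * X⁻¹ * (X * Y)⁻¹ = X * (X * Y * X⁻¹ * Y⁻¹) * X⁻¹ by group,
        trace_conj_inv, ctr]
    obtain ⟨N, δ, γ, l, m, h, hlim⟩ := hΓ.exists_closedGeodesic_seq hP hU hU2 hUP hκ.ne'
      (fun k => (X * Y) ^ k * X)
      (fun k => by
        rw [Units.val_mul, Matrix.det_mul, hX, Units.val_pow_eq_pow_val, Matrix.det_pow, hU,
          one_pow, one_mul])
      (fun k => by
        rw [map_mul, map_pow]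
        exact Subgroup.mul_mem _ (Subgroup.pow_mem _ hUP k) hXP)
      (fun k => by rw [ctr_pow_mul, hctr])
      (tendsto_abs_trace_pow_mul hU hU2 hX (by
        rw [hctr, ctr_eq hX hY]
        intro h
        linarith))
    refine ⟨N, δ, γ, l, m, fun n => ?_, hlim⟩
    obtain ⟨⟨h1, h2, h3, h4, h5, h6⟩, h7, -⟩ := h n
    refine ⟨?_, h2, h3, h4, h5, h6, h7 hκ⟩
    rwa [map_mul, map_pow, map_mul] at h1
  · have hconj : ∀ k : ℕ, X⁻¹ * (X * (X * Y) ^ k * Y) * X = (X * Y) ^ k * (Y * X) := fun k => by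
      group
    have hYX : (Y * X).val.det = 1 := by rw [Units.val_mul, Matrix.det_mul, hX, hY, one_mul]
    have htr : ∀ k : ℕ, (X * (X * Y) ^ k * Y).val.trace = ((X * Y) ^ k * (Y * X)).val.trace :=
      fun k => by rw [← hconj, trace_conj]
    obtain ⟨N, δ, γ, l, m, h, hlim⟩ := hΓ.exists_closedGeodesic_seq hP (V := X * (X * Y) * X⁻¹)
      (by rw [det_conj_inv, hU]) (by rwa [trace_conj_inv])
      (by
        rw [map_mul, map_mul, map_inv]
        exact Subgroup.mul_mem _ (Subgroup.mul_mem _ hXP hUP) (Subgroup.inv_mem _ hXP))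
      hκ'.ne (fun k => X * (X * Y) ^ k * Y)
      (fun k => by
        rw [Units.val_mul, Units.val_mul, Matrix.det_mul, Matrix.det_mul, hX, hY,
          Units.val_pow_eq_pow_val, Matrix.det_pow, hU, one_pow, one_mul, one_mul])
      (fun k => by
        rw [map_mul, map_mul, map_pow]
        exact Subgroup.mul_mem _ (Subgroup.mul_mem _ hXP (Subgroup.pow_mem _ hUP k)) hYP)
      (fun k => by
        rw [← ctr_conj X, hconj, show X⁻¹ * (X * (X * Y) * X⁻¹) * X = X * Y by group, ctr_pow_mul])
      (by
        simp only [htr]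
        refine tendsto_abs_trace_pow_mul hU hU2 hYX fun h => ?_
        rw [h] at hκ'
        nlinarith)
    refine ⟨N, δ, γ, l, m, fun n => ?_, hlim⟩
    obtain ⟨⟨h1, h2, h3, h4, h5, h6⟩, -, h7⟩ := h n
    refine ⟨?_, h2, h3, h4, h5, h6, h7 hκ'⟩
    rwa [map_mul, map_mul, map_pow, map_mul] at h1
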